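/- **Theorem (existence and uniqueness).** Let $d\ge 2$, let $\Omega\subset\mathbb R^d$ be a bounded Lipschitz domain, $\nu>0$, $\boldsymbol f\in L^2(\Omega)^d$ and $k\ge 0$ an integer. *Mesh.* Let $(\mathcal T_h,\mathcal F_h)$ be a finite curved mesh of $\Omega$. The elements $T\in\mathcal T_h$ are pairwise disjoint, open, simply connected subsets of $\Omega$ with piecewise $C^1$ boundary and $\overline\Omega=\bigcup_{T}\overline T$. The faces $F\in\mathcal F_h$ are pairwise disjoint $C^1$ hypersurfaces of finite area, each with relative boundary $\overline F\setminus F$ of zero area, and $\bigcup_T\partial T=\bigcup_F\overline F$. For each $F$ either there are two distinct elements $T_1,T_2$ with $F\subset\partial T_1\cap\partial T_2$, or there is an element $T$ with $F\subset\partial T\cap\partial\Omega$. Whenever $F\subset\partial T$, $F$ is relatively open in $\partial T$ and, near each point of $F$, $\partial T$ is of class $C^1$ with $T$ on one side; $\boldsymbol n_{TF}$ is the unit normal on $F$ pointing out of $T$. The mesh is regular: there is $\varrho>0$ such that every $T$ is connected by star-shaped sets with parameter $\varrho$ (in particular $T$ is a finite union of sets, each star-shaped with respect to every point of a ball of radius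 $\varrho h_T$, $h_T=\operatorname{diam}T$). Write $\mathcal F_T=\{F:F\subset\partial T\}$ and $\mathcal T_F=\{T:F\subset\partial T\}$. *Enrichment.* For each $T$ let $\boldsymbol\Psi(T)\subset H^1(T)^d$ and $\Phi(T)\subset H^1(T)$ be finite-dimensional spaces with $\boldsymbol\Delta\boldsymbol\Psi(T)\subset L^2(T)^d$ and $\nabla\boldsymbol\Psi(T)\,\boldsymbol n_{TF}\subset L^2(F)^d$ for all $F\in\mathcal F_T$. Boundary values on $F$ are understood as traces, i.e. as approximate limits from inside $T$ at almost every point of $F$. *Discrete spaces.* $\mathbb P^\ell$ denotes polynomials of total degree at most $\ell$. On a face with unit normal $\boldsymbol n_F$, let $\boldsymbol{\mathcal P}^k(F)=(\mathbb P^0)^d|_F+(\mathbb P^k)^{d\times d}|_F\,\boldsymbol n_F$. Define $$\boldsymbol{\mathcal P}^{k+1,\Psi}(T)=\mathbb P^{k+1}(T)^d+\boldsymbol\Psi(T),\qquad \boldsymbol{\mathcal P}^{k,\Delta}(T)=\mathbb P^{k}(T)^d+\boldsymbol\Delta\boldsymbol\Psi(T)+\nabla\Phi(T),$$ $$\boldsymbol{\mathcal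 P}^{k,n}(F)=\boldsymbol{\mathcal P}^k(F)+\sum_{T\in\mathcal T_F}\big(\nabla\boldsymbol\Psi(T)\boldsymbol n_{TF}+\Phi(T)\boldsymbol n_{TF}\big),\qquad \mathcal P^{k,\Phi}(T)=\mathbb P^k(T)+\Phi(T).$$ Let $\underline{\boldsymbol U}_T=\boldsymbol{\mathcal P}^{k,\Delta}(T)\times\prod_{F\in\mathcal F_T}\boldsymbol{\mathcal P}^{k,n}(F)$ and $\underline{\boldsymbol U}_h=\prod_T\boldsymbol{\mathcal P}^{k,\Delta}(T)\times\prod_F\boldsymbol{\mathcal P}^{k,n}(F)$. Let $\underline{\boldsymbol U}_{h,0}$ be the subspace of those $\underline{\boldsymbol v}_h\in\underline{\boldsymbol U}_h$ with $\boldsymbol v_F=\boldsymbol 0$ for all $F\subset\partial\Omega$, and let $$\mathcal P^{k,\Phi}_0=\Big\{z\in L^2(\Omega): z|_T\in\mathcal P^{k,\Phi}(T)\ \ \forall T\in\mathcal T_h,\ \int_\Omega z=0\Big\}.$$ *Operators and forms.* For $\underline{\boldsymbol v}_T\in\underline{\boldsymbol U}_T$ let $\boldsymbol r_T\underline{\boldsymbol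 v}_T\in\boldsymbol{\mathcal P}^{k+1,\Psi}(T)$ and $D_T\underline{\boldsymbol v}_T\in\mathcal P^{k,\Phi}(T)$ be given by $$\int_T\nabla \boldsymbol r_T\underline{\boldsymbol v}_T:\nabla\boldsymbol w=-\int_T\boldsymbol v_T\cdot\boldsymbol\Delta\boldsymbol w+\sum_{F\in\mathcal F_T}\int_F\boldsymbol v_F\cdot(\nabla\boldsymbol w)\boldsymbol n_{TF}\quad\forall\boldsymbol w\in\boldsymbol{\mathcal P}^{k+1,\Psi}(T),\qquad\int_T(\boldsymbol r_T\underline{\boldsymbol v}_T-\boldsymbol v_T)=\boldsymbol 0,$$ $$\int_T D_T\underline{\boldsymbol v}_T\,q=-\int_T\boldsymbol v_T\cdot\nabla q+\sum_{F\in\mathcal F_T}\int_F\boldsymbol v_F\cdot q\,\boldsymbol n_{TF}\quad\forall q\in\mathcal P^{k,\Phi}(T).$$ Let $\boldsymbol\pi_T,\boldsymbol\pi_F$ be the $L^2$-orthogonal projectors on $\boldsymbol{\mathcal P}^{k,\Delta}(T)$ and $\boldsymbol{\mathcal P}^{k,n}(F)$, let $\underline{\boldsymbol I}_T\boldsymbol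 w=(\boldsymbol\pi_T\boldsymbol w,(\boldsymbol\pi_F\boldsymbol w)_{F\in\mathcal F_T})$, and let $$\|\underline{\boldsymbol v}_T\|_{1,T}^2=\|\nabla\boldsymbol r_T\underline{\boldsymbol v}_T\|_T^2+h_T^{-2}\|\boldsymbol v_T-\boldsymbol\pi_T\boldsymbol r_T\underline{\boldsymbol v}_T\|_T^2+h_T^{-1}\sum_{F\in\mathcal F_T}\|\boldsymbol v_F-\boldsymbol\pi_F\boldsymbol r_T\underline{\boldsymbol v}_T\|_F^2 .$$ For each $T$ let the stabilisation $s_T$ be either a symmetric positive semi-definite bilinear form on $\underline{\boldsymbol U}_T$ for which there is $C>0$ with $C^{-1}\|\underline{\boldsymbol v}_T-\underline{\boldsymbol I}_T\boldsymbol r_T\underline{\boldsymbol v}_T\|_{1,T}^2\le s_T(\underline{\boldsymbol v}_T,\underline{\boldsymbol v}_T)\le C\|\underline{\boldsymbol v}_T-\underline{\boldsymbol I}_T\boldsymbol r_T\underline{\boldsymbol v}_T\|_{1,T}^2$ for all $\underline{\boldsymbol v}_T$, or the explicit form $$s_T(\underline{\boldsymbol u}_T,\underline{\boldsymbol v}_T)=h_T^{-2}\int_T(\boldsymbol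 u_T-\boldsymbol\pi_T\boldsymbol r_T\underline{\boldsymbol u}_T)\cdot(\boldsymbol v_T-\boldsymbol\pi_T\boldsymbol r_T\underline{\boldsymbol v}_T)+h_T^{-1}\sum_{F\in\mathcal F_T}\int_F(\boldsymbol u_F-\boldsymbol\pi_F\boldsymbol r_T\underline{\boldsymbol u}_T)\cdot(\boldsymbol v_F-\boldsymbol\pi_F\boldsymbol r_T\underline{\boldsymbol v}_T),$$ where in the explicit form one may also take for $\boldsymbol\pi_T,\boldsymbol\pi_F$ the $L^2$-orthogonal projectors on $\mathbb P^k(T)^d$ and $\boldsymbol{\mathcal P}^k(F)$. Put $$a_h(\underline{\boldsymbol v}_h,\underline{\boldsymbol w}_h)=\sum_T\Big(\int_T\nabla\boldsymbol r_T\underline{\boldsymbol v}_T:\nabla\boldsymbol r_T\underline{\boldsymbol w}_T+s_T(\underline{\boldsymbol v}_T,\underline{\boldsymbol w}_T)\Big),\qquad b_h(\underline{\boldsymbol v}_h,q_h)=-\sum_T\int_T D_T\underline{\boldsymbol v}_T\,q_h .$$ *Conclusion.* The operators $\boldsymbol r_T$ and $D_T$ are well defined: their defining equations have exactly one solution for every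 $T$ and every $\underline{\boldsymbol v}_T\in\underline{\boldsymbol U}_T$. There exists a unique $(\underline{\boldsymbol u}_h,p_h)\in\underline{\boldsymbol U}_{h,0}\times\mathcal P^{k,\Phi}_0$ such that $$\nu\,a_h(\underline{\boldsymbol u}_h,\underline{\boldsymbol v}_h)+b_h(\underline{\boldsymbol v}_h,p_h)=\sum_T\int_T\boldsymbol f\cdot\boldsymbol v_T\quad\forall\,\underline{\boldsymbol v}_h\in\underline{\boldsymbol U}_{h,0},\qquad -b_h(\underline{\boldsymbol u}_h,q_h)=0\quad\forall\,q_h\in\mathcal P^{k,\Phi}_0 .$$ -/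

import Mathlib

open MeasureTheory Filter Topology
open scoped ContDiff

noncomputable section

namespace EnrichedHHO

/-! ### Euclidean space, tensors and `L²` spaces -/

/-- The Euclidean space `ℝᵈ`. -/
abbrev E (d : ℕ) := EuclideanSpace ℝ (Fin d)

/-- `d × d` tensors with the Frobenius inner product `A : B = ∑ᵢⱼ Aᵢⱼ Bᵢⱼ`. -/
abbrev Mat (d : ℕ) := EuclideanSpace ℝ (Fin d × Fin d)

/-- The product `M n` of a tensor and a vector. -/
def matVec {d : ℕ} (M : Mat d) (n : E d) : E d :=
  WithLp.toLp 2 fun i => ∑ j, M (i, j) * n j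

/-- `L²(T; V)` for a region `T ⊆ ℝᵈ` (with respect to Lebesgue measure). The inner product
`inner ℝ v w` is `∫_T v · w`. -/
abbrev L2 {d : ℕ} (V : Type*) [NormedAddCommGroup V] (T : Set (E d)) :=
  Lp V 2 ((volume : Measure (E d)).restrict T)

/-- The surface measure on a hypersurface `F ⊆ ℝᵈ`: the `(d-1)`-dimensional Hausdorff measure,
normalised to be the Euclidean area. -/
abbrev surf {d : ℕ} (F : Set (E d)) : Measure (E d) :=
  (Measure.euclideanHausdorffMeasure (d - 1) : Measure (E d)).restrict F

/-- `L²(F; V)` for a hypersurface `F ⊆ ℝᵈ`. -/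
abbrev L2Face {d : ℕ} (V : Type*) [NormedAddCommGroup V] (F : Set (E d)) := Lp V 2 (surf F)

/-- The restriction to `T` of a square-integrable function on `Ω ⊇ T`. -/
def restrictTo {d : ℕ} {V : Type*} [NormedAddCommGroup V] {Ω T : Set (E d)} (h : T ⊆ Ω)
    (z : L2 V Ω) : L2 V T :=
  ((Lp.memLp z).mono_measure (Measure.restrict_mono h le_rfl)).toLp z

open scoped Classical in
/-- The orthogonal projection of `v` on the (finite-dimensional) subspace `K`. -/
def orthProj {H : Type*} [NormedAddCommGroup H] [InnerProductSpace ℝ H] (K : Submodule ℝ H)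
    (v : H) : K :=
  if h : ∃ p : K, ∀ w ∈ K, inner ℝ (v - (p : H)) w = 0 then h.choose else 0

/-! ### Weak derivatives -/

/-- `φ ∈ C_c^∞(T)`. -/
def IsTest {d : ℕ} (T : Set (E d)) (φ : E d → ℝ) : Prop :=
  ContDiff ℝ ∞ φ ∧ HasCompactSupport φ ∧ tsupport φ ⊆ T

/-- The partial derivative `∂ⱼ φ`. -/
def pd {d : ℕ} (j : Fin d) (φ : E d → ℝ) (x : E d) : ℝ :=
  fderiv ℝ φ x (EuclideanSpace.single j 1)

/-- `G ∈ L²(T)ᵈ` is the weak gradient of `q ∈ L²(T)`. -/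
def IsWeakGrad {d : ℕ} (T : Set (E d)) (q : L2 ℝ T) (G : L2 (E d) T) : Prop :=
  ∀ φ : E d → ℝ, IsTest T φ → ∀ j : Fin d,
    ∫ x in T, q x * pd j φ x = -∫ x in T, G x j * φ x

/-- `G ∈ L²(T)^{d×d}` is the weak total derivative of `w ∈ L²(T)ᵈ`: `Gᵢⱼ = ∂ⱼ wᵢ`. -/
def IsWeakJac {d : ℕ} (T : Set (E d)) (w : L2 (E d) T) (G : L2 (Mat d) T) : Prop :=
  ∀ φ : E d → ℝ, IsTest T φ → ∀ i j : Fin d,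
    ∫ x in T, w x i * pd j φ x = -∫ x in T, G x (i, j) * φ x

/-- `L ∈ L²(T)ᵈ` is the weak Laplacian of `w ∈ H¹(T)ᵈ`: `Lᵢ = ∑ⱼ ∂ⱼ ∂ⱼ wᵢ`. -/
def IsWeakLap {d : ℕ} (T : Set (E d)) (w : L2 (E d) T) (L : L2 (E d) T) : Prop :=
  ∃ G : L2 (Mat d) T, IsWeakJac T w G ∧
    ∀ φ : E d → ℝ, IsTest T φ → ∀ i : Fin d,
      ∑ j, ∫ x in T, G x (i, j) * pd j φ x = -∫ x in T, L x i * φ x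

/-- `q ∈ H¹(T)`. -/
def MemH1 {d : ℕ} (T : Set (E d)) (q : L2 ℝ T) : Prop := ∃ G, IsWeakGrad T q G

/-- `w ∈ H¹(T)ᵈ`. -/
def MemH1Vec {d : ℕ} (T : Set (E d)) (w : L2 (E d) T) : Prop := ∃ G, IsWeakJac T w G

open scoped Classical in
/-- `∇q` for `q ∈ H¹(T)`. -/
def weakGrad {d : ℕ} (T : Set (E d)) (q : L2 ℝ T) : L2 (E d) T :=
  if h : ∃ G, IsWeakGrad T q G then h.choose else 0

open scoped Classical in
/-- `∇w` for `w ∈ H¹(T)ᵈ`. -/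
def weakJac {d : ℕ} (T : Set (E d)) (w : L2 (E d) T) : L2 (Mat d) T :=
  if h : ∃ G, IsWeakJac T w G then h.choose else 0

open scoped Classical in
/-- `Δw` for `w ∈ H¹(T)ᵈ` with square-integrable weak Laplacian. -/
def weakLap {d : ℕ} (T : Set (E d)) (w : L2 (E d) T) : L2 (E d) T :=
  if h : ∃ L, IsWeakLap T w L then h.choose else 0

/-! ### Outward normals and traces -/

/-- `T` has a `C¹` boundary near `x ∈ ∂T`, lies on one side of it there, and has the outward unit
normal `n` at `x`: near `x`, `T` is the sublevel set `{ρ < 0}` of a `C¹` function `ρ` with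
`ρ x = 0` and `∇ρ x = n`. -/
def IsOutwardNormal {d : ℕ} (T : Set (E d)) (x n : E d) : Prop :=
  ‖n‖ = 1 ∧ ∃ ρ : E d → ℝ, ContDiffAt ℝ 1 ρ x ∧ ρ x = 0 ∧ gradient ρ x = n ∧
    ∀ᶠ y in 𝓝 x, (y ∈ T ↔ ρ y < 0)

open scoped Classical in
/-- The outward unit normal of `T` at a regular boundary point `x`. -/
def normal {d : ℕ} (T : Set (E d)) (x : E d) : E d :=
  if h : ∃ n, IsOutwardNormal T x n then h.choose else 0

/-- `g ∈ L²(F; V)` is the trace on `F ⊆ ∂T` of `w`: for almost every `x ∈ F` (with respect to the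
surface measure), `w` has the strong approximate limit `g x` at `x` from inside `T`. -/
def IsTrace {d : ℕ} {V : Type*} [NormedAddCommGroup V] (T F : Set (E d))
    (w : L2 V T) (g : L2Face V F) : Prop :=
  ∀ᵐ x ∂(surf F),
    Tendsto (fun r : ℝ => ⨍ y in T ∩ Metric.ball x r, ‖w y - g x‖) (𝓝[>] 0) (𝓝 0)

/-- `g ∈ L²(F)ᵈ` is the normal trace `(∇w) n` on `F ⊆ ∂T` of the total derivative of
`w ∈ H¹(T)ᵈ`, where `n` is the outward unit normal of `T`. -/
def IsNormalTrace {d : ℕ} (T F : Set (E d)) (w : L2 (E d) T) (g : L2Face (E d) F) : Prop :=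
  ∀ᵐ x ∂(surf F),
    Tendsto (fun r : ℝ => ⨍ y in T ∩ Metric.ball x r, ‖matVec (weakJac T w y) (normal T x) - g x‖)
      (𝓝[>] 0) (𝓝 0)

open scoped Classical in
/-- The trace of `w` on `F`. -/
def trace {d : ℕ} {V : Type*} [NormedAddCommGroup V] (T F : Set (E d)) (w : L2 V T) :
    L2Face V F :=
  if h : ∃ g, IsTrace T F w g then h.choose else 0

open scoped Classical in
/-- The normal trace `(∇w) n` of the total derivative of `w` on `F`. -/
def normalTrace {d : ℕ} (T F : Set (E d)) (w : L2 (E d) T) : L2Face (E d) F :=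
  if h : ∃ g, IsNormalTrace T F w g then h.choose else 0

/-! ### Polynomials -/

/-- The polynomial function on `ℝᵈ` given by `p`. -/
def pev {d : ℕ} (p : MvPolynomial (Fin d) ℝ) (x : E d) : ℝ := MvPolynomial.eval (fun i => x i) p

/-- `P^l(T)`: restrictions to `T` of polynomials of total degree at most `l`. -/
def polyT {d : ℕ} (l : ℕ) (T : Set (E d)) : Submodule ℝ (L2 ℝ T) :=
  Submodule.span ℝ {q | ∃ p : MvPolynomial (Fin d) ℝ, p.totalDegree ≤ l ∧
    q =ᵐ[volume.restrict T] pev p}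

/-- `P^l(T)ᵈ`: restrictions to `T` of vector-valued polynomials of degree at most `l`. -/
def polyVecT {d : ℕ} (l : ℕ) (T : Set (E d)) : Submodule ℝ (L2 (E d) T) :=
  Submodule.span ℝ {v | ∃ p : Fin d → MvPolynomial (Fin d) ℝ, (∀ i, (p i).totalDegree ≤ l) ∧
    v =ᵐ[volume.restrict T] fun x => WithLp.toLp 2 fun i => pev (p i) x}

/-! ### Curved meshes -/

/-- A curved mesh of `Ω`, with elements `elt i` and faces `face j`. -/
structure CurvedMesh {d : ℕ} (Ω : Set (E d)) (ι κ : Type*) where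
  /-- The mesh elements. -/
  elt : ι → Set (E d)
  /-- The mesh faces. -/
  face : κ → Set (E d)
  elt_open : ∀ i, IsOpen (elt i)
  elt_connected : ∀ i, IsConnected (elt i)
  elt_subset : ∀ i, elt i ⊆ Ω
  elt_disjoint : Pairwise fun i i' => Disjoint (elt i) (elt i')
  elt_cover : closure Ω = ⋃ i, closure (elt i)
  face_disjoint : Pairwise fun j j' => Disjoint (face j) (face j')
  /-- The faces partition the mesh skeleton. -/
  skeleton : ⋃ i, frontier (elt i) = ⋃ j, closure (face j)
  /-- Each face is an internal face or a boundary face. -/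
  face_incidence : ∀ j,
    (∃ i i', i ≠ i' ∧ face j ⊆ frontier (elt i) ∩ frontier (elt i')) ∨
      ∃ i, face j ⊆ frontier (elt i) ∩ frontier Ω
  /-- The boundary of an element is of class `C¹` along each of its faces, with the element on one
  side, and the face is a relatively open part of it. -/
  face_C1 : ∀ i j, face j ⊆ frontier (elt i) → ∀ x ∈ face j,
    (∃ n, IsOutwardNormal (elt i) x n) ∧ ∀ᶠ y in 𝓝 x, y ∈ frontier (elt i) → y ∈ face j
  /-- Faces have finite area. -/
  face_finite : ∀ j, surf (face j) Set.univ < ⊤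
  /-- The boundary of a face (where the boundaries of the elements need not be of class `C¹`) has
  zero area. -/
  face_boundary : ∀ j, surf (closure (face j) \ face j) Set.univ = 0

namespace CurvedMesh

variable {d : ℕ} {Ω : Set (E d)} {ι κ : Type*} [Fintype ι] [Fintype κ]

/-- Mesh regularity with some parameter `ϱ > 0`: each element `T` is a finite union of sets, each of
them star-shaped with respect to every point of a ball of radius `ϱ h_T` that it contains. -/
def IsRegular (M : CurvedMesh Ω ι κ) : Prop :=
  ∃ ϱ : ℝ, 0 < ϱ ∧ ∀ i, ∃ (N : ℕ) (X : Fin N → Set (E d)) (c : Fin N → E d),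
    M.elt i = ⋃ m, X m ∧ ∀ m,
      Metric.ball (c m) (ϱ * Metric.diam (M.elt i)) ⊆ X m ∧
      ∀ z ∈ Metric.ball (c m) (ϱ * Metric.diam (M.elt i)), StarConvex ℝ z (X m)

/-- The faces of the element `elt i`. -/
abbrev facesOf (M : CurvedMesh Ω ι κ) (i : ι) := {j : κ // M.face j ⊆ frontier (M.elt i)}

instance (M : CurvedMesh Ω ι κ) (i : ι) : Fintype (M.facesOf i) := Fintype.ofFinite _

variable (M : CurvedMesh Ω ι κ)

/-- `P^k(F)` on a curved face `F`: constant vectors plus `A n`, where `A` is a tensor-valued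
polynomial of degree at most `k` and `n` is the unit normal of `F` (for an internal face, the two
choices of `n` are opposite and give the same space). -/
def polyFace (k : ℕ) (j : κ) : Submodule ℝ (L2Face (E d) (M.face j)) :=
  Submodule.span ℝ ({v | ∃ c : E d, v =ᵐ[surf (M.face j)] fun _ => c} ∪
    {v | ∃ i, M.face j ⊆ frontier (M.elt i) ∧
      ∃ A : Fin d × Fin d → MvPolynomial (Fin d) ℝ, (∀ a, (A a).totalDegree ≤ k) ∧
        v =ᵐ[surf (M.face j)] fun x =>
          matVec (WithLp.toLp 2 fun a => pev (A a) x) (normal (M.elt i) x)})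

/-- Assumptions on the enrichment spaces `Ψ(T)` (velocity) and `Φ(T)` (pressure). -/
structure IsEnrichment (Ψ : ∀ i, Submodule ℝ (L2 (E d) (M.elt i)))
    (Φ : ∀ i, Submodule ℝ (L2 ℝ (M.elt i))) : Prop where
  finite_velocity : ∀ i, FiniteDimensional ℝ (Ψ i)
  finite_pressure : ∀ i, FiniteDimensional ℝ (Φ i)
  U1 : ∀ i, ∀ ψ ∈ Ψ i, MemH1Vec (M.elt i) ψ
  U2 : ∀ i, ∀ ψ ∈ Ψ i, ∃ L, IsWeakLap (M.elt i) ψ L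
  U3 : ∀ i, ∀ ψ ∈ Ψ i, ∀ j : M.facesOf i, ∃ g, IsNormalTrace (M.elt i) (M.face j) ψ g
  P1 : ∀ i, ∀ φ ∈ Φ i, MemH1 (M.elt i) φ

variable (k : ℕ) (Ψ : ∀ i, Submodule ℝ (L2 (E d) (M.elt i)))
  (Φ : ∀ i, Submodule ℝ (L2 ℝ (M.elt i)))

/-! ### Discrete spaces -/

/-- The extended space `P^{k+1}(T)ᵈ + Ψ(T)`. -/
def extVel (i : ι) : Submodule ℝ (L2 (E d) (M.elt i)) := polyVecT (k + 1) (M.elt i) ⊔ Ψ i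

/-- The element velocity space `P^k(T)ᵈ + ΔΨ(T) + ∇Φ(T)`. -/
def cellVel (i : ι) : Submodule ℝ (L2 (E d) (M.elt i)) :=
  polyVecT k (M.elt i) ⊔ Submodule.span ℝ (weakLap (M.elt i) '' (Ψ i))
    ⊔ Submodule.span ℝ (weakGrad (M.elt i) '' (Φ i))

/-- The face velocity space `P^k(F) + ∑_{T : F ⊆ ∂T} (∇Ψ(T) n_{TF} + Φ(T) n_{TF})`. -/
def faceVel (j : κ) : Submodule ℝ (L2Face (E d) (M.face j)) :=
  M.polyFace k j
    ⊔ Submodule.span ℝ {v | ∃ i, M.face j ⊆ frontier (M.elt i) ∧ ∃ ψ ∈ Ψ i,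
        v = normalTrace (M.elt i) (M.face j) ψ}
    ⊔ Submodule.span ℝ {v | ∃ i, M.face j ⊆ frontier (M.elt i) ∧ ∃ φ ∈ Φ i,
        v =ᵐ[surf (M.face j)] fun x =>
          trace (M.elt i) (M.face j) φ x • normal (M.elt i) x}

/-- The local pressure space `P^k(T) + Φ(T)`. -/
def cellPres (i : ι) : Submodule ℝ (L2 ℝ (M.elt i)) := polyT k (M.elt i) ⊔ Φ i

/-- The local discrete velocity space: pairs `(v_T, (v_F)_F)`. -/
abbrev LocalVel (i : ι) := M.cellVel k Ψ Φ i × ∀ j : M.facesOf i, M.faceVel k Ψ Φ j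

/-- The global discrete velocity space: pairs `((v_T)_T, (v_F)_F)`. -/
abbrev GlobalVel := (∀ i, M.cellVel k Ψ Φ i) × ∀ j, M.faceVel k Ψ Φ j

variable {k Ψ Φ}

/-- The restriction of a global discrete velocity to the element `elt i` and its faces. -/
def localize (v : M.GlobalVel k Ψ Φ) (i : ι) : M.LocalVel k Ψ Φ i := (v.1 i, fun j => v.2 j)

/-- The interpolator `I_T w = (π_T w, (π_F w)_F)`. -/
def interp (i : ι) (w : L2 (E d) (M.elt i)) : M.LocalVel k Ψ Φ i :=
  (orthProj _ w, fun j => orthProj _ (trace (M.elt i) (M.face j) w))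

/-! ### Reconstructions -/

/-- `r` is the velocity reconstruction of `v`. -/
def IsReconstruction {i : ι} (v : M.LocalVel k Ψ Φ i) (r : L2 (E d) (M.elt i)) : Prop :=
  r ∈ M.extVel k Ψ i ∧
  (∀ w ∈ M.extVel k Ψ i,
    inner ℝ (weakJac (M.elt i) r) (weakJac (M.elt i) w) =
      -inner ℝ (v.1 : L2 (E d) (M.elt i)) (weakLap (M.elt i) w) +
        ∑ j : M.facesOf i, inner ℝ (v.2 j : L2Face (E d) (M.face j))
          (normalTrace (M.elt i) (M.face j) w)) ∧
  ∫ x in M.elt i, r x = ∫ x in M.elt i, (v.1 : L2 (E d) (M.elt i)) x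

/-- `D` is the divergence reconstruction of `v`. -/
def IsDivReconstruction {i : ι} (v : M.LocalVel k Ψ Φ i) (D : L2 ℝ (M.elt i)) : Prop :=
  D ∈ M.cellPres k Φ i ∧
  ∀ q ∈ M.cellPres k Φ i,
    inner ℝ D q =
      -inner ℝ (v.1 : L2 (E d) (M.elt i)) (weakGrad (M.elt i) q) +
        ∑ j : M.facesOf i, ∫ x, inner ℝ ((v.2 j : L2Face (E d) (M.face j)) x)
          (trace (M.elt i) (M.face j) q x • normal (M.elt i) x) ∂(surf (M.face j))

open scoped Classical in
/-- The velocity reconstruction operator. -/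
def recon {i : ι} (v : M.LocalVel k Ψ Φ i) : L2 (E d) (M.elt i) :=
  if h : ∃ r, M.IsReconstruction v r then h.choose else 0

open scoped Classical in
/-- The divergence reconstruction operator. -/
def divRecon {i : ι} (v : M.LocalVel k Ψ Φ i) : L2 ℝ (M.elt i) :=
  if h : ∃ D, M.IsDivReconstruction v D then h.choose else 0

/-! ### Stabilisation -/

/-- The square of the local discrete seminorm `‖v‖_{1,T}`. -/
def seminormSq {i : ι} (v : M.LocalVel k Ψ Φ i) : ℝ :=
  ‖weakJac (M.elt i) (M.recon v)‖ ^ 2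
    + (Metric.diam (M.elt i) ^ 2)⁻¹ *
        ‖(v.1 : L2 (E d) (M.elt i)) - orthProj (M.cellVel k Ψ Φ i) (M.recon v)‖ ^ 2
    + (Metric.diam (M.elt i))⁻¹ * ∑ j : M.facesOf i,
        ‖(v.2 j : L2Face (E d) (M.face j)) -
          orthProj (M.faceVel k Ψ Φ j) (trace (M.elt i) (M.face j) (M.recon v))‖ ^ 2

/-- The explicit stabilisation, built with the `L²`-orthogonal projectors on the subspaces `KT`
(element) and `KF` (faces). -/
def explicitStab (i : ι) (KT : Submodule ℝ (L2 (E d) (M.elt i)))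
    (KF : ∀ j : M.facesOf i, Submodule ℝ (L2Face (E d) (M.face j)))
    (u v : M.LocalVel k Ψ Φ i) : ℝ :=
  (Metric.diam (M.elt i) ^ 2)⁻¹ *
      inner ℝ ((u.1 : L2 (E d) (M.elt i)) - orthProj KT (M.recon u))
        ((v.1 : L2 (E d) (M.elt i)) - orthProj KT (M.recon v))
    + (Metric.diam (M.elt i))⁻¹ * ∑ j : M.facesOf i,
        inner ℝ ((u.2 j : L2Face (E d) (M.face j)) -
            orthProj (KF j) (trace (M.elt i) (M.face j) (M.recon u)))
          ((v.2 j : L2Face (E d) (M.face j)) -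
            orthProj (KF j) (trace (M.elt i) (M.face j) (M.recon v)))

/-- The abstract assumption on the stabilisation: a symmetric positive semi-definite bilinear form
with `s(v, v) ≈ ‖v - I_T r v‖²_{1,T}`. -/
def IsAbstractStab (i : ι) (s : M.LocalVel k Ψ Φ i → M.LocalVel k Ψ Φ i → ℝ) : Prop :=
  (∃ B : LinearMap.BilinForm ℝ (M.LocalVel k Ψ Φ i), ∀ u v, B u v = s u v) ∧
  (∀ u v, s u v = s v u) ∧ (∀ v, 0 ≤ s v v) ∧
  ∃ C : ℝ, 0 < C ∧ ∀ v,
    C⁻¹ * M.seminormSq (v - M.interp i (M.recon v)) ≤ s v v ∧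
    s v v ≤ C * M.seminormSq (v - M.interp i (M.recon v))

/-- The stabilisations covered: any form satisfying the abstract assumption, and the explicit
stabilisation, with the projectors on the enriched spaces or on the plain polynomial spaces. -/
def IsStab (i : ι) (s : M.LocalVel k Ψ Φ i → M.LocalVel k Ψ Φ i → ℝ) : Prop :=
  M.IsAbstractStab i s ∨
  s = M.explicitStab i (M.cellVel k Ψ Φ i) (fun j => M.faceVel k Ψ Φ j) ∨
  s = M.explicitStab i (polyVecT k (M.elt i)) (fun j => M.polyFace k j)

/-! ### The discrete problem -/

/-- `a_h(v, w)`, where `s` is the family of local stabilisation forms. -/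
def ah (s : ∀ i, M.LocalVel k Ψ Φ i → M.LocalVel k Ψ Φ i → ℝ) (v w : M.GlobalVel k Ψ Φ) : ℝ :=
  ∑ i, (inner ℝ (weakJac (M.elt i) (M.recon (M.localize v i)))
      (weakJac (M.elt i) (M.recon (M.localize w i))) +
    s i (M.localize v i) (M.localize w i))

/-- `b_h(v, q)`. -/
def bh (v : M.GlobalVel k Ψ Φ) (q : L2 ℝ Ω) : ℝ :=
  ∑ i, -inner ℝ (M.divRecon (M.localize v i)) (restrictTo (M.elt_subset i) q)

/-- `∫_Ω f · v_h`, where `v_h` is equal to `v_T` on each element `T`. -/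
def load (f : L2 (E d) Ω) (v : M.GlobalVel k Ψ Φ) : ℝ :=
  ∑ i, inner ℝ (restrictTo (M.elt_subset i) f) (v.1 i : L2 (E d) (M.elt i))

variable (k Ψ Φ)

/-- Discrete velocities that vanish on the faces contained in `∂Ω`. -/
def velZero : Set (M.GlobalVel k Ψ Φ) := {v | ∀ j, M.face j ⊆ frontier Ω → v.2 j = 0}

/-- The global pressure space: zero-mean functions in `L²(Ω)` whose restriction to each element `T`
is in `P^k(T) + Φ(T)`. -/
def presZero : Set (L2 ℝ Ω) :=
  {z | (∀ i, restrictTo (M.elt_subset i) z ∈ M.cellPres k Φ i) ∧ ∫ x in Ω, z x = 0}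

variable {k Ψ Φ}

/-- `(u, p)` solves the enriched HHO discrete Stokes problem. -/
def IsDiscreteSolution (ν : ℝ) (f : L2 (E d) Ω)
    (s : ∀ i, M.LocalVel k Ψ Φ i → M.LocalVel k Ψ Φ i → ℝ)
    (u : M.GlobalVel k Ψ Φ) (p : L2 ℝ Ω) : Prop :=
  u ∈ M.velZero k Ψ Φ ∧ p ∈ M.presZero k Φ ∧
  (∀ v ∈ M.velZero k Ψ Φ, ν * M.ah s u v + M.bh v p = M.load f v) ∧
  ∀ q ∈ M.presZero k Φ, -M.bh u q = 0

end CurvedMesh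

end EnrichedHHO

end

open EnrichedHHO

/-! The discrete problem is a linear system on a finite-dimensional space with as many equations as
unknowns, because trial and test spaces coincide. Existence and uniqueness both follow once the
homogeneous problem has only the zero solution (`existsUnique_saddle`); no quantitative inf-sup
bound enters.

Let `(u, p)` solve the homogeneous problem. Testing with `u` removes `b_h` and leaves `a_h(u, u) =
0`. On each element the reconstruction then has zero gradient, so it is a constant, and the
vanishing stabilisation forces the element unknown and all its face unknowns to equal one constant
(`isStab_spec`). Elements that share a face share its unknown, some boundary face carries the value
zero, and the mesh is connected through interior faces; hence `u = 0` (`velocity_eq_zero`). What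
remains is `b_h(v, p) = 0` for all `v`. The velocity spaces were enriched by `∇Φ` and `Φ n` exactly
so that `v_T = -∇p`, `v_F = ` jump of `p n` is an admissible test function. It turns `b_h` into
minus a sum of squares, so `p` is constant on each element, has no jumps, is therefore constant, and
has zero mean (`weakGrad_eq_zero_and_jump_eq_zero`, `pressure_eq_zero`). The operator `r_T` is a
Neumann problem whose data are compatible with constants; `D_T` is a Riesz representative.

Two inputs are harder than this algebra.

Traces. An `H¹` function must have square-integrable approximate limits on the faces of a union of
star-shaped sets. Averages of `u` over the sections of a cone with apex `x` vary with the height at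
a rate controlled by the gradient (`coneAvg_sub`). An Eilenberg inequality (`lintegral_slices_le`)
shows that for almost every `x` of a face the total variation is finite, and square-integrable in
`x`, so the averages converge as the section shrinks to `x`. A Poincaré inequality on `T ∩ ball x
r`, valid because the boundary is `C¹` near `x`, carries the limit over to averages on `T ∩ ball x
r`. Its error term vanishes almost everywhere on the face since the measure `|G| dx` is singular to
the surface measure (`IsRegularFace.ae_tendsto_density`). Linearity of traces comes from uniqueness
of approximate limits.

Connectedness. The rims of the faces have zero area, and a set of zero `(d-1)`-dimensional measure
cannot separate a connected open set (`not_separated_of_null`). Near any point of an interface, the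
two elements and the face fill a neighbourhood (`IsRegularFace.eventually_mem_union`). Hence one can
walk between any two elements through interior faces, and a nonempty boundary face exists. -/

noncomputable section

namespace EnrichedHHO

/-! ### Cone averages of functions with a weak gradient -/

/-- `u` and `G` are integrable on `ℝᵈ`, and `G` is the weak gradient of `u` in `T`. -/
structure WeakGradOn {d : ℕ} (T : Set (E d)) (u : E d → ℝ) (G : E d → E d) : Prop where
  int_u : Integrable u
  int_G : Integrable G
  eq : ∀ φ : E d → ℝ, IsTest T φ → ∀ j : Fin d, ∫ x, u x * pd j φ x = -∫ x, G x j * φ x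

theorem integral_homothety {d : ℕ} {V : Type*} [NormedAddCommGroup V] [NormedSpace ℝ V]
    (x : E d) {t : ℝ} (ht : 0 < t) (h : E d → V) :
    ∫ b, h (x + t • (b - x)) = (t⁻¹) ^ d • ∫ y, h y := by
  have h1 := integral_sub_right_eq_self (μ := (volume : Measure (E d)))
    (fun b => h (x + t • b)) x
  rw [h1]
  have h2 := Measure.integral_comp_smul (volume : Measure (E d)) (fun b => h (x + b)) t
  rw [h2, integral_add_left_eq_self (μ := (volume : Measure (E d))) h x]
  simp [abs_of_pos ht]

theorem lintegral_homothety {d : ℕ} (x : E d) {t : ℝ} (ht : 0 < t) (h : E d → ENNReal) :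
    ∫⁻ b, h (x + t • (b - x)) = ENNReal.ofReal ((t⁻¹) ^ d) * ∫⁻ y, h y := by
  have h1 := lintegral_sub_right_eq_self (μ := (volume : Measure (E d)))
    (fun b => h (x + t • b)) x
  rw [h1]
  have e : MeasurableEmbedding (fun b : E d => x + t • b) :=
    ((Homeomorph.smulOfNeZero t ht.ne').trans (Homeomorph.addLeft x)).measurableEmbedding
  have h2 : Measure.map (fun b : E d => x + t • b) (volume : Measure (E d)) =
      ENNReal.ofReal ((t⁻¹) ^ d) • (volume : Measure (E d)) := by
    have : (fun b : E d => x + t • b) = (fun b => x + b) ∘ (fun b => t • b) := rfl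
    rw [this, ← Measure.map_map (by fun_prop) (by fun_prop), Measure.map_addHaar_smul _ ht.ne',
      Measure.map_smul, map_add_left_eq_self]
    simp [abs_of_pos ht]
  rw [← e.lintegral_map, h2, lintegral_smul_measure, smul_eq_mul]

theorem pd_eq_of_hasFDerivAt {d : ℕ} {φ : E d → ℝ} {x : E d} {L : E d →L[ℝ] ℝ}
    (h : HasFDerivAt φ L x) (j : Fin d) : pd j φ x = L (EuclideanSpace.single j 1) := by
  rw [pd, h.fderiv]

theorem sum_smul_single {d : ℕ} (v : E d) : ∑ j, v j • EuclideanSpace.single j (1:ℝ) = v := by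
  ext i
  simp [Finset.sum_apply, Pi.single_apply]

section Kernel

variable {d : ℕ} {φ : E d → ℝ}

/-- The function `dφ(p) + Dφ(p)(p - x)`, the divergence of `φ(p)(p - x)`. -/
def radialDiv (φ : E d → ℝ) (x p : E d) : ℝ := d * φ p + fderiv ℝ φ p (p - x)

/-- The kernel is the density of the image of `φ` under the homothety of centre `x` and ratio `t`.
Its mass moves with velocity `(y - x) / t`, so the derivative in `t` is minus a divergence in `y`;
`sum_pd_coneTest` identifies the field. -/
theorem hasDerivAt_coneKernel (hφ : ContDiff ℝ ∞ φ) (x y : E d) {t : ℝ} (ht : t ≠ 0) :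
    HasDerivAt (fun t : ℝ => (t⁻¹) ^ d * φ (x + t⁻¹ • (y - x)))
      (-((t⁻¹) ^ (d + 1) * radialDiv φ x (x + t⁻¹ • (y - x)))) t := by
  have h1 : HasDerivAt (fun t : ℝ => t⁻¹) (-(t ^ 2)⁻¹) t := hasDerivAt_inv ht
  have h2 : HasDerivAt (fun t : ℝ => x + t⁻¹ • (y - x)) ((-(t ^ 2)⁻¹) • (y - x)) t :=
    (h1.smul_const _).const_add _
  have h3 : HasFDerivAt φ (fderiv ℝ φ (x + t⁻¹ • (y - x))) (x + t⁻¹ • (y - x)) :=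
    (hφ.differentiable (by simp) _).hasFDerivAt
  have h4 := h3.comp_hasDerivAt t h2
  have h5 := (h1.pow d).mul h4
  refine h5.congr_deriv ?_
  simp only [radialDiv, Function.comp_apply, map_smul, smul_eq_mul, add_sub_cancel_left, Pi.pow_apply]
  -- The power rule yields the natural-number exponent `d - 1`, so `d = 0` is treated apart.
  rcases d with _ | d
  · simp only [Nat.cast_zero]; ring
  · simp only [Nat.add_sub_cancel]
    have : (t ^ 2)⁻¹ = t⁻¹ ^ 2 := by rw [inv_pow]
    rw [this]
    push_cast
    ring

theorem hasFDerivAt_coneTest (hφ : ContDiff ℝ ∞ φ) (x y : E d) (s : ℝ) (j : Fin d) :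
    HasFDerivAt (fun y : E d => φ (x + s • (y - x)) * (s * (y j - x j)))
      ((φ (x + s • (y - x))) • (s • (EuclideanSpace.proj j : E d →L[ℝ] ℝ)) +
        (s * (y j - x j)) • (s • fderiv ℝ φ (x + s • (y - x)))) y := by
  have h2 : HasFDerivAt (fun y : E d => x + s • (y - x)) (s • ContinuousLinearMap.id ℝ (E d)) y :=
    (((hasFDerivAt_id y).sub_const x).const_smul s).const_add x
  have h3 : HasFDerivAt φ (fderiv ℝ φ (x + s • (y - x))) (x + s • (y - x)) :=
    (hφ.differentiable (by simp) _).hasFDerivAt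
  have h4 := h3.comp y h2
  have h5 : HasFDerivAt (fun y : E d => s * (y j - x j))
      (s • (EuclideanSpace.proj j : E d →L[ℝ] ℝ)) y := by
    have := ((EuclideanSpace.proj j : E d →L[ℝ] ℝ).hasFDerivAt (x := y)).sub_const (x j)
    exact this.const_mul s
  have h6 := h4.mul h5
  refine h6.congr_fderiv ?_
  ext v
  simp

theorem sum_pd_coneTest (hφ : ContDiff ℝ ∞ φ) (x y : E d) (s : ℝ) :
    ∑ j, pd j (fun y : E d => φ (x + s • (y - x)) * (s * (y j - x j))) y =
      s * radialDiv φ x (x + s • (y - x)) := by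
  simp_rw [fun j => pd_eq_of_hasFDerivAt (hasFDerivAt_coneTest hφ x y s j) j]
  simp only [_root_.add_apply, _root_.smul_apply, smul_eq_mul,
    Finset.sum_add_distrib]
  have h1 : ∀ j : Fin d, (EuclideanSpace.proj j : E d →L[ℝ] ℝ) (EuclideanSpace.single j (1:ℝ)) = 1 := by
    intro j; simp
  simp only [h1]
  have h2 : ∑ j, s * (y j - x j) * (s * fderiv ℝ φ (x + s • (y - x)) (EuclideanSpace.single j 1))
      = s * fderiv ℝ φ (x + s • (y - x)) (s • (y - x)) := by
    have h3 := congrArg (fderiv ℝ φ (x + s • (y - x))) (sum_smul_single (s • (y - x)))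
    rw [← h3, map_sum, Finset.mul_sum]
    refine Finset.sum_congr rfl fun j _ => ?_
    simp
    ring
  rw [h2, radialDiv]
  simp
  ring

variable {T : Set (E d)} {u : E d → ℝ} {G : E d → E d}

/-- The support is contained in the image of `tsupport φ` under the homothety of ratio `t`, so only
the section of the cone at this height has to lie in `T`. -/
theorem isTest_coneTest (hφ : ContDiff ℝ ∞ φ) (hc : HasCompactSupport φ) {x : E d} {t : ℝ}
    (ht : 0 < t) (hcone : ∀ b ∈ tsupport φ, x + t • (b - x) ∈ T) (j : Fin d) :
    IsTest T (fun y : E d => φ (x + t⁻¹ • (y - x)) * (t⁻¹ * (y j - x j))) := by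
  have hK : IsCompact ((fun b => x + t • (b - x)) '' tsupport φ) :=
    hc.isCompact.image (by fun_prop)
  have hsub : Function.support (fun y : E d => φ (x + t⁻¹ • (y - x)) * (t⁻¹ * (y j - x j))) ⊆
      (fun b => x + t • (b - x)) '' tsupport φ := by
    intro y hy
    refine ⟨x + t⁻¹ • (y - x), subset_tsupport _ ?_, ?_⟩
    · exact left_ne_zero_of_mul hy
    · simp [smul_smul, ht.ne']
  refine ⟨?_, HasCompactSupport.of_support_subset_isCompact hK hsub, ?_⟩
  · refine (hφ.comp (by fun_prop)).mul (contDiff_const.mul ((?_ : ContDiff ℝ ∞ fun y : E d => y j).sub contDiff_const))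
    exact (EuclideanSpace.proj j : E d →L[ℝ] ℝ).contDiff
  · refine (closure_minimal hsub hK.isClosed).trans ?_
    rintro _ ⟨b, hb, rfl⟩
    exact hcone b hb

theorem continuous_radialDiv (hφ : ContDiff ℝ ∞ φ) (x : E d) : Continuous (radialDiv φ x) := by
  unfold radialDiv
  have := hφ.continuous
  have h2 : Continuous (fderiv ℝ φ) := hφ.continuous_fderiv (by simp)
  exact (continuous_const.mul this).add (h2.clm_apply (by fun_prop))

theorem exists_bound_radialDiv (hφ : ContDiff ℝ ∞ φ) (hc : HasCompactSupport φ) (x : E d) :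
    ∃ C, ∀ p, ‖radialDiv φ x p‖ ≤ C := by
  refine Continuous.bounded_above_of_compact_support (continuous_radialDiv hφ x) ?_
  refine HasCompactSupport.of_support_subset_isCompact hc.isCompact fun p hp => ?_
  by_contra h
  apply hp
  rw [radialDiv, image_eq_zero_of_notMem_tsupport h,
    image_eq_zero_of_notMem_tsupport (fun h' => h (tsupport_fderiv_subset ℝ h'))]
  simp

/-- The left side is `u` integrated against a divergence of admissible test functions, so the weak
derivative passes to `G`. The factor `(t⁻¹) ^ d` is then absorbed as the Jacobian of `y = x + t • (b
- x)`. -/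
theorem integral_mul_radialDiv (hW : WeakGradOn T u G) (hφ : ContDiff ℝ ∞ φ)
    (hc : HasCompactSupport φ) {x : E d} {t : ℝ} (ht : 0 < t)
    (hcone : ∀ b ∈ tsupport φ, x + t • (b - x) ∈ T) :
    ∫ y, u y * ((t⁻¹) ^ (d + 1) * radialDiv φ x (x + t⁻¹ • (y - x))) =
      - ∫ b, φ b * inner ℝ (G (x + t • (b - x))) (b - x) := by
  have hV := isTest_coneTest hφ hc ht hcone
  have hb : ∀ j, ∃ C, ∀ y, ‖pd j (fun y : E d => φ (x + t⁻¹ • (y - x)) * (t⁻¹ * (y j - x j))) y‖ ≤ C := by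
    intro j
    obtain ⟨h1, h2, -⟩ := hV j
    have h3 : Continuous (pd j (fun y : E d => φ (x + t⁻¹ • (y - x)) * (t⁻¹ * (y j - x j)))) :=
      (h1.continuous_fderiv (by simp)).clm_apply continuous_const
    refine h3.bounded_above_of_compact_support ?_
    exact (h2.fderiv_apply (𝕜 := ℝ) _)
  have hi : ∀ j, Integrable (fun y => u y *
      pd j (fun y : E d => φ (x + t⁻¹ • (y - x)) * (t⁻¹ * (y j - x j))) y) := by
    intro j
    obtain ⟨C, hC⟩ := hb j
    refine hW.int_u.mul_bdd (c := C) ?_ (Eventually.of_forall hC)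
    exact (((hV j).1.continuous_fderiv (by simp)).clm_apply continuous_const).aestronglyMeasurable
  have hiG : ∀ j, Integrable (fun y => G y j * (φ (x + t⁻¹ • (y - x)) * (t⁻¹ * (y j - x j)))) := by
    intro j
    obtain ⟨C, hC⟩ := (hV j).1.continuous.bounded_above_of_compact_support (hV j).2.1
    refine Integrable.mul_bdd (c := C) ?_ (hV j).1.continuous.aestronglyMeasurable
      (Eventually.of_forall hC)
    exact ((EuclideanSpace.proj j : E d →L[ℝ] ℝ).integrable_comp hW.int_G)
  have e1 : ∀ y, u y * ((t⁻¹) ^ (d + 1) * radialDiv φ x (x + t⁻¹ • (y - x))) =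
      (t⁻¹) ^ d * ∑ j, u y *
        pd j (fun y : E d => φ (x + t⁻¹ • (y - x)) * (t⁻¹ * (y j - x j))) y := by
    intro y
    rw [← Finset.mul_sum, sum_pd_coneTest hφ]
    ring
  simp_rw [e1]
  rw [integral_const_mul, integral_finsetSum _ (fun j _ => hi j)]
  simp_rw [fun j => hW.eq _ (hV j) j]
  rw [Finset.sum_neg_distrib, ← integral_finsetSum _ (fun j _ => hiG j)]
  have e2 : ∀ b, φ b * inner ℝ (G (x + t • (b - x))) (b - x) =
      (fun y => φ (x + t⁻¹ • (y - x)) * inner ℝ (G y) (t⁻¹ • (y - x))) (x + t • (b - x)) := by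
    intro b
    simp [smul_smul, ht.ne']
  simp_rw [e2]
  rw [integral_homothety x ht (fun y => φ (x + t⁻¹ • (y - x)) * inner ℝ (G y) (t⁻¹ • (y - x))),
    smul_eq_mul, mul_neg]
  congr 2
  refine integral_congr_ae (Eventually.of_forall fun y => ?_)
  simp only [PiLp.inner_apply, Finset.mul_sum]
  refine Finset.sum_congr rfl fun j _ => ?_
  simp
  ring

/-- The average of `u` over the section at height `t` of the cone with apex `x`, with weight `φ`. -/
def coneAvg (φ : E d → ℝ) (u : E d → ℝ) (t : ℝ) (x : E d) : ℝ := ∫ b, φ b * u (x + t • (b - x))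

theorem coneAvg_eq (u : E d → ℝ) (x : E d) {t : ℝ} (ht : 0 < t) :
    coneAvg φ u t x = ∫ y, u y * ((t⁻¹) ^ d * φ (x + t⁻¹ • (y - x))) := by
  have e2 : ∀ b, φ b * u (x + t • (b - x)) =
      (fun y => φ (x + t⁻¹ • (y - x)) * u y) (x + t • (b - x)) := by
    intro b
    simp [smul_smul, ht.ne']
  rw [coneAvg]
  simp_rw [e2]
  rw [integral_homothety x ht (fun y => φ (x + t⁻¹ • (y - x)) * u y), smul_eq_mul,
    ← integral_const_mul]
  refine integral_congr_ae (Eventually.of_forall fun y => ?_)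
  ring

/-- The derivative in the height falls on the smooth kernel, not on `u`: fundamental theorem of
calculus for each `y`, then Fubini, then the weak gradient at each height. Since heights stay in
`[s, t]` with `s > 0`, the apex `x` may lie on the boundary of `T`. -/
theorem coneAvg_sub (hW : WeakGradOn T u G) (hφ : ContDiff ℝ ∞ φ)
    (hc : HasCompactSupport φ) {x : E d} {s t : ℝ} (hs : 0 < s) (hst : s ≤ t)
    (hcone : ∀ r ∈ Set.Icc s t, ∀ b ∈ tsupport φ, x + r • (b - x) ∈ T) :
    coneAvg φ u t x - coneAvg φ u s x =
      ∫ r in s..t, ∫ b, φ b * inner ℝ (G (x + r • (b - x))) (b - x) := by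
  have ht : 0 < t := hs.trans_le hst
  have hpos : ∀ r ∈ Set.uIcc s t, 0 < r := fun r hr => by
    rw [Set.uIcc_of_le hst] at hr; exact hs.trans_le hr.1
  obtain ⟨C, hC⟩ := exists_bound_radialDiv hφ hc x
  obtain ⟨C', hC'⟩ := hφ.continuous.bounded_above_of_compact_support hc
  have hint : ∀ r, Integrable fun y => u y * ((r⁻¹) ^ d * φ (x + r⁻¹ • (y - x))) := by
    intro r
    refine hW.int_u.mul_bdd (c := ‖(r⁻¹) ^ d‖ * C') ?_ (Eventually.of_forall fun y => ?_)
    · have := hφ.continuous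
      exact Continuous.aestronglyMeasurable (by fun_prop)
    · rw [norm_mul]; gcongr; exact hC' _
  have hcont : ContinuousOn (fun p : ℝ × E d => (p.1⁻¹) ^ (d + 1) * radialDiv φ x (x + p.1⁻¹ • (p.2 - x)))
      (Set.Ioc s t ×ˢ Set.univ) := by
    have h1 : ContinuousOn (fun p : ℝ × E d => p.1⁻¹) (Set.Ioc s t ×ˢ Set.univ) :=
      continuousOn_fst.inv₀ (fun p hp => (hs.trans hp.1.1).ne')
    refine (h1.pow _).mul ((continuous_radialDiv hφ x).comp_continuousOn ?_)
    exact continuousOn_const.add (h1.smul (by fun_prop))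
  rw [coneAvg_eq u x ht, coneAvg_eq u x hs, ← integral_sub (hint t) (hint s)]
  have e1 : ∀ y, u y * ((t⁻¹) ^ d * φ (x + t⁻¹ • (y - x))) - u y * ((s⁻¹) ^ d * φ (x + s⁻¹ • (y - x)))
      = ∫ r in s..t, u y * (-((r⁻¹) ^ (d + 1) * radialDiv φ x (x + r⁻¹ • (y - x)))) := by
    intro y
    rw [intervalIntegral.integral_const_mul, intervalIntegral.integral_eq_sub_of_hasDerivAt
      (fun r hr => hasDerivAt_coneKernel hφ x y (hpos r hr).ne')]
    · ring
    · refine ContinuousOn.intervalIntegrable ?_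
      have h1 : ContinuousOn (fun r : ℝ => r⁻¹) (Set.uIcc s t) :=
        continuousOn_id.inv₀ (fun p hp => (hpos p hp).ne')
      refine ((h1.pow _).mul ((continuous_radialDiv hφ x).comp_continuousOn ?_)).neg
      exact continuousOn_const.add (h1.smul continuousOn_const)
  simp_rw [e1, intervalIntegral.integral_of_le hst]
  rw [integral_integral_swap]
  · refine setIntegral_congr_fun measurableSet_Ioc fun r hr => ?_
    have := integral_mul_radialDiv hW hφ hc (hs.trans hr.1) (hcone r (Set.Ioc_subset_Icc_self hr))
    simp only [mul_neg]
    rw [integral_neg, this, neg_neg]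
  -- Integrability for Fubini: heights above `s > 0` keep the derivative of the kernel below `(s⁻¹)
  -- ^ (d + 1) * C`, and the interval of heights has finite length.
  · have h1 : Integrable (fun p : E d × ℝ => u p.1) (volume.prod (volume.restrict (Set.Ioc s t))) :=
      hW.int_u.comp_fst _
    refine h1.mul_bdd (c := (s⁻¹) ^ (d + 1) * C) ?_ ?_
    · refine AEStronglyMeasurable.neg ?_
      have h2 := hcont.aestronglyMeasurable (μ := (volume : Measure ℝ).prod (volume : Measure (E d)))
        (measurableSet_Ioc.prod MeasurableSet.univ)
      rw [← Measure.prod_restrict, Measure.restrict_univ] at h2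
      exact h2.prod_swap
    · have : ∀ᵐ p : E d × ℝ ∂(volume.prod (volume.restrict (Set.Ioc s t))), p.2 ∈ Set.Ioc s t := by
        have := ae_restrict_mem (μ := (volume : Measure ℝ)) (measurableSet_Ioc (a := s) (b := t))
        exact Measure.quasiMeasurePreserving_snd.ae this
      filter_upwards [this] with p hp
      rw [norm_neg, norm_mul, norm_pow, norm_inv, Real.norm_of_nonneg (hs.trans hp.1).le]
      have h3 : 0 ≤ p.2⁻¹ := inv_nonneg.2 (hs.trans hp.1).le
      have h4 : p.2⁻¹ ≤ s⁻¹ := inv_anti₀ hs hp.1.le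
      gcongr
      exact hC _

/-- The average of `|G|` over the section at height `t` of the cone with apex `x`, with weight `φ`,
scaled by the distance to the apex before contraction. -/
def coneSlice (φ : E d → ℝ) (G : E d → E d) (t : ℝ) (x : E d) : ENNReal :=
  ∫⁻ b, ENNReal.ofReal (φ b) * (‖G (x + t • (b - x))‖ₑ * ‖b - x‖ₑ)

theorem enorm_coneAvg_sub_le (hW : WeakGradOn T u G) (hφ : ContDiff ℝ ∞ φ)
    (hc : HasCompactSupport φ) (hnn : ∀ b, 0 ≤ φ b) {x : E d} {s t : ℝ} (hs : 0 < s) (hst : s ≤ t)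
    (hcone : ∀ r ∈ Set.Icc s t, ∀ b ∈ tsupport φ, x + r • (b - x) ∈ T) :
    ‖coneAvg φ u t x - coneAvg φ u s x‖ₑ ≤ ∫⁻ r in Set.Ioc s t, coneSlice φ G r x := by
  rw [coneAvg_sub hW hφ hc hs hst hcone, intervalIntegral.integral_of_le hst]
  refine (enorm_integral_le_lintegral_enorm _).trans (lintegral_mono fun r => ?_)
  refine (enorm_integral_le_lintegral_enorm _).trans (lintegral_mono fun b => ?_)
  rw [enorm_mul, Real.enorm_of_nonneg (hnn b)]
  gcongr
  rw [← enorm_norm (G _), ← enorm_norm (b - x), ← enorm_mul]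
  simp only [enorm_le_iff_norm_le, norm_mul, norm_norm]
  exact norm_inner_le_norm _ _

end Kernel

/-! ### Mollifiers, Lebesgue points and a Poincaré inequality from cone averages. -/

/-- A smooth probability density supported in `closedBall c R`. -/
structure IsMollifier {d : ℕ} (φ : E d → ℝ) (c : E d) (R M : ℝ) : Prop where
  smooth : ContDiff ℝ ∞ φ
  nonneg : ∀ b, 0 ≤ φ b
  integral_eq : ∫ b, φ b = 1
  supp : tsupport φ ⊆ Metric.closedBall c R
  le : ∀ b, φ b ≤ M

section Mollifier

variable {d : ℕ} {φ : E d → ℝ} {c : E d} {R M : ℝ} {T : Set (E d)} {u : E d → ℝ} {G : E d → E d}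

theorem IsMollifier.compact (h : IsMollifier φ c R M) : HasCompactSupport φ :=
  (isCompact_closedBall c R).of_isClosed_subset (isClosed_tsupport _) h.supp

theorem IsMollifier.integrable (h : IsMollifier φ c R M) : Integrable φ :=
  h.smooth.continuous.integrable_of_hasCompactSupport h.compact

theorem IsMollifier.eq_zero (h : IsMollifier φ c R M) {b : E d} (hb : b ∉ Metric.closedBall c R) :
    φ b = 0 := image_eq_zero_of_notMem_tsupport fun h' => hb (h.supp h')

theorem IsMollifier.lintegral_eq (h : IsMollifier φ c R M) : ∫⁻ b, ENNReal.ofReal (φ b) = 1 := by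
  rw [← ofReal_integral_eq_lintegral_ofReal h.integrable (Eventually.of_forall h.nonneg),
    h.integral_eq, ENNReal.ofReal_one]

/-- Before normalisation the bump is at most 1 and equals 1 on the ball of radius `R / 2`, so its
integral is at least the volume of that ball. -/
theorem exists_mollifier (c : E d) {R : ℝ} (hR : 0 < R) :
    ∃ φ : E d → ℝ, IsMollifier φ c R
      (1 / (volume : Measure (E d)).real (Metric.closedBall c (R / 2))) := by
  let f : ContDiffBump c := ⟨R / 2, R, by positivity, by linarith⟩
  exact ⟨f.normed volume, f.contDiff_normed, f.nonneg_normed, f.integral_normed,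
    f.tsupport_normed_eq.le, fun b => f.normed_le_div_measure_closedBall_rIn volume b⟩

theorem homothety_mem_closedBall {x c b : E d} {t : ℝ} (ht : 0 < t) :
    x + t • (b - x) ∈ Metric.closedBall (x + t • (c - x)) (t * R) ↔ b ∈ Metric.closedBall c R := by
  rw [Metric.mem_closedBall, Metric.mem_closedBall, dist_eq_norm, dist_eq_norm]
  have : x + t • (b - x) - (x + t • (c - x)) = t • (b - c) := by module
  rw [this, norm_smul, Real.norm_of_nonneg ht.le]
  exact mul_le_mul_iff_right₀ ht

theorem integrable_comp_homothety {V : Type*} [NormedAddCommGroup V] {h : E d → V}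
    (hh : Integrable h) (x : E d) {t : ℝ} (ht : 0 < t) :
    Integrable fun b => h (x + t • (b - x)) := by
  have h1 : Integrable fun b => h (x + b) := hh.comp_add_left x
  have h2 : Integrable fun b => h (x + t • b) :=
    h1.comp_smul (μ := (volume : Measure (E d))) ht.ne'
  exact h2.comp_sub_right x

theorem integrable_mul_comp_homothety (hφ : IsMollifier φ c R M) (hu : Integrable u) (x : E d)
    {t : ℝ} (ht : 0 < t) : Integrable fun b => φ b * u (x + t • (b - x)) := by
  refine (integrable_comp_homothety hu x ht).bdd_mul (c := M) ?_ (Eventually.of_forall fun b => ?_)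
  · exact hφ.smooth.continuous.aestronglyMeasurable
  · rw [Real.norm_of_nonneg (hφ.nonneg b)]; exact hφ.le b

/-- As `φ` has mass one, `a` can be moved inside the average; then `φ ≤ M` and the homothety maps
`closedBall c R` onto the ball on the right. -/
theorem norm_coneAvg_sub_le (hφ : IsMollifier φ c R M) (hM : 0 ≤ M) (hu : Integrable u) (x : E d)
    {t : ℝ} (ht : 0 < t) (a : ℝ) : ‖coneAvg φ u t x - a‖ ≤
      M * (t⁻¹) ^ d * ∫ y in Metric.closedBall (x + t • (c - x)) (t * R), ‖u y - a‖ := by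
  have hi := integrable_mul_comp_homothety hφ hu x ht
  have e : coneAvg φ u t x - a = ∫ b, φ b * (u (x + t • (b - x)) - a) := by
    simp_rw [mul_sub]
    rw [integral_sub hi (hφ.integrable.mul_const a), integral_mul_const, hφ.integral_eq, one_mul]
    rfl
  have hloc : IntegrableOn (fun y => ‖u y - a‖) (Metric.closedBall (x + t • (c - x)) (t * R)) := by
    refine (hu.integrableOn.sub ?_).norm
    exact integrableOn_const (by exact measure_closedBall_lt_top.ne)
  rw [e]
  refine (norm_integral_le_integral_norm _).trans ?_
  have e2 := integral_homothety x ht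
    ((Metric.closedBall (x + t • (c - x)) (t * R)).indicator fun y => ‖u y - a‖)
  rw [integral_indicator Metric.isClosed_closedBall.measurableSet, smul_eq_mul] at e2
  rw [mul_assoc, ← e2, ← integral_const_mul]
  refine integral_mono_of_nonneg (Eventually.of_forall fun b => norm_nonneg _) ?_
    (Eventually.of_forall fun b => ?_)
  · refine Integrable.const_mul ?_ _
    exact integrable_comp_homothety (hloc.integrable_indicator Metric.isClosed_closedBall.measurableSet) x ht
  · by_cases hb : b ∈ Metric.closedBall c R
    · simp only [Set.indicator_of_mem ((homothety_mem_closedBall (x := x) ht).2 hb)]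
      rw [norm_mul, Real.norm_of_nonneg (hφ.nonneg b)]
      gcongr
      exact hφ.le b
    · simp only [hφ.eq_zero hb, zero_mul, norm_zero]
      exact mul_nonneg hM (Set.indicator_nonneg (fun _ _ => norm_nonneg _) _)

theorem volume_real_closedBall_homothety (x c : E d) {t : ℝ} (ht : 0 < t) (hR : 0 < R) :
    (volume : Measure (E d)).real (Metric.closedBall (x + t • (c - x)) (t * R)) =
      t ^ d * (volume : Measure (E d)).real (Metric.closedBall c R) := by
  rw [measureReal_def, measureReal_def, Measure.addHaar_closedBall_mul _ _ ht.le hR.le,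
    Measure.addHaar_closedBall_center _ c]
  simp [ht.le]

theorem volume_real_closedBall_pos (c : E d) (hR : 0 < R) :
    0 < (volume : Measure (E d)).real (Metric.closedBall c R) :=
  ENNReal.toReal_pos (Metric.measure_closedBall_pos _ _ hR).ne' measure_closedBall_lt_top.ne

/-- Lebesgue differentiation along balls that are not centred at `y`: the section at height `t` lies
in a ball of radius `t * R` whose `K`-fold enlargement contains `y`, where `K ≥ dist y c / R` does
not depend on `t`. -/
theorem ae_tendsto_coneAvg (hφ : IsMollifier φ c R M) (hM : 0 ≤ M) (hR : 0 < R)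
    (hu : Integrable u) :
    ∀ᵐ y, Tendsto (fun t => coneAvg φ u t y) (𝓝[>] 0) (𝓝 (u y)) := by
  have h1 : ∀ᵐ y : E d, ∀ K : ℕ, ∀ {ι : Type} {l : Filter ι} (w : ι → E d) (δ : ι → ℝ)
      (_ : Tendsto δ l (𝓝[>] 0)) (_ : ∀ᶠ j in l, y ∈ Metric.closedBall (w j) (K * δ j)),
      Tendsto (fun j => ⨍ z in Metric.closedBall (w j) (δ j), ‖u z - u y‖) l (𝓝 0) := by
    rw [ae_all_iff]
    intro K
    exact IsUnifLocDoublingMeasure.ae_tendsto_average_norm_sub _ hu.locallyIntegrable K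
  filter_upwards [h1] with y hy
  obtain ⟨K, hK⟩ := exists_nat_ge (dist y c / R)
  have h2 := hy K (l := 𝓝[>] (0:ℝ)) (fun t => y + t • (c - y)) (fun t => t * R) ?_ ?_
  · rw [tendsto_iff_norm_sub_tendsto_zero]
    have h3 := h2.const_mul (M * (volume : Measure (E d)).real (Metric.closedBall c R))
    rw [mul_zero] at h3
    refine squeeze_zero' (Eventually.of_forall fun t => norm_nonneg _) ?_ h3
    filter_upwards [self_mem_nhdsWithin] with t ht
    have ht : 0 < t := ht
    refine (norm_coneAvg_sub_le hφ hM hu y ht (u y)).trans (le_of_eq ?_)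
    rw [setAverage_eq, volume_real_closedBall_homothety y c ht hR, smul_eq_mul]
    have : (volume : Measure (E d)).real (Metric.closedBall c R) ≠ 0 :=
      (volume_real_closedBall_pos c hR).ne'
    rw [inv_pow]
    field_simp
  · rw [tendsto_nhdsWithin_iff]
    refine ⟨?_, ?_⟩
    · have : Tendsto (fun t : ℝ => t * R) (𝓝 0) (𝓝 (0 * R)) := tendsto_id.mul_const R
      rw [zero_mul] at this
      exact this.mono_left nhdsWithin_le_nhds
    · filter_upwards [self_mem_nhdsWithin] with t ht using mul_pos ht hR
  · filter_upwards [self_mem_nhdsWithin] with t ht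
    have ht : 0 < t := ht
    rw [Metric.mem_closedBall, dist_eq_norm]
    have : y - (y + t • (c - y)) = t • (y - c) := by module
    rw [this, norm_smul, Real.norm_of_nonneg ht.le, ← dist_eq_norm]
    rw [div_le_iff₀ hR] at hK
    nlinarith

theorem coneAvg_one (x : E d) : coneAvg φ u 1 x = ∫ b, φ b * u b := by
  simp [coneAvg]

/-- Cone averages are compared between the heights `s` and 1 and `s` tends to 0. At height 1 the
average is the weighted mean `∫ φ u`, which no longer depends on `y`. -/
theorem ae_enorm_sub_le (hW : WeakGradOn T u G) (hφ : IsMollifier φ c R M) (hM : 0 ≤ M)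
    (hR : 0 < R) : ∀ᵐ y, (∀ r ∈ Set.Ioc (0:ℝ) 1, ∀ b ∈ tsupport φ, y + r • (b - y) ∈ T) →
      ‖u y - ∫ b, φ b * u b‖ₑ ≤ ∫⁻ r in Set.Ioc (0:ℝ) 1, coneSlice φ G r y := by
  filter_upwards [ae_tendsto_coneAvg hφ hM hR hW.int_u] with y hy hcone
  have h1 : Tendsto (fun s => ‖coneAvg φ u s y - ∫ b, φ b * u b‖ₑ) (𝓝[>] 0)
      (𝓝 ‖u y - ∫ b, φ b * u b‖ₑ) := (hy.sub_const _).enorm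
  refine le_of_tendsto h1 ?_
  filter_upwards [self_mem_nhdsWithin, Ioc_mem_nhdsGT (zero_lt_one' ℝ)] with s hs hs1
  have hs : 0 < s := hs
  rw [← coneAvg_one (φ := φ) (u := u) y, enorm_sub_rev]
  refine (enorm_coneAvg_sub_le hW hφ.smooth hφ.compact hφ.nonneg hs hs1.2 ?_).trans ?_
  · intro r hr b hb
    exact hcone r ⟨hs.trans_le hr.1, hr.2⟩ b hb
  · exact lintegral_mono_set (Set.Ioc_subset_Ioc_left hs.le)

/-- A function with zero weak gradient on a connected open set is constant. -/
theorem WeakGradOn.ae_eq_const (hT : IsOpen T) (hTc : IsPreconnected T)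
    (hW : WeakGradOn T u fun _ => 0) : ∃ a, ∀ᵐ y, y ∈ T → u y = a := by
  have hloc : ∀ x ∈ T, ∃ ε > 0, ∃ a, ∀ᵐ y, y ∈ Metric.ball x ε → u y = a := by
    intro x hx
    obtain ⟨ε, hε, hb⟩ := Metric.isOpen_iff.1 hT x hx
    obtain ⟨φ, hφ⟩ := exists_mollifier x (half_pos hε)
    refine ⟨ε, hε, ∫ b, φ b * u b, ?_⟩
    filter_upwards [ae_enorm_sub_le hW hφ (by positivity) (half_pos hε)] with y hy hyb
    -- A ball inside `T` is convex, so all the cones stay in `T`; with zero gradient the bound says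
    -- that `u` equals its weighted mean.
    have h0 := hy fun r hr b hb' => hb ((convex_ball x ε).add_smul_sub_mem hyb
      (Metric.closedBall_subset_ball (by linarith) (hφ.supp hb')) ⟨hr.1.le, hr.2⟩)
    simp only [coneSlice, enorm_zero, zero_mul, mul_zero, lintegral_zero, nonpos_iff_eq_zero,
      enorm_eq_zero] at h0
    linarith
  rcases T.eq_empty_or_nonempty with rfl | ⟨x0, hx0⟩
  · exact ⟨0, by simp⟩
  obtain ⟨ε0, hε0, a, ha⟩ := hloc x0 hx0
  refine ⟨a, ?_⟩
  -- A general `P` serves for two disjoint open sets: the points near which `u` is the constant `a`,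
  -- and those near which it is another constant. Connectedness excludes the second.
  have hopen : ∀ P : ℝ → Prop,
      IsOpen {x : E d | ∃ ε > 0, ∃ a, P a ∧ ∀ᵐ y, y ∈ Metric.ball x ε → u y = a} := by
    intro P
    rw [Metric.isOpen_iff]
    rintro x ⟨ε, hε, a, hP, h⟩
    refine ⟨ε / 2, half_pos hε, fun z hz => ⟨ε / 2, half_pos hε, a, hP, ?_⟩⟩
    filter_upwards [h] with y hy hyz
    refine hy (Metric.ball_subset_ball' ?_ hyz)
    rw [Metric.mem_ball] at hz
    linarith
  have hsub : T ⊆ {x : E d | ∃ ε > 0, ∃ a', a' = a ∧ ∀ᵐ y, y ∈ Metric.ball x ε → u y = a'} := by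
    refine hTc.subset_left_of_subset_union (hopen _) (hopen fun a' => a' ≠ a) ?_ ?_
      ⟨x0, hx0, ε0, hε0, a, rfl, ha⟩
    · rw [Set.disjoint_left]
      rintro x ⟨ε, hε, a1, rfl, h1⟩ ⟨ε', hε', a2, hne, h2⟩
      have hpos := Metric.measure_ball_pos (volume : Measure (E d)) x (lt_min hε hε')
      obtain ⟨y, hy, hy1, hy2⟩ := (Measure.exists_mem_of_measure_ne_zero_of_ae hpos.ne'
        (ae_restrict_of_ae (h1.and h2)))
      exact hne ((hy2 (Metric.ball_subset_ball (min_le_right _ _) hy)).symm.trans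
        (hy1 (Metric.ball_subset_ball (min_le_left _ _) hy)))
    · intro x hx
      obtain ⟨ε, hε, a', h⟩ := hloc x hx
      by_cases h' : a' = a
      · exact Or.inl ⟨ε, hε, a', h', h⟩
      · exact Or.inr ⟨ε, hε, a', h', h⟩
  rw [ae_iff]
  refine measure_null_of_locally_null _ fun x hx => ?_
  have hxT : x ∈ T := by
    by_contra h
    exact hx fun h' => absurd h' h
  obtain ⟨ε, hε, a', rfl, h⟩ := hsub hxT
  refine ⟨Metric.ball x ε ∩ {y | ¬(y ∈ T → u y = a')}, ?_, ?_⟩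
  · exact inter_mem (mem_nhdsWithin_of_mem_nhds (Metric.ball_mem_nhds x hε)) self_mem_nhdsWithin
  · rw [ae_iff] at h
    refine measure_mono_null (fun y hy => ?_) h
    intro h'
    exact hy.2 fun _ => h' hy.1

/-- For `r ≥ 1/2` integrate first in `b`: the homothety centred at `y` has ratio `r`. For `r ≤ 1/2`
integrate first in `y`: the homothety centred at `b` has ratio `1 - r`. Either way the ratio is at
least `1/2`, so the Jacobian costs at most `2 ^ d`. -/
theorem lintegral_segments_le {g : E d → ENNReal} (hg : Measurable g) (A B : Set (E d)) :
    ∫⁻ y in A, ∫⁻ r in Set.Ioc (0:ℝ) 1, ∫⁻ b in B, g (y + r • (b - y)) ≤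
      2 ^ d * (volume A + volume B) * ∫⁻ y, g y := by
  have hm3 : Measurable fun p : (E d × ℝ) × E d => g (p.1.1 + p.1.2 • (p.2 - p.1.1)) :=
    hg.comp (by fun_prop)
  rw [lintegral_lintegral_swap (hm3.lintegral_prod_right').aemeasurable]
  have key : ∀ r ∈ Set.Ioc (0:ℝ) 1, ∫⁻ y in A, ∫⁻ b in B, g (y + r • (b - y)) ≤
      2 ^ d * (volume A + volume B) * ∫⁻ y, g y := by
    intro r hr
    have two : ∀ t : ℝ, 1 / 2 ≤ t → ENNReal.ofReal ((t⁻¹) ^ d) ≤ 2 ^ d := by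
      intro t ht
      have : t⁻¹ ≤ 2 := by
        rw [inv_le_comm₀ (by linarith) (by norm_num)]; linarith
      calc ENNReal.ofReal ((t⁻¹) ^ d) ≤ ENNReal.ofReal (2 ^ d) := by
            apply ENNReal.ofReal_le_ofReal
            have : 0 ≤ t⁻¹ := inv_nonneg.2 (by linarith)
            gcongr
        _ = 2 ^ d := by rw [ENNReal.ofReal_pow (by norm_num)]; norm_num
    rcases le_total r (1 / 2) with h | h
    · have hm : Measurable fun p : E d × E d => g (p.1 + r • (p.2 - p.1)) := hg.comp (by fun_prop)
      rw [lintegral_lintegral_swap hm.aemeasurable]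
      calc ∫⁻ b in B, ∫⁻ y in A, g (y + r • (b - y))
          ≤ ∫⁻ b in B, 2 ^ d * ∫⁻ y, g y := by
            refine lintegral_mono fun b => ?_
            refine (setLIntegral_le_lintegral _ _).trans ?_
            have : ∀ y, y + r • (b - y) = b + (1 - r) • (y - b) := fun y => by module
            simp_rw [this]
            rw [lintegral_homothety b (by linarith)]
            gcongr
            exact two _ (by linarith)
        _ = 2 ^ d * volume B * ∫⁻ y, g y := by
            rw [setLIntegral_const]; ring
        _ ≤ _ := by gcongr; exact le_add_self
    · calc ∫⁻ y in A, ∫⁻ b in B, g (y + r • (b - y))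
          ≤ ∫⁻ y in A, 2 ^ d * ∫⁻ y, g y := by
            refine lintegral_mono fun y => ?_
            refine (setLIntegral_le_lintegral _ _).trans ?_
            rw [lintegral_homothety y (by linarith)]
            gcongr
            exact two _ (by linarith)
        _ = 2 ^ d * volume A * ∫⁻ y, g y := by
            rw [setLIntegral_const]; ring
        _ ≤ _ := by gcongr; exact le_self_add
  calc _ ≤ ∫⁻ r in Set.Ioc (0:ℝ) 1, 2 ^ d * (volume A + volume B) * ∫⁻ y, g y :=
        setLIntegral_mono' measurableSet_Ioc key
    _ = _ := by simp

/-- A Poincaré inequality on a set whose points all see a common ball of comparable radius. -/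
theorem exists_lintegral_enorm_sub_le (hW : WeakGradOn T u G) (hG : Measurable G) {S : Set (E d)}
    (hS : MeasurableSet S) {x z : E d} {r : ℝ} (hr : 0 < r) (hSx : S ⊆ Metric.ball x r)
    (hz : dist z x ≤ 4 * r)
    (hcone : ∀ y ∈ S, ∀ t ∈ Set.Ioc (0:ℝ) 1, ∀ b ∈ Metric.closedBall z r, y + t • (b - y) ∈ T) :
    ∃ a : ℝ, ∫⁻ y in S, ‖u y - a‖ₑ ≤
      12 * 4 ^ d * (ENNReal.ofReal r * ∫⁻ y in Metric.ball x (6 * r), ‖G y‖ₑ) := by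
  obtain ⟨φ, hφ⟩ := exists_mollifier z hr
  set M : ℝ := 1 / (volume : Measure (E d)).real (Metric.closedBall z (r / 2)) with hM
  -- Points of `S` are within `r` of `x` and points of `closedBall z r` within `5 * r`, so the
  -- segments between them stay in `ball x (6 * r)` and are no longer than `6 * r`.
  set g : E d → ENNReal := (Metric.ball x (6 * r)).indicator fun y => ‖G y‖ₑ with hg
  have hgm : Measurable g := (hG.enorm).indicator measurableSet_ball
  refine ⟨∫ b, φ b * u b, ?_⟩
  have h1 : ∀ y ∈ S, ∀ t ∈ Set.Ioc (0:ℝ) 1, coneSlice φ G t y ≤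
      ENNReal.ofReal M * ENNReal.ofReal (6 * r) *
        ∫⁻ b in Metric.closedBall z r, g (y + t • (b - y)) := by
    intro y hy t ht
    rw [← lintegral_const_mul' _ _ (by finiteness), ← lintegral_indicator measurableSet_closedBall,
      coneSlice]
    refine lintegral_mono fun b => ?_
    by_cases hb : b ∈ Metric.closedBall z r
    · rw [Set.indicator_of_mem hb]
      have hyx := hSx hy
      rw [Metric.mem_ball] at hyx
      rw [Metric.mem_closedBall] at hb
      have hbx : dist b x ≤ 5 * r := by linarith [dist_triangle b z x]
      have hmem : y + t • (b - y) ∈ Metric.ball x (6 * r) :=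
        (convex_ball x (6 * r)).add_smul_sub_mem (by rw [Metric.mem_ball]; linarith)
          (by rw [Metric.mem_ball]; linarith) ⟨ht.1.le, ht.2⟩
      rw [hg, Set.indicator_of_mem hmem, mul_assoc]
      have h3 : ‖b - y‖ₑ ≤ ENNReal.ofReal (6 * r) := by
        rw [← ofReal_norm, ← dist_eq_norm]
        apply ENNReal.ofReal_le_ofReal
        linarith [dist_triangle b x y, dist_comm x y]
      rw [mul_comm ‖G _‖ₑ]
      gcongr
      exact hφ.le b
    · rw [Set.indicator_of_notMem hb, hφ.eq_zero hb]
      simp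
  calc ∫⁻ y in S, ‖u y - ∫ b, φ b * u b‖ₑ
      ≤ ∫⁻ y in S, ∫⁻ t in Set.Ioc (0:ℝ) 1, coneSlice φ G t y := by
        refine lintegral_mono_ae ?_
        rw [ae_restrict_iff' hS]
        filter_upwards [ae_enorm_sub_le hW hφ (by positivity) hr] with y hy hyS
        exact hy fun t ht b hb => hcone y hyS t ht b (hφ.supp hb)
    _ ≤ ∫⁻ y in S, ∫⁻ t in Set.Ioc (0:ℝ) 1, ENNReal.ofReal M * ENNReal.ofReal (6 * r) *
        ∫⁻ b in Metric.closedBall z r, g (y + t • (b - y)) := by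
        refine setLIntegral_mono' hS fun y hy => setLIntegral_mono' measurableSet_Ioc fun t ht => ?_
        exact h1 y hy t ht
    _ = ENNReal.ofReal M * ENNReal.ofReal (6 * r) * ∫⁻ y in S, ∫⁻ t in Set.Ioc (0:ℝ) 1,
        ∫⁻ b in Metric.closedBall z r, g (y + t • (b - y)) := by
        simp_rw [lintegral_const_mul' (ENNReal.ofReal M * ENNReal.ofReal (6 * r)) _ (by finiteness)]
    _ ≤ ENNReal.ofReal M * ENNReal.ofReal (6 * r) *
        (2 ^ d * (volume S + volume (Metric.closedBall z r)) * ∫⁻ y, g y) := by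
        gcongr
        exact lintegral_segments_le hgm _ _
    _ ≤ ENNReal.ofReal M * ENNReal.ofReal (6 * r) *
        (2 ^ d * (volume (Metric.closedBall z r) + volume (Metric.closedBall z r)) * ∫⁻ y, g y) := by
        gcongr ENNReal.ofReal M * ENNReal.ofReal (6 * r) * (2 ^ d * (?_ + _) * _)
        calc volume S ≤ volume (Metric.closedBall x r) :=
              measure_mono (hSx.trans Metric.ball_subset_closedBall)
          _ = volume (Metric.closedBall z r) := by
              rw [Measure.addHaar_closedBall_center, Measure.addHaar_closedBall_center _ z]
    _ = _ := by
        -- `M` is the inverse volume of the half-radius ball, so it cancels the volumes up to `2 ^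
        -- d`. Together with the `2 ^ d` of the segment estimate this is `4 ^ d`, and 12 is the
        -- length factor 6 times the two equal volumes.
        have hv : volume (Metric.closedBall z r) =
            2 ^ d * volume (Metric.closedBall z (r / 2)) := by
          have : r = 2 * (r / 2) := by ring
          conv_lhs => rw [this]
          rw [Measure.addHaar_closedBall_mul _ _ (by norm_num) (half_pos hr).le,
            Measure.addHaar_closedBall_center _ z]
          simp [ENNReal.ofReal_pow]
        have hMv : ENNReal.ofReal M * volume (Metric.closedBall z (r / 2)) = 1 := by
          have h0 := (Metric.measure_closedBall_pos (volume : Measure (E d)) z (half_pos hr)).ne'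
          have ht : volume (Metric.closedBall z (r / 2)) ≠ ⊤ := measure_closedBall_lt_top.ne
          rw [hM, one_div, ENNReal.ofReal_inv_of_pos (volume_real_closedBall_pos z (half_pos hr)), measureReal_def,
            ENNReal.ofReal_toReal ht, ENNReal.inv_mul_cancel h0 ht]
        rw [hv, ENNReal.ofReal_mul (by norm_num : (0:ℝ) ≤ 6), hg,
          lintegral_indicator measurableSet_ball]
        have h6 : ENNReal.ofReal 6 = 6 := by norm_num
        rw [h6]
        calc ENNReal.ofReal M * (6 * ENNReal.ofReal r) * (2 ^ d * (2 ^ d * volume (Metric.closedBall z (r / 2)) +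
              2 ^ d * volume (Metric.closedBall z (r / 2))) * ∫⁻ y in Metric.ball x (6 * r), ‖G y‖ₑ)
            = (ENNReal.ofReal M * volume (Metric.closedBall z (r / 2))) * (12 * (2 ^ d * 2 ^ d)) *
              (ENNReal.ofReal r * ∫⁻ y in Metric.ball x (6 * r), ‖G y‖ₑ) := by ring
          _ = _ := by rw [hMv, ← mul_pow]; norm_num

end Mollifier

/-! ### Sections of cones over a piece of boundary. -/

/-- All segments from `x` to points of `ball c R` lie in `T`, except possibly for `x`. -/
def SeesBall {d : ℕ} (T : Set (E d)) (x c : E d) (R : ℝ) : Prop :=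
  ∀ b ∈ Metric.ball c R, ∀ t ∈ Set.Ioc (0:ℝ) 1, x + t • (b - x) ∈ T

section Slices

variable {d : ℕ} {T D : Set (E d)} {c b : E d} {R : ℝ}

/-- If the two points were closer than this, then `x` itself would lie on the segment from `x'` to a
slightly displaced vertex in `ball b R`, at height `(t' - t) / (1 - t)`. As `x'` sees that ball, `x`
would be in `T`. Thus the height is a Lipschitz function on the cones over `D`. -/
theorem SeesBall.mul_sub_le (hD : ∀ x ∈ D, x ∉ T ∧ SeesBall T x b R) {x x' : E d} (hx : x ∈ D)
    (hx' : x' ∈ D) {t t' : ℝ} (ht' : t' < 1) (htt : t < t') :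
    R * (t' - t) ≤ dist (x + t • (b - x)) (x' + t' • (b - x')) := by
  by_contra! h
  apply (hD x hx).1
  have h1 : 0 < 1 - t := by linarith
  have h2 : 0 < t' - t := by linarith
  have key := (hD x' hx').2
    (b + (t' - t)⁻¹ • ((x + t • (b - x)) - (x' + t' • (b - x')))) ?_ ((t' - t) / (1 - t)) ?_
  · convert key using 1
    have e : (1 - t) • x = (1 - t) • (x' + ((t' - t) / (1 - t)) • (b + (t' - t)⁻¹ •
        ((x + t • (b - x)) - (x' + t' • (b - x'))) - x')) := by
      rw [smul_add (1 - t) x', smul_smul, mul_div_cancel₀ _ h1.ne']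
      rw [smul_sub (t' - t), smul_add (t' - t), smul_smul, mul_inv_cancel₀ h2.ne', one_smul]
      module
    exact smul_right_injective _ h1.ne' e
  · rw [Metric.mem_ball, dist_eq_norm, add_sub_cancel_left, norm_smul, norm_inv,
      Real.norm_of_nonneg h2.le, ← dist_eq_norm, inv_mul_lt_iff₀ h2]
    linarith
  · refine ⟨div_pos h2 h1, ?_⟩
    rw [div_le_one h1]
    linarith

theorem SeesBall.mul_abs_sub_le (hD : ∀ x ∈ D, x ∉ T ∧ SeesBall T x b R) {x x' : E d} (hx : x ∈ D)
    (hx' : x' ∈ D) {t t' : ℝ} (ht : t < 1) (ht' : t' < 1) :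
    R * |t - t'| ≤ dist (x + t • (b - x)) (x' + t' • (b - x')) := by
  rcases lt_trichotomy t t' with h | h | h
  · rw [abs_sub_comm, abs_of_pos (by linarith)]
    exact SeesBall.mul_sub_le hD hx hx' ht' h
  · simp [h]
  · rw [abs_of_pos (by linarith), dist_comm]
    exact SeesBall.mul_sub_le hD hx' hx ht h

/-- The number `r` bounds both the size of the covering sets and the excess of the sum, so that one
sequence tending to zero controls both. -/
theorem exists_cover_hausdorff {X : Type*} [EMetricSpace X] [MeasurableSpace X] [BorelSpace X]
    {s : ℝ} (hs : 0 < s) {S : Set X} (hS : Measure.hausdorffMeasure s S ≠ ⊤) {r : ENNReal}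
    (hr : 0 < r) : ∃ U : ℕ → Set X, S ⊆ ⋃ n, U n ∧ (∀ n, Metric.ediam (U n) ≤ r) ∧
      ∑' n, Metric.ediam (U n) ^ s ≤ Measure.hausdorffMeasure s S + r := by
  have h1 := ENNReal.lt_add_right hS hr.ne'
  have h2 : (⨅ (t : ℕ → Set X) (_ : S ⊆ ⋃ n, t n) (_ : ∀ n, Metric.ediam (t n) ≤ r),
      ∑' n, ⨆ _ : (t n).Nonempty, Metric.ediam (t n) ^ s) ≤ Measure.hausdorffMeasure s S := by
    conv_rhs => rw [Measure.hausdorffMeasure_apply]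
    exact le_iSup₂_of_le r hr le_rfl
  have h3 := h2.trans_lt h1
  simp only [iInf_lt_iff] at h3
  obtain ⟨U, hU1, hU2, hU3⟩ := h3
  refine ⟨U, hU1, hU2, le_trans (ENNReal.tsum_le_tsum fun n => ?_) hU3.le⟩
  rcases (U n).eq_empty_or_nonempty with h | h
  · simp [h, hs]
  · simp [h]

/-- An Eilenberg inequality for the sections of the cones over `D` with vertex `b`. -/
theorem lintegral_hausdorff_slices_le (hR : 0 < R) (hD : ∀ x ∈ D, x ∉ T ∧ SeesBall T x b R) {m : ℝ}
    (hm : 0 < m) (S : Set (E d)) :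
    ∫⁻ t in Set.Ioc (0:ℝ) (1/2), Measure.hausdorffMeasure m {x ∈ D | x + t • (b - x) ∈ S} ≤
      2 ^ m * ENNReal.ofReal R⁻¹ * Measure.hausdorffMeasure (m + 1) S := by
  have hm1 : 0 < m + 1 := by linarith
  have hc0 : (2:ENNReal) ^ m * ENNReal.ofReal R⁻¹ ≠ 0 := by
    refine mul_ne_zero ?_ ?_
    · exact (ENNReal.rpow_pos (by norm_num) (by norm_num)).ne'
    · simpa using hR
  have hct : (2:ENNReal) ^ m * ENNReal.ofReal R⁻¹ ≠ ⊤ :=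
    ENNReal.mul_ne_top (ENNReal.rpow_ne_top_of_nonneg hm.le (by norm_num)) (by finiteness)
  by_cases hS : Measure.hausdorffMeasure (m + 1) S = ⊤
  · rw [hS, ENNReal.mul_top hc0]; exact le_top
  have hr : ∀ n : ℕ, (0:ENNReal) < ((n:ENNReal) + 1)⁻¹ := fun n => by
    rw [ENNReal.inv_pos]; finiteness
  have hr0 : Tendsto (fun n : ℕ => ((n:ENNReal) + 1)⁻¹) atTop (𝓝 0) := by
    have := (tendsto_add_atTop_iff_nat 1).2 ENNReal.tendsto_inv_nat_nhds_zero
    simpa using this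
  choose U hU1 hU2 hU3 using fun n => exists_cover_hausdorff hm1 hS (hr n)
  -- `P n i t` collects the points of `D` whose ray meets `U n i` at height `t`, and `J n i`
  -- contains the heights where there are such points. The diameter of `P n i t` is at most twice
  -- that of `U n i`, because `x ↦ x + t • (b - x)` scales by `1 - t ≥ 1/2`; the length of `J n i`
  -- is at most `R⁻¹` times that diameter.
  let P : ℕ → ℕ → ℝ → Set (E d) := fun n i t => {x ∈ D | x + t • (b - x) ∈ U n i}
  -- The closure makes the set of heights measurable without changing its diameter.
  let J : ℕ → ℕ → Set ℝ := fun n i => closure {t ∈ Set.Ioc (0:ℝ) (1/2) | (P n i t).Nonempty}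
  have hJm : ∀ n i, MeasurableSet (J n i) := fun n i => isClosed_closure.measurableSet
  have hJ : ∀ n i, volume (J n i) ≤ ENNReal.ofReal R⁻¹ * Metric.ediam (U n i) := by
    intro n i
    refine (Real.volume_le_diam _).trans ?_
    rw [Metric.ediam_closure]
    refine Metric.ediam_le ?_
    rintro t ⟨ht, x, hx, hxU⟩ t' ⟨ht', x', hx', hxU'⟩
    have h1 := SeesBall.mul_abs_sub_le hD hx hx' (t := t) (t' := t') (by linarith [ht.2]) (by linarith [ht'.2])
    refine le_trans ?_ (mul_le_mul_right (Metric.edist_le_ediam_of_mem hxU hxU') _)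
    rw [edist_dist, edist_dist, ← ENNReal.ofReal_mul (by positivity), Real.dist_eq]
    apply ENNReal.ofReal_le_ofReal
    rw [le_inv_mul_iff₀ hR]
    exact h1
  have hP : ∀ n i, ∀ t ∈ Set.Ioc (0:ℝ) (1/2), Metric.ediam (P n i t) ≤ 2 * Metric.ediam (U n i) := by
    intro n i t ht
    refine Metric.ediam_le ?_
    rintro x ⟨hx, hxU⟩ x' ⟨hx', hxU'⟩
    refine le_trans ?_ (mul_le_mul_right (Metric.edist_le_ediam_of_mem hxU hxU') _)
    have : dist (x + t • (b - x)) (x' + t • (b - x')) = (1 - t) * dist x x' := by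
      rw [dist_eq_norm, dist_eq_norm, ← Real.norm_of_nonneg (show 0 ≤ 1 - t by linarith [ht.2]),
        ← norm_smul]
      congr 1
      module
    rw [edist_dist, edist_dist, this]
    calc ENNReal.ofReal (dist x x') ≤ ENNReal.ofReal (2 * ((1 - t) * dist x x')) := by
          apply ENNReal.ofReal_le_ofReal
          have := ht.2
          have := dist_nonneg (x := x) (y := x')
          nlinarith
      _ = 2 * ENNReal.ofReal ((1 - t) * dist x x') := by
          rw [ENNReal.ofReal_mul (by norm_num)]; norm_num
  let f : ℕ → ℝ → ENNReal := fun n t =>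
    ∑' i, (J n i).indicator (fun _ => (2 * Metric.ediam (U n i)) ^ m) t
  have hfm : ∀ n, Measurable (f n) := fun n =>
    Measurable.tsum fun i => measurable_const.indicator (hJm n i)
  have hle : ∀ t ∈ Set.Ioc (0:ℝ) (1/2), Measure.hausdorffMeasure m {x ∈ D | x + t • (b - x) ∈ S} ≤
      liminf (fun n => f n t) atTop := by
    intro t ht
    have h2r : Tendsto (fun n : ℕ => 2 * ((n:ENNReal) + 1)⁻¹) atTop (𝓝 0) := by
      have := ENNReal.Tendsto.const_mul (a := 2) hr0 (Or.inr (by norm_num))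
      simpa using this
    refine (Measure.hausdorffMeasure_le_liminf_tsum m _ _ h2r (fun n i => P n i t) ?_ ?_).trans ?_
    · exact Eventually.of_forall fun n i => (hP n i t ht).trans (mul_le_mul_right (hU2 n i) _)
    · refine Eventually.of_forall fun n x hx => ?_
      obtain ⟨i, hi⟩ := Set.mem_iUnion.1 (hU1 n hx.2)
      exact Set.mem_iUnion.2 ⟨i, hx.1, hi⟩
    · refine liminf_le_liminf (Eventually.of_forall fun n => ENNReal.tsum_le_tsum fun i => ?_)
      rcases (P n i t).eq_empty_or_nonempty with h | h
      · simp [h, hm]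
      · rw [Set.indicator_of_mem (show t ∈ J n i from subset_closure ⟨ht, h⟩)]
        exact ENNReal.rpow_le_rpow (hP n i t ht) hm.le
  -- The coverings change with `n`, so the measure of a section is only bounded by a lower limit;
  -- Fatou's lemma takes it out of the integral.
  calc _ ≤ ∫⁻ t in Set.Ioc (0:ℝ) (1/2), liminf (fun n => f n t) atTop :=
        setLIntegral_mono' measurableSet_Ioc hle
    _ ≤ liminf (fun n => ∫⁻ t in Set.Ioc (0:ℝ) (1/2), f n t) atTop := lintegral_liminf_le hfm
    _ ≤ liminf (fun n : ℕ => 2 ^ m * ENNReal.ofReal R⁻¹ *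
          (Measure.hausdorffMeasure (m + 1) S + ((n:ENNReal) + 1)⁻¹)) atTop := by
        refine liminf_le_liminf (Eventually.of_forall fun n => ?_)
        refine le_trans ?_ (mul_le_mul_right (hU3 n) _)
        rw [lintegral_tsum fun i => (measurable_const.indicator (hJm n i)).aemeasurable,
          ← ENNReal.tsum_mul_left]
        refine ENNReal.tsum_le_tsum fun i => ?_
        rw [lintegral_indicator (hJm n i), setLIntegral_const]
        calc (2 * Metric.ediam (U n i)) ^ m * (volume.restrict (Set.Ioc 0 (1/2))) (J n i)
            ≤ (2 * Metric.ediam (U n i)) ^ m * (ENNReal.ofReal R⁻¹ * Metric.ediam (U n i)) := by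
              gcongr
              exact (Measure.restrict_apply_le _ _).trans (hJ n i)
          _ = 2 ^ m * ENNReal.ofReal R⁻¹ * Metric.ediam (U n i) ^ (m + 1) := by
              rw [ENNReal.mul_rpow_of_nonneg _ _ hm.le, ENNReal.rpow_add_of_nonneg _ _ hm.le zero_le_one,
                ENNReal.rpow_one]
              ring
    _ = 2 ^ m * ENNReal.ofReal R⁻¹ * Measure.hausdorffMeasure (m + 1) S := by
        refine Tendsto.liminf_eq ?_
        have := ENNReal.Tendsto.const_mul (a := 2 ^ m * ENNReal.ofReal R⁻¹)
          (hr0.const_add (Measure.hausdorffMeasure (m + 1) S)) (Or.inr hct)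
        simpa using this

/-- The normalised Hausdorff measure is volume in top dimension, and its normalising factor is
nonzero and can be inverted. -/
theorem exists_hausdorff_eq_smul_volume (d : ℕ) : ∃ C : ENNReal, C ≠ ⊤ ∧
    (Measure.hausdorffMeasure (d:ℝ) : Measure (E d)) = C • volume := by
  have h : Measure.addHaarScalarFactor (volume : Measure (E d)) (Measure.hausdorffMeasure d) ≠ 0 :=
    Measure.addHaarScalarFactor_volume_hausdorffMeasure_ne_zero d
  refine ⟨((Measure.addHaarScalarFactor (volume : Measure (E d)) (Measure.hausdorffMeasure d))⁻¹ : NNReal),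
    ENNReal.coe_ne_top, ?_⟩
  have h2 := EuclideanSpace.euclideanHausdorffMeasure_eq_volume d
  rw [Measure.euclideanHausdorffMeasure_def] at h2
  refine Eq.trans ?_ (congrArg (fun μ : Measure (E d) => (Measure.addHaarScalarFactor
    (volume : Measure (E d)) (Measure.hausdorffMeasure d))⁻¹ • μ) h2)
  simp only [smul_smul, inv_mul_cancel₀ h, one_smul]

/-- The image of `dt × surf D` under `(t, x) ↦ x + t • (b - x)` is dominated by a multiple of
volume: the sections of the preimage of `S` are those of the Eilenberg inequality with `m = d - 1`,
positive since `d ≥ 2`. The constant depends on `d` only, hence it is uniform in the vertex `b`. -/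
theorem lintegral_slices_le (hd : 2 ≤ d) : ∃ C : ENNReal, C ≠ ⊤ ∧ ∀ (T D : Set (E d)) (b : E d) (R : ℝ),
    0 < R → (∀ x ∈ D, x ∉ T ∧ SeesBall T x b R) → surf D Set.univ ≠ ⊤ → ∀ g : E d → ENNReal,
    Measurable g → ∫⁻ t in Set.Ioc (0:ℝ) (1/2), ∫⁻ x, g (x + t • (b - x)) ∂(surf D) ≤
      C * ENNReal.ofReal R⁻¹ * ∫⁻ y, g y := by
  obtain ⟨C, hC, hCv⟩ := exists_hausdorff_eq_smul_volume d
  let a := Measure.addHaarScalarFactor (volume : Measure (E (d - 1))) (Measure.hausdorffMeasure ((d - 1 : ℕ):ℝ))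
  have hm : (0:ℝ) < ((d - 1 : ℕ) : ℝ) := by
    have : 0 < d - 1 := by omega
    exact_mod_cast this
  have hmd : ((d - 1 : ℕ) : ℝ) + 1 = d := by
    have : d - 1 + 1 = d := by omega
    exact_mod_cast this
  refine ⟨a * 2 ^ ((d - 1 : ℕ) : ℝ) * C, ?_, ?_⟩
  · exact ENNReal.mul_ne_top (ENNReal.mul_ne_top ENNReal.coe_ne_top
      (ENNReal.rpow_ne_top_of_nonneg hm.le (by norm_num))) hC
  intro T D b R hR hD hfin g hg
  have : IsFiniteMeasure (surf D) := ⟨lt_of_le_of_ne le_top hfin⟩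
  have hΦ : Measurable fun p : ℝ × E d => p.2 + p.1 • (b - p.2) := by fun_prop
  have hmeas : Measure.map (fun p : ℝ × E d => p.2 + p.1 • (b - p.2))
      ((volume.restrict (Set.Ioc (0:ℝ) (1/2))).prod (surf D)) ≤
      (a * 2 ^ ((d - 1 : ℕ) : ℝ) * C * ENNReal.ofReal R⁻¹) • (volume : Measure (E d)) := by
    refine Measure.le_iff.2 fun S hS => ?_
    rw [Measure.map_apply hΦ hS, Measure.prod_apply (hΦ hS), Measure.smul_apply, smul_eq_mul]
    have e : ∀ t : ℝ, surf D (Prod.mk t ⁻¹' ((fun p : ℝ × E d => p.2 + p.1 • (b - p.2)) ⁻¹' S)) =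
        a * Measure.hausdorffMeasure ((d - 1 : ℕ):ℝ) {x ∈ D | x + t • (b - x) ∈ S} := by
      intro t
      rw [Measure.restrict_apply (by exact (measurable_prodMk_left (hΦ hS))),
        Measure.euclideanHausdorffMeasure_def, Measure.smul_apply, ENNReal.smul_def, smul_eq_mul]
      congr 2
      ext x
      exact and_comm
    simp_rw [e]
    rw [lintegral_const_mul' _ _ ENNReal.coe_ne_top]
    calc _ ≤ a * (2 ^ ((d - 1 : ℕ) : ℝ) * ENNReal.ofReal R⁻¹ * Measure.hausdorffMeasure (((d - 1 : ℕ) : ℝ) + 1) S) := by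
          gcongr
          exact lintegral_hausdorff_slices_le hR hD hm S
      _ = _ := by
          rw [hmd, hCv, Measure.smul_apply, smul_eq_mul]; ring
  calc ∫⁻ t in Set.Ioc (0:ℝ) (1/2), ∫⁻ x, g (x + t • (b - x)) ∂(surf D)
      = ∫⁻ y, g y ∂(Measure.map (fun p : ℝ × E d => p.2 + p.1 • (b - p.2))
      ((volume.restrict (Set.Ioc (0:ℝ) (1/2))).prod (surf D))) := by
        rw [lintegral_map hg hΦ, lintegral_prod (fun p : ℝ × E d => g (p.2 + p.1 • (b - p.2))) (hg.comp hΦ).aemeasurable]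
    _ ≤ ∫⁻ y, g y ∂((a * 2 ^ ((d - 1 : ℕ) : ℝ) * C * ENNReal.ofReal R⁻¹) • (volume : Measure (E d))) :=
        lintegral_mono' hmeas le_rfl
    _ = _ := by rw [lintegral_smul_measure, smul_eq_mul]

end Slices

theorem lintegral_sq_le {α : Type*} [MeasurableSpace α] {μ : Measure α} (hμ : μ Set.univ ≤ 1)
    {f : α → ENNReal} (hf : AEMeasurable f μ) : (∫⁻ a, f a ∂μ) ^ 2 ≤ ∫⁻ a, f a ^ 2 ∂μ := by
  have h := ENNReal.lintegral_mul_le_Lp_mul_Lq μ Real.HolderConjugate.two_two hf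
    (aemeasurable_const (b := (1:ENNReal)))
  simp only [Pi.mul_apply, mul_one, ENNReal.one_rpow, lintegral_one] at h
  have h1 : (μ Set.univ) ^ (1 / 2 : ℝ) ≤ 1 := ENNReal.rpow_le_one hμ (by norm_num)
  calc (∫⁻ a, f a ∂μ) ^ 2 ≤ ((∫⁻ a, f a ^ (2:ℝ) ∂μ) ^ (1 / 2 : ℝ)) ^ 2 := by
        gcongr
        exact h.trans (mul_le_of_le_one_right' h1)
    _ = ∫⁻ a, f a ^ (2:ℝ) ∂μ := by
        rw [← ENNReal.rpow_natCast, ← ENNReal.rpow_mul]; norm_num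
    _ = _ := by simp

/-! ### Boundary values as limits of cone averages. -/

section ConeTrace

variable {d : ℕ} {φ : E d → ℝ} {c : E d} {R M : ℝ} {T D : Set (E d)} {u : E d → ℝ} {G : E d → E d}

theorem measurable_coneSlice_uncurry (hφ : Measurable φ) (hG : Measurable G) :
    Measurable fun p : E d × ℝ => coneSlice φ G p.2 p.1 := by
  have : Measurable fun q : (E d × ℝ) × E d => ENNReal.ofReal (φ q.2) *
      (‖G (q.1.1 + q.1.2 • (q.2 - q.1.1))‖ₑ * ‖q.2 - q.1.1‖ₑ) := by fun_prop
  exact this.lintegral_prod_right'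

/-- Cauchy–Schwarz twice: over heights, an interval of length below one, and over `b` for the
probability measure with density `φ`. -/
theorem sq_lintegral_coneSlice_le (hφ : IsMollifier φ c R M) (hG : Measurable G) {x : E d} {K : ENNReal}
    (hK : ∀ b ∈ Metric.closedBall c R, ‖b - x‖ₑ ≤ K) :
    (∫⁻ t in Set.Ioc (0:ℝ) (1/2), coneSlice φ G t x) ^ 2 ≤
      K ^ 2 * ∫⁻ t in Set.Ioc (0:ℝ) (1/2), ∫⁻ b, ENNReal.ofReal (φ b) * ‖G (x + t • (b - x))‖ₑ ^ 2 := by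
  have hφm : Measurable φ := hφ.smooth.continuous.measurable
  have hm := (measurable_coneSlice_uncurry hφm hG).comp (measurable_prodMk_left (x := x))
  have hm2 : Measurable fun p : ℝ × E d => ENNReal.ofReal (φ p.2) * ‖G (x + p.1 • (p.2 - x))‖ₑ ^ 2 := by
    fun_prop
  have h1 : (∫⁻ t in Set.Ioc (0:ℝ) (1/2), coneSlice φ G t x) ^ 2 ≤
      ∫⁻ t in Set.Ioc (0:ℝ) (1/2), (coneSlice φ G t x) ^ 2 := by
    refine lintegral_sq_le ?_ hm.aemeasurable
    simp only [Measure.restrict_apply MeasurableSet.univ, Set.univ_inter, Real.volume_Ioc]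
    rw [ENNReal.ofReal_le_one]; norm_num
  refine h1.trans ?_
  rw [← lintegral_const_mul _ hm2.lintegral_prod_right']
  refine lintegral_mono fun t => ?_
  have hm2t : Measurable fun b => ENNReal.ofReal (φ b) * ‖G (x + t • (b - x))‖ₑ ^ 2 := by fun_prop
  refine le_of_le_of_eq ?_ (lintegral_const_mul _ hm2t)
  have hdens : ∀ f : E d → ENNReal, Measurable f →
      ∫⁻ b, f b ∂(volume.withDensity fun b => ENNReal.ofReal (φ b)) = ∫⁻ b, ENNReal.ofReal (φ b) * f b :=
    fun f hf => lintegral_withDensity_eq_lintegral_mul _ hφm.ennreal_ofReal hf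
  have hf1 : Measurable fun b => ‖G (x + t • (b - x))‖ₑ * ‖b - x‖ₑ := by fun_prop
  have h2 := lintegral_sq_le (μ := volume.withDensity fun b => ENNReal.ofReal (φ b)) ?_ hf1.aemeasurable
  · rw [hdens _ hf1, hdens _ (hf1.pow_const 2)] at h2
    refine h2.trans (lintegral_mono fun b => ?_)
    by_cases hb : b ∈ Metric.closedBall c R
    · calc ENNReal.ofReal (φ b) * (‖G (x + t • (b - x))‖ₑ * ‖b - x‖ₑ) ^ 2
          ≤ ENNReal.ofReal (φ b) * (‖G (x + t • (b - x))‖ₑ * K) ^ 2 := by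
            gcongr; exact hK b hb
        _ = _ := by ring
    · simp [hφ.eq_zero hb]
  · rw [withDensity_apply _ MeasurableSet.univ, Measure.restrict_univ, hφ.lintegral_eq]

/-- Cauchy criterion: averages at heights below `t` differ from the one at `t` by at most the
integral over `(0, t]`, which tends to zero when the whole integral is finite. -/
theorem tendsto_coneAvg_of_lintegral_ne_top (hW : WeakGradOn T u G) (hφ : IsMollifier φ c R M)
    {x : E d} (hcone : ∀ b ∈ Metric.closedBall c R, ∀ t ∈ Set.Ioc (0:ℝ) 1, x + t • (b - x) ∈ T)
    (hfin : ∫⁻ t in Set.Ioc (0:ℝ) (1/2), coneSlice φ G t x ≠ ⊤) :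
    ∃ a, Tendsto (fun t => coneAvg φ u t x) (𝓝[>] 0) (𝓝 a) ∧
      ‖a‖ₑ ≤ ‖coneAvg φ u (1/2) x‖ₑ + ∫⁻ t in Set.Ioc (0:ℝ) (1/2), coneSlice φ G t x := by
  have hdiff : ∀ s t : ℝ, 0 < s → s ≤ t → t ≤ 1 / 2 →
      ‖coneAvg φ u t x - coneAvg φ u s x‖ₑ ≤ ∫⁻ r in Set.Ioc 0 t, coneSlice φ G r x := by
    intro s t hs hst ht
    refine (enorm_coneAvg_sub_le hW hφ.smooth hφ.compact hφ.nonneg hs hst ?_).trans ?_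
    · intro r hr b hb
      exact hcone b (hφ.supp hb) r ⟨hs.trans_le hr.1, by linarith [hr.2]⟩
    · exact lintegral_mono_set (Set.Ioc_subset_Ioc_left hs.le)
  have hvol : Tendsto (fun t : ℝ => (volume.restrict (Set.Ioc (0:ℝ) (1/2))) (Set.Ioc 0 t)) (𝓝[>] 0) (𝓝 0) := by
    refine tendsto_of_tendsto_of_tendsto_of_le_of_le tendsto_const_nhds
      (h := fun t : ℝ => ENNReal.ofReal (t - 0)) ?_ (fun _ => zero_le) (fun t => ?_)
    · have : Tendsto (fun t : ℝ => ENNReal.ofReal (t - 0)) (𝓝 0) (𝓝 (ENNReal.ofReal (0 - 0))) := by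
        exact (ENNReal.continuous_ofReal.comp (continuous_id.sub continuous_const)).tendsto 0
      simpa using this.mono_left nhdsWithin_le_nhds
    · exact (Measure.restrict_apply_le _ _).trans (by rw [Real.volume_Ioc])
  have hsmall := tendsto_setLIntegral_zero hfin hvol
  have hcauchy : Cauchy (map (fun t => coneAvg φ u t x) (𝓝[>] 0)) := by
    rw [EMetric.cauchy_iff]
    refine ⟨(inferInstance : NeBot _).ne, fun ε hε => ?_⟩
    have h1 := hsmall.eventually (gt_mem_nhds (ENNReal.half_pos hε.ne'))
    obtain ⟨t, h1t, ht⟩ := (h1.and (Ioc_mem_nhdsGT (show (0:ℝ) < 1/2 by norm_num))).exists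
    rw [Measure.restrict_restrict measurableSet_Ioc,
      Set.inter_eq_left.2 (Set.Ioc_subset_Ioc_right ht.2)] at h1t
    refine ⟨_, image_mem_map (Ioc_mem_nhdsGT ht.1), ?_⟩
    rintro _ ⟨s, hs, rfl⟩ _ ⟨s', hs', rfl⟩
    calc edist (coneAvg φ u s x) (coneAvg φ u s' x)
        ≤ edist (coneAvg φ u t x) (coneAvg φ u s x) + edist (coneAvg φ u t x) (coneAvg φ u s' x) :=
          edist_triangle_left _ _ _
      _ < ε / 2 + ε / 2 := by
          rw [edist_eq_enorm_sub, edist_eq_enorm_sub]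
          exact ENNReal.add_lt_add ((hdiff s t hs.1 hs.2 ht.2).trans_lt h1t)
            ((hdiff s' t hs'.1 hs'.2 ht.2).trans_lt h1t)
      _ = ε := ENNReal.add_halves ε
  obtain ⟨a, ha⟩ := cauchy_map_iff_exists_tendsto.1 hcauchy
  refine ⟨a, ha, ?_⟩
  refine le_of_tendsto ha.enorm ?_
  filter_upwards [Ioc_mem_nhdsGT (show (0:ℝ) < 1/2 by norm_num)] with s hs
  calc ‖coneAvg φ u s x‖ₑ = ‖coneAvg φ u (1/2) x - (coneAvg φ u (1/2) x - coneAvg φ u s x)‖ₑ := by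
        congr 1; ring
    _ ≤ ‖coneAvg φ u (1/2) x‖ₑ + ‖coneAvg φ u (1/2) x - coneAvg φ u s x‖ₑ := enorm_sub_le
    _ ≤ _ := by gcongr; exact hdiff s (1/2) hs.1 hs.2 le_rfl

/-- Square-integrable boundary values as limits of cone averages. -/
theorem exists_memLp_tendsto_coneAvg (hd : 2 ≤ d) (hW : WeakGradOn T u G) (hu : Measurable u)
    (hG : Measurable G) (hG2 : ∫⁻ y, ‖G y‖ₑ ^ 2 ≠ ⊤) (hR : 0 < R) (hDm : MeasurableSet D)
    (hDb : Bornology.IsBounded D) (hDfin : surf D Set.univ ≠ ⊤)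
    (hD : ∀ x ∈ D, x ∉ T ∧ SeesBall T x c R) (hM : 0 ≤ M) (hφ : IsMollifier φ c (R / 2) M) :
    ∃ g : E d → ℝ, MemLp g 2 (surf D) ∧
      ∀ᵐ x ∂(surf D), Tendsto (fun t => coneAvg φ u t x) (𝓝[>] 0) (𝓝 (g x)) := by
  have hfinm : IsFiniteMeasure (surf D) := ⟨lt_of_le_of_ne le_top hDfin⟩
  have hφm : Measurable φ := hφ.smooth.continuous.measurable
  have hball : Metric.closedBall c (R / 2) ⊆ Metric.ball c R :=
    Metric.closedBall_subset_ball (by linarith)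
  obtain ⟨K, hK⟩ : ∃ K : ℝ, ∀ x ∈ D, ∀ b ∈ Metric.closedBall c (R / 2), ‖b - x‖ₑ ≤ ENNReal.ofReal K := by
    obtain ⟨K, hK⟩ := (Metric.isBounded_iff).1 (hDb.union (Metric.isBounded_closedBall (x := c) (r := R / 2)))
    refine ⟨K, fun x hx b hb => ?_⟩
    rw [← ofReal_norm, ← dist_eq_norm]
    exact ENNReal.ofReal_le_ofReal (hK (Or.inr hb) (Or.inl hx))
  obtain ⟨C, hC, hslice⟩ := lintegral_slices_le hd
  set I : E d → ENNReal := fun x => ∫⁻ t in Set.Ioc (0:ℝ) (1/2), coneSlice φ G t x with hI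
  have hIm : Measurable I := (measurable_coneSlice_uncurry hφm hG).lintegral_prod_right'
  have hI2 : ∫⁻ x, I x ^ 2 ∂(surf D) ≠ ⊤ := by
    have h1 : ∫⁻ x, I x ^ 2 ∂(surf D) ≤ ∫⁻ x, (ENNReal.ofReal K ^ 2 *
        ∫⁻ t in Set.Ioc (0:ℝ) (1/2), ∫⁻ b, ENNReal.ofReal (φ b) * ‖G (x + t • (b - x))‖ₑ ^ 2) ∂(surf D) := by
      refine lintegral_mono_ae ?_
      filter_upwards [ae_restrict_mem hDm] with x hx
      exact sq_lintegral_coneSlice_le hφ hG (hK x hx)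
    have hm2 : Measurable fun p : (E d × ℝ) × E d =>
        ENNReal.ofReal (φ p.2) * ‖G (p.1.1 + p.1.2 • (p.2 - p.1.1))‖ₑ ^ 2 := by fun_prop
    have hm3 : Measurable fun p : (E d × E d) × ℝ =>
        ENNReal.ofReal (φ p.1.2) * ‖G (p.1.1 + p.2 • (p.1.2 - p.1.1))‖ₑ ^ 2 := by fun_prop
    have hm4 : ∀ x : E d, Measurable fun p : ℝ × E d =>
        ENNReal.ofReal (φ p.2) * ‖G (x + p.1 • (p.2 - x))‖ₑ ^ 2 := fun x => by fun_prop
    have hm5 : ∀ b : E d, Measurable fun p : E d × ℝ => ‖G (p.1 + p.2 • (b - p.1))‖ₑ ^ 2 :=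
      fun b => by fun_prop
    have h2 : ∫⁻ x, (∫⁻ t in Set.Ioc (0:ℝ) (1/2), ∫⁻ b,
        ENNReal.ofReal (φ b) * ‖G (x + t • (b - x))‖ₑ ^ 2) ∂(surf D) ≤
        C * ENNReal.ofReal (R / 2)⁻¹ * ∫⁻ y, ‖G y‖ₑ ^ 2 := by
      have hswap : ∀ x, ∫⁻ t in Set.Ioc (0:ℝ) (1/2), ∫⁻ b,
          ENNReal.ofReal (φ b) * ‖G (x + t • (b - x))‖ₑ ^ 2 = ∫⁻ b, ∫⁻ t in Set.Ioc (0:ℝ) (1/2),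
          ENNReal.ofReal (φ b) * ‖G (x + t • (b - x))‖ₑ ^ 2 :=
        fun x => lintegral_lintegral_swap (hm4 x).aemeasurable
      simp_rw [hswap]
      rw [lintegral_lintegral_swap (hm3.lintegral_prod_right').aemeasurable]
      calc ∫⁻ b, ∫⁻ x, (∫⁻ t in Set.Ioc (0:ℝ) (1/2),
            ENNReal.ofReal (φ b) * ‖G (x + t • (b - x))‖ₑ ^ 2) ∂(surf D)
          ≤ ∫⁻ b, ENNReal.ofReal (φ b) * (C * ENNReal.ofReal (R / 2)⁻¹ * ∫⁻ y, ‖G y‖ₑ ^ 2) := by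
            refine lintegral_mono fun b => ?_
            simp_rw [lintegral_const_mul' (ENNReal.ofReal (φ b)) _ ENNReal.ofReal_ne_top]
            by_cases hb : b ∈ Metric.closedBall c (R / 2)
            · gcongr
              rw [lintegral_lintegral_swap (hm5 b).aemeasurable]
              -- Each `b` in the support of `φ` serves as a vertex: it is within `R / 2` of `c`, so
              -- every point of `D` sees `ball b (R / 2)`. The bound does not depend on `b`, so
              -- averaging over `b` with weight `φ` keeps it.
              refine hslice T D b (R / 2) (half_pos hR) (fun x hx => ⟨(hD x hx).1, fun b' hb' =>
                (hD x hx).2 b' ?_⟩) hDfin _ (hG.enorm.pow_const 2)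
              rw [Metric.mem_ball] at hb' ⊢
              rw [Metric.mem_closedBall] at hb
              linarith [dist_triangle b' b c]
            · simp [hφ.eq_zero hb]
        _ = _ := by
            rw [lintegral_mul_const _ hφm.ennreal_ofReal, hφ.lintegral_eq, one_mul]
    rw [lintegral_const_mul _ (hm2.lintegral_prod_right').lintegral_prod_right'] at h1
    refine ne_top_of_le_ne_top ?_ (h1.trans (mul_le_mul_right h2 _))
    finiteness
  have hIfin : ∀ᵐ x ∂(surf D), I x ≠ ⊤ := by
    filter_upwards [ae_lt_top (hIm.pow_const 2) hI2] with x hx h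
    simp [h] at hx
  have hex : ∀ᵐ x ∂(surf D), ∃ a, Tendsto (fun t => coneAvg φ u t x) (𝓝[>] 0) (𝓝 a) ∧
      ‖a‖ₑ ≤ ‖coneAvg φ u (1/2) x‖ₑ + I x := by
    filter_upwards [hIfin, ae_restrict_mem hDm] with x hx hxD
    exact tendsto_coneAvg_of_lintegral_ne_top hW hφ
      (fun b hb t ht => (hD x hxD).2 b (hball hb) t ht) hx
  classical
  let g : E d → ℝ := fun x => if h : ∃ a, Tendsto (fun t => coneAvg φ u t x) (𝓝[>] 0) (𝓝 a) ∧
      ‖a‖ₑ ≤ ‖coneAvg φ u (1/2) x‖ₑ + I x then h.choose else 0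
  have hg : ∀ᵐ x ∂(surf D), Tendsto (fun t => coneAvg φ u t x) (𝓝[>] 0) (𝓝 (g x)) ∧
      ‖g x‖ₑ ≤ ‖coneAvg φ u (1/2) x‖ₑ + I x := by
    filter_upwards [hex] with x hx
    simp only [g, dif_pos hx]
    exact hx.choose_spec
  refine ⟨g, ⟨?_, ?_⟩, hg.mono fun x hx => hx.1⟩
  -- `g` is an almost everywhere limit of cone averages at the heights `1 / (n + 1)`, each
  -- measurable in `x`.
  · have hseq : Tendsto (fun n : ℕ => 1 / ((n:ℝ) + 1)) atTop (𝓝[>] 0) := by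
      rw [tendsto_nhdsWithin_iff]
      exact ⟨tendsto_one_div_add_atTop_nhds_zero_nat, Eventually.of_forall fun n => by
        simp only [Set.mem_Ioi]; positivity⟩
    refine aestronglyMeasurable_of_tendsto_ae atTop (f := fun (n : ℕ) x => coneAvg φ u (1 / ((n:ℝ) + 1)) x)
      (fun n => ?_) (hg.mono fun x hx => hx.1.comp hseq)
    have : StronglyMeasurable fun p : E d × E d => φ p.2 * u (p.1 + (1 / ((n:ℝ) + 1)) • (p.2 - p.1)) := by
      refine Measurable.stronglyMeasurable ?_
      fun_prop
    exact this.integral_prod_right'.aestronglyMeasurable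
  · rw [eLpNorm_lt_top_iff_lintegral_rpow_enorm_lt_top (by norm_num) (by norm_num)]
    -- At height `1/2` the average is bounded uniformly in the apex because `u` is integrable; as
    -- `D` has finite area, the square integral of `g` is controlled by that of `I`.
    set B : ENNReal := ENNReal.ofReal (M * (((1/2:ℝ))⁻¹) ^ d * ∫ y, ‖u y‖) with hB
    have hb : ∀ x, ‖coneAvg φ u (1/2) x‖ₑ ≤ B := by
      intro x
      have h1 := norm_coneAvg_sub_le hφ hM hW.int_u x (show (0:ℝ) < 1/2 by norm_num) 0
      simp only [sub_zero] at h1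
      rw [← ofReal_norm]
      refine ENNReal.ofReal_le_ofReal (h1.trans ?_)
      exact mul_le_mul_of_nonneg_left (setIntegral_le_integral hW.int_u.norm
        (Eventually.of_forall fun y => norm_nonneg _)) (by positivity)
    have h2 : ∫⁻ x, ‖g x‖ₑ ^ (2:ℝ) ∂(surf D) ≤ ∫⁻ x, 2 * (B ^ 2 + I x ^ 2) ∂(surf D) := by
      refine lintegral_mono_ae ?_
      filter_upwards [hg] with x hx
      calc ‖g x‖ₑ ^ (2:ℝ) ≤ (B + I x) ^ (2:ℝ) := by
            gcongr; exact hx.2.trans (add_le_add_left (hb x) _)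
        _ ≤ 2 ^ ((2:ℝ) - 1) * (B ^ (2:ℝ) + I x ^ (2:ℝ)) :=
            ENNReal.rpow_add_le_mul_rpow_add_rpow _ _ (by norm_num)
        _ = _ := by
            have : (2:ℝ) - 1 = 1 := by norm_num
            simp [this]
    simp only [ENNReal.toReal_ofNat]
    refine h2.trans_lt ?_
    rw [lintegral_const_mul _ (by fun_prop), lintegral_add_left measurable_const, lintegral_const]
    have : B ≠ ⊤ := ENNReal.ofReal_ne_top
    have hs : surf D Set.univ < ⊤ := measure_lt_top _ _
    exact ENNReal.mul_lt_top (by norm_num) (ENNReal.add_lt_top.2 ⟨ENNReal.mul_lt_top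
      (ENNReal.pow_lt_top this.lt_top) hs, hI2.lt_top⟩)

/-- If the averages over cones with apex `x` converge, so do the averages over `T ∩ ball x r`. -/
theorem tendsto_average_of_tendsto_coneAvg (hW : WeakGradOn T u G) (hT : MeasurableSet T)
    (hG : Measurable G) (hR : 0 < R) (hM : 0 ≤ M)
    (hφ : IsMollifier φ c R M) {x : E d} {a : ℝ}
    (ha : Tendsto (fun t => coneAvg φ u t x) (𝓝[>] 0) (𝓝 a))
    (hcone : ∀ b ∈ Metric.closedBall c R, ∀ t ∈ Set.Ioc (0:ℝ) 1, x + t • (b - x) ∈ T)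
    {r₀ : ℝ} (hr₀ : 0 < r₀) (hP : ∀ r ∈ Set.Ioo 0 r₀, ∃ z, dist z x ≤ 4 * r ∧
      ∀ y ∈ T ∩ Metric.ball x r, ∀ t ∈ Set.Ioc (0:ℝ) 1, ∀ b ∈ Metric.closedBall z r,
        y + t • (b - y) ∈ T)
    (hdens : Tendsto (fun r : ℝ => r * (∫ y in Metric.ball x (6 * r), ‖G y‖) / r ^ d) (𝓝[>] 0) (𝓝 0)) :
    Tendsto (fun r : ℝ => ⨍ y in T ∩ Metric.ball x r, ‖u y - a‖) (𝓝[>] 0) (𝓝 0) := by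
  -- With this `δ`, the section of the cone at height `r / δ` lies inside `ball x r`, and the height
  -- is at most 1 when `r < 1`.
  set δ : ℝ := ‖c - x‖ + R + 1 with hδ
  have hδ1 : 1 ≤ δ := by rw [hδ]; have := norm_nonneg (c - x); linarith
  have hδ0 : 0 < δ := by linarith
  set V : ℝ := (volume : Measure (E d)).real (Metric.closedBall c R) with hV
  have hVpos : 0 < V := volume_real_closedBall_pos c hR
  set P : ℝ → ℝ := fun r => r * (∫ y in Metric.ball x (6 * r), ‖G y‖) / r ^ d with hPdef
  have hlim : Tendsto (fun r => (δ ^ d / V + M * δ ^ d) * (12 * 4 ^ d * P r) + ‖coneAvg φ u (r / δ) x - a‖)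
      (𝓝[>] 0) (𝓝 0) := by
    have h1 : Tendsto (fun r : ℝ => r / δ) (𝓝[>] 0) (𝓝[>] 0) := by
      rw [tendsto_nhdsWithin_iff]
      refine ⟨?_, ?_⟩
      · have : Tendsto (fun r : ℝ => r / δ) (𝓝 0) (𝓝 (0 / δ)) := tendsto_id.div_const δ
        rw [zero_div] at this
        exact this.mono_left nhdsWithin_le_nhds
      · filter_upwards [self_mem_nhdsWithin] with r hr using div_pos hr hδ0
    have h2 := (tendsto_iff_norm_sub_tendsto_zero.1 ha).comp h1
    have h3 := ((hdens.const_mul (12 * 4 ^ d)).const_mul (δ ^ d / V + M * δ ^ d)).add h2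
    simpa using h3
  refine squeeze_zero' (Eventually.of_forall fun r => ?_) ?_ hlim
  · rw [setAverage_eq]
    exact smul_nonneg (inv_nonneg.2 measureReal_nonneg) (integral_nonneg fun _ => norm_nonneg _)
  filter_upwards [Ioo_mem_nhdsGT hr₀, Ioo_mem_nhdsGT (zero_lt_one' ℝ)] with r hr hr1
  have hr0 : 0 < r := hr.1
  obtain ⟨z, hz, hsee⟩ := hP r hr
  set S := T ∩ Metric.ball x r with hS
  have hSm : MeasurableSet S := hT.inter measurableSet_ball
  have hSfin : volume S ≠ ⊤ := ((measure_mono Set.inter_subset_right).trans_lt measure_ball_lt_top).ne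
  have hint : ∀ a' : ℝ, IntegrableOn (fun y => ‖u y - a'‖) S := fun a' =>
    (hW.int_u.integrableOn.sub (integrableOn_const (by exact hSfin))).norm
  -- The Poincaré constant `a'` of `T ∩ ball x r` is the intermediary: the average over `S` and the
  -- cone average are both within a multiple of `P r` of it, and the cone average tends to `a`.
  obtain ⟨a', ha'⟩ := exists_lintegral_enorm_sub_le hW hG hSm hr0 Set.inter_subset_right hz hsee
  have hpoin : ∫ y in S, ‖u y - a'‖ ≤ 12 * 4 ^ d * P r * r ^ d := by
    have hi : Integrable (fun y => ‖G y‖) (volume.restrict (Metric.ball x (6 * r))) :=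
      hW.int_G.norm.integrableOn
    have e1 : ∫⁻ y in S, ‖u y - a'‖ₑ = ENNReal.ofReal (∫ y in S, ‖u y - a'‖) := by
      rw [ofReal_integral_eq_lintegral_ofReal (hint a') (Eventually.of_forall fun _ => norm_nonneg _)]
      simp_rw [ofReal_norm]
    have e2 : ∫⁻ y in Metric.ball x (6 * r), ‖G y‖ₑ = ENNReal.ofReal (∫ y in Metric.ball x (6 * r), ‖G y‖) := by
      rw [ofReal_integral_eq_lintegral_ofReal hi (Eventually.of_forall fun _ => norm_nonneg _)]
      simp_rw [ofReal_norm]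
    rw [e1, e2] at ha'
    have e3 : (12 * 4 ^ d : ENNReal) = ENNReal.ofReal (12 * 4 ^ d) := by
      rw [ENNReal.ofReal_mul (by norm_num), ENNReal.ofReal_pow (by norm_num)]
      norm_num
    rw [e3, ← ENNReal.ofReal_mul hr0.le, ← ENNReal.ofReal_mul (by positivity)] at ha'
    have hnn : 0 ≤ ∫ y in Metric.ball x (6 * r), ‖G y‖ := integral_nonneg fun _ => norm_nonneg _
    rw [ENNReal.ofReal_le_ofReal_iff (by positivity)] at ha'
    refine ha'.trans (le_of_eq ?_)
    rw [hPdef]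
    field_simp
  set t := r / δ with ht
  have ht0 : 0 < t := div_pos hr0 hδ0
  set Bt := Metric.closedBall (x + t • (c - x)) (t * R) with hBt
  have ht1 : t ≤ 1 := by rw [ht, div_le_one hδ0]; linarith [hr1.2]
  have htδ : t * δ = r := by rw [ht]; field_simp
  have hsub : Bt ⊆ S := by
    intro y hy
    have hyb : y = x + t • ((x + t⁻¹ • (y - x)) - x) := by
      rw [add_sub_cancel_left, smul_smul, mul_inv_cancel₀ ht0.ne', one_smul]; abel
    refine ⟨?_, ?_⟩
    · rw [hyb]
      refine hcone _ ?_ t ⟨ht0, ht1⟩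
      rw [hBt, hyb] at hy
      exact (homothety_mem_closedBall ht0).1 hy
    · rw [hBt, Metric.mem_closedBall] at hy
      rw [Metric.mem_ball]
      have h1 : dist (x + t • (c - x)) x = t * ‖c - x‖ := by
        rw [dist_eq_norm, add_sub_cancel_left, norm_smul, Real.norm_of_nonneg ht0.le]
      have h2 := dist_triangle y (x + t • (c - x)) x
      rw [← htδ, hδ]
      nlinarith
  have hvolS : t ^ d * V ≤ (volume : Measure (E d)).real S := by
    rw [hV, ← volume_real_closedBall_homothety x c ht0 hR]
    exact measureReal_mono hsub hSfin
  have hSpos : 0 < (volume : Measure (E d)).real S := lt_of_lt_of_le (by positivity) hvolS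
  set J := ∫ y in S, ‖u y - a'‖ with hJ
  have hJ0 : 0 ≤ J := integral_nonneg fun _ => norm_nonneg _
  have hPr : J ≤ 12 * 4 ^ d * P r * (t ^ d * δ ^ d) := by rw [← mul_pow, htδ]; exact hpoin
  have h1 : ‖coneAvg φ u t x - a'‖ ≤ M * δ ^ d * (12 * 4 ^ d * P r) := by
    refine (norm_coneAvg_sub_le hφ hM hW.int_u x ht0 a').trans ?_
    calc M * t⁻¹ ^ d * ∫ y in Bt, ‖u y - a'‖ ≤ M * t⁻¹ ^ d * J := by
          refine mul_le_mul_of_nonneg_left ?_ (by positivity)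
          exact setIntegral_mono_set (hint a') (Eventually.of_forall fun _ => norm_nonneg _)
            hsub.eventuallyLE
      _ ≤ M * t⁻¹ ^ d * (12 * 4 ^ d * P r * (t ^ d * δ ^ d)) :=
          mul_le_mul_of_nonneg_left hPr (by positivity)
      _ = _ := by
          rw [inv_pow]
          have : t ^ d ≠ 0 := by positivity
          field_simp
  have h2 : (⨍ y in S, ‖u y - a'‖) ≤ δ ^ d / V * (12 * 4 ^ d * P r) := by
    rw [setAverage_eq, smul_eq_mul]
    calc ((volume : Measure (E d)).real S)⁻¹ * J ≤ (t ^ d * V)⁻¹ * J :=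
          mul_le_mul_of_nonneg_right (inv_anti₀ (by positivity) hvolS) hJ0
      _ ≤ (t ^ d * V)⁻¹ * (12 * 4 ^ d * P r * (t ^ d * δ ^ d)) :=
          mul_le_mul_of_nonneg_left hPr (by positivity)
      _ = _ := by
          have : t ^ d ≠ 0 := by positivity
          field_simp
  have h3 : (⨍ y in S, ‖u y - a‖) ≤ (⨍ y in S, ‖u y - a'‖) + ‖a' - a‖ := by
    have hc : ⨍ y in S, ‖a' - a‖ = ‖a' - a‖ := setAverage_const (by
      intro h; rw [measureReal_def, h] at hSpos; simp at hSpos) hSfin _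
    rw [setAverage_eq, setAverage_eq, smul_eq_mul, smul_eq_mul]
    rw [setAverage_eq, smul_eq_mul] at hc
    rw [← hc, ← mul_add]
    refine mul_le_mul_of_nonneg_left ?_ (inv_nonneg.2 measureReal_nonneg)
    have hci : IntegrableOn (fun _ : E d => ‖a' - a‖) S := integrableOn_const (by exact hSfin)
    rw [← integral_add (hint a') hci]
    refine integral_mono (hint a) ((hint a').add hci) fun y => ?_
    have : u y - a = (u y - a') + (a' - a) := by ring
    simp only [this]
    exact norm_add_le _ _
  have h4 : ‖a' - a‖ ≤ ‖coneAvg φ u t x - a'‖ + ‖coneAvg φ u t x - a‖ := by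
    have : a' - a = -(coneAvg φ u t x - a') + (coneAvg φ u t x - a) := by ring
    rw [this]
    refine (norm_add_le _ _).trans (by rw [norm_neg])
  calc (⨍ y in S, ‖u y - a‖) ≤ δ ^ d / V * (12 * 4 ^ d * P r) +
        (M * δ ^ d * (12 * 4 ^ d * P r) + ‖coneAvg φ u t x - a‖) := by linarith
    _ = _ := by ring

end ConeTrace

/-! ### Local geometry of hypersurfaces -/

/-- On `ball x r`, the set `T` is `{ρ < 0}`, with `ρ x = 0` and `ρ` close to a linear function of
gradient `n`. -/
structure IsSide {d : ℕ} (ρ : E d → ℝ) (T : Set (E d)) (x n : E d) (ε r : ℝ) : Prop where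
  pos : 0 < r
  unit : ‖n‖ = 1
  zero : ρ x = 0
  est : ∀ a ∈ Metric.ball x r, ∀ b ∈ Metric.ball x r, |ρ a - ρ b - inner ℝ n (a - b)| ≤ ε * ‖a - b‖
  mem_iff : ∀ y ∈ Metric.ball x r, (y ∈ T ↔ ρ y < 0)

section Local

variable {d : ℕ} {T F : Set (E d)} {x n : E d} {ε r : ℝ} {ρ : E d → ℝ}

/-- A `C¹` function is strictly differentiable, so increments between any two nearby points, not
only those from `x`, are linear up to a factor `ε`. -/
theorem IsOutwardNormal.exists_isSide (h : IsOutwardNormal T x n) (hε : 0 < ε) :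
    ∃ ρ r, IsSide ρ T x n ε r := by
  obtain ⟨h1, ρ, hρ, hρ0, hρn, hT⟩ := h
  have hs : HasStrictFDerivAt ρ (fderiv ℝ ρ x) x := hρ.hasStrictFDerivAt (by simp)
  have hev := hs.isLittleO.def hε
  rw [nhds_prod_eq] at hev
  obtain ⟨r1, hr1, hb1⟩ := Metric.eventually_nhds_iff_ball.1 (by rw [← nhds_prod_eq] at hev; exact hev)
  obtain ⟨r2, hr2, hb2⟩ := Metric.eventually_nhds_iff_ball.1 hT
  refine ⟨ρ, min r1 r2, lt_min hr1 hr2, h1, hρ0, fun a ha b hb => ?_, fun y hy =>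
    hb2 y (Metric.ball_subset_ball (min_le_right _ _) hy)⟩
  have h2 := hb1 (a, b) (by
    rw [← ball_prod_same]
    exact ⟨Metric.ball_subset_ball (min_le_left _ _) ha, Metric.ball_subset_ball (min_le_left _ _) hb⟩)
  have h3 : fderiv ℝ ρ x (a - b) = inner ℝ n (a - b) := by
    rw [← hρn, gradient, InnerProductSpace.toDual_symm_apply]
  rw [← h3]
  exact h2

theorem IsSide.mono (h : IsSide ρ T x n ε r) {r' : ℝ} (hr' : 0 < r') (hr : r' ≤ r) :
    IsSide ρ T x n ε r' :=
  ⟨hr', h.unit, h.zero, fun a ha b hb => h.est a (Metric.ball_subset_ball hr ha) b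
    (Metric.ball_subset_ball hr hb), fun y hy => h.mem_iff y (Metric.ball_subset_ball hr hy)⟩

theorem IsSide.continuousOn (h : IsSide ρ T x n ε r) (hε : 0 ≤ ε) :
    ContinuousOn ρ (Metric.ball x r) := by
  have : LipschitzOnWith (Real.toNNReal (1 + ε)) ρ (Metric.ball x r) := by
    refine LipschitzOnWith.of_dist_le_mul fun a ha b hb => ?_
    rw [Real.coe_toNNReal _ (by linarith), Real.dist_eq, dist_eq_norm]
    have h1 := abs_le.1 (h.est a ha b hb)
    have h2 := abs_le.1 (abs_real_inner_le_norm n (a - b))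
    rw [h.unit, one_mul] at h2
    rw [abs_le]
    constructor <;> nlinarith
  exact this.continuousOn

/-- Continuity of `ρ` keeps the closure of `T` in `{ρ ≤ 0}` near `x`. Conversely, from a zero of `ρ`
the direction `-n` leads into `T`, because the slope error `ε` is below one. -/
theorem IsSide.frontier_iff (h : IsSide ρ T x n ε r) (hT : IsOpen T) (hε : 0 ≤ ε) (hε1 : ε < 1) {y : E d}
    (hy : y ∈ Metric.ball x r) : y ∈ frontier T ↔ ρ y = 0 := by
  have hball : Metric.ball x r ∈ 𝓝 y := Metric.isOpen_ball.mem_nhds hy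
  rw [hT.frontier_eq]
  constructor
  · rintro ⟨h1, h2⟩
    rw [h.mem_iff y hy, not_lt] at h2
    refine le_antisymm ?_ h2
    have hc := (h.continuousOn hε).continuousAt hball
    by_contra! hpos
    obtain ⟨z, ⟨hz1, hz2⟩, hz⟩ := mem_closure_iff_nhds.1 h1 _
      (inter_mem hball (hc.eventually (lt_mem_nhds hpos)))
    exact absurd ((h.mem_iff z hz1).1 hz) (not_lt.2 (le_of_lt hz2))
  · intro h0
    refine ⟨?_, by rw [h.mem_iff y hy, h0]; exact lt_irrefl _⟩
    have ht : Tendsto (fun t : ℝ => y - t • n) (𝓝[>] 0) (𝓝 y) := by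
      have : Tendsto (fun t : ℝ => y - t • n) (𝓝 0) (𝓝 (y - (0:ℝ) • n)) :=
        (continuous_const.sub (continuous_id.smul continuous_const)).tendsto 0
      rw [zero_smul, sub_zero] at this
      exact this.mono_left nhdsWithin_le_nhds
    refine mem_closure_of_tendsto ht ?_
    filter_upwards [ht.eventually hball, self_mem_nhdsWithin] with t htb ht0
    have ht0 : 0 < t := ht0
    rw [h.mem_iff _ htb]
    have h1 := (abs_le.1 (h.est _ htb y hy)).2
    have h2 : y - t • n - y = -(t • n) := by abel
    rw [h2, h0, inner_neg_right, real_inner_smul_right, real_inner_self_eq_norm_sq, norm_neg, norm_smul,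
      h.unit, Real.norm_of_nonneg ht0.le] at h1
    nlinarith

/-- Let `e = n - n'`. It points inwards for `n'`, so `y + t • e` is in `T` for small `t > 0`; hence
`ρ` is negative there and `⟨n, e⟩ ≤ ε ‖e‖`. For unit vectors `⟨n, e⟩ = ‖e‖² / 2`. -/
theorem IsSide.norm_sub_le (h : IsSide ρ T x n ε r) (hT : IsOpen T) (hε : 0 ≤ ε) (hε1 : ε < 1)
    {y n' : E d} (hy : y ∈ Metric.ball x r) (hyT : y ∈ frontier T) (hn' : IsOutwardNormal T y n') :
    ‖n - n'‖ ≤ 2 * ε := by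
  have hin : ‖n - n'‖ ^ 2 = 2 * inner ℝ n (n - n') := by
    rw [norm_sub_sq_real, inner_sub_right, real_inner_self_eq_norm_sq, h.unit, hn'.1]
    ring
  have hin' : inner ℝ n' (n - n') = - inner ℝ n (n - n') := by
    rw [inner_sub_right, inner_sub_right, real_inner_self_eq_norm_sq, real_inner_self_eq_norm_sq,
      h.unit, hn'.1, real_inner_comm]
    ring
  rcases eq_or_ne n n' with rfl | hne
  · simpa using hε
  have hpos : 0 < ‖n - n'‖ := norm_pos_iff.2 (sub_ne_zero.2 hne)
  set e := n - n' with he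
  have hneg : inner ℝ n' e < 0 := by rw [hin']; nlinarith
  have hball : Metric.ball x r ∈ 𝓝 y := Metric.isOpen_ball.mem_nhds hy
  -- The accuracy is half the rate of descent along `e`, so `ρ'` still decreases in that direction.
  obtain ⟨ρ', r', h'⟩ := hn'.exists_isSide (ε := -inner ℝ n' e / (2 * ‖e‖)) (div_pos (by linarith) (by linarith))
  have ht : Tendsto (fun t : ℝ => y + t • e) (𝓝[>] 0) (𝓝 y) := by
    have : Tendsto (fun t : ℝ => y + t • e) (𝓝 0) (𝓝 (y + (0:ℝ) • e)) :=
      (continuous_const.add (continuous_id.smul continuous_const)).tendsto 0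
    rw [zero_smul, add_zero] at this
    exact this.mono_left nhdsWithin_le_nhds
  obtain ⟨t, ⟨htb, htb'⟩, ht0⟩ := ((ht.eventually (inter_mem hball
    (Metric.ball_mem_nhds y h'.pos))).and self_mem_nhdsWithin).exists
  have ht0 : 0 < t := ht0
  have e1 : y + t • e - y = t • e := by abel
  have h1 := (abs_le.1 (h'.est _ htb' y (Metric.mem_ball_self h'.pos))).2
  rw [e1, h'.zero, real_inner_smul_right, norm_smul, Real.norm_of_nonneg ht0.le] at h1
  have h1' : -inner ℝ n' e / (2 * ‖e‖) * (t * ‖e‖) = t * (-inner ℝ n' e / 2) := by field_simp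
  rw [h1'] at h1
  have h2 : ρ' (y + t • e) < 0 := by nlinarith
  have h3 := (h.mem_iff _ htb).1 ((h'.mem_iff _ htb').2 h2)
  have h4 := (abs_le.1 (h.est _ htb y hy)).1
  rw [e1, (h.frontier_iff hT hε hε1 hy).1 hyT, real_inner_smul_right, norm_smul,
    Real.norm_of_nonneg ht0.le] at h4
  have h5 : inner ℝ n e ≤ ε * ‖e‖ := by
    by_contra! h6
    nlinarith
  nlinarith

theorem IsOutwardNormal.mem_frontier (hT : IsOpen T) (h : IsOutwardNormal T x n) : x ∈ frontier T := by
  obtain ⟨ρ, r, hs⟩ := h.exists_isSide (ε := 1/2) (by norm_num)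
  exact (hs.frontier_iff hT (by norm_num) (by norm_num) (Metric.mem_ball_self hs.pos)).2 hs.zero

theorem isOutwardNormal_normal (h : ∃ n, IsOutwardNormal T x n) : IsOutwardNormal T x (normal T x) := by
  rw [normal, dif_pos h]; exact h.choose_spec

theorem continuousOn_normal (hT : IsOpen T) (h : ∀ x ∈ F, ∃ n, IsOutwardNormal T x n) :
    ContinuousOn (normal T) F := by
  intro x hx
  rw [Metric.continuousWithinAt_iff]
  intro δ hδ
  set ε := min (δ / 4) (1/2) with hε
  have hε0 : 0 < ε := by positivity
  have hε1 : ε < 1 := (min_le_right _ _).trans_lt (by norm_num)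
  obtain ⟨ρ, r, hs⟩ := (isOutwardNormal_normal (h x hx)).exists_isSide hε0
  refine ⟨r, hs.pos, fun y hyF hy => ?_⟩
  have hn' := isOutwardNormal_normal (h y hyF)
  have := hs.norm_sub_le hT hε0.le hε1 hy (hn'.mem_frontier hT) hn'
  rw [dist_comm, dist_eq_norm]
  have h3 : ε ≤ δ / 4 := min_le_left _ _
  linarith

/-- Take `z` at depth `4 * s` below `x`. For `y` within `s` of `x` and `b` within `s` of `z`, the
component of `b - y` along `n` is at most `-2 * s` while its length is at most `6 * s`. The error `6
* s / 4` is smaller than the drop, so `ρ` stays negative along the segment. -/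
theorem IsSide.exists_visible_ball (h : IsSide ρ T x n (1/4) r) {s : ℝ} (hs : s ∈ Set.Ioo 0 (r / 6)) :
    ∃ z, dist z x ≤ 4 * s ∧ ∀ y ∈ T ∩ Metric.ball x s, ∀ t ∈ Set.Ioc (0:ℝ) 1,
      ∀ b ∈ Metric.closedBall z s, y + t • (b - y) ∈ T := by
  have hs0 := hs.1
  have hs6 : 6 * s < r := by linarith [hs.2]
  have hzx : dist (x - (4 * s) • n) x = 4 * s := by
    rw [dist_eq_norm, sub_sub_cancel_left, norm_neg, norm_smul, h.unit, mul_one,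
      Real.norm_of_nonneg (by linarith)]
  refine ⟨x - (4 * s) • n, hzx.le, ?_⟩
  rintro y ⟨hyT, hy⟩ t ht b hb
  rw [Metric.mem_ball] at hy
  rw [Metric.mem_closedBall] at hb
  have hyr : y ∈ Metric.ball x r := by rw [Metric.mem_ball]; linarith
  have hbr : b ∈ Metric.ball x r := by
    rw [Metric.mem_ball]; linarith [dist_triangle b (x - (4 * s) • n) x]
  have hw : y + t • (b - y) ∈ Metric.ball x r :=
    (convex_ball x r).add_smul_sub_mem hyr hbr ⟨ht.1.le, ht.2⟩
  rw [h.mem_iff _ hw]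
  have h0 := (h.mem_iff _ hyr).1 hyT
  have h1 := (abs_le.1 (h.est _ hw y hyr)).2
  rw [add_sub_cancel_left, real_inner_smul_right, norm_smul, Real.norm_of_nonneg ht.1.le] at h1
  have hby : ‖b - y‖ ≤ 6 * s := by
    rw [← dist_eq_norm]
    linarith [dist_triangle b (x - (4 * s) • n) x, dist_triangle b x y, dist_comm x y]
  have hin : inner ℝ n (b - y) ≤ -2 * s := by
    have e : b - y = (b - (x - (4 * s) • n)) + (x - y) - (4 * s) • n := by abel
    rw [e, inner_sub_right, inner_add_right, real_inner_smul_right, real_inner_self_eq_norm_sq, h.unit]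
    have h2 := real_inner_le_norm n (b - (x - (4 * s) • n))
    have h3 := real_inner_le_norm n (x - y)
    rw [h.unit, one_mul, ← dist_eq_norm] at h2 h3
    rw [dist_comm] at h3
    linarith
  have := ht.1
  nlinarith

/-- The orthogonal projection along a unit vector. -/
theorem exists_projection_along (hd : 1 ≤ d) (hn : ‖n‖ = 1) : ∃ L : E d →L[ℝ] E (d - 1),
    (∀ v, ‖L v‖ ^ 2 + inner ℝ n v ^ 2 = ‖v‖ ^ 2) ∧ ∀ w, ∃ v, inner ℝ n v = 0 ∧ L v = w := by
  have hn0 : n ≠ 0 := by rintro rfl; simp at hn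
  have hf : Fact (Module.finrank ℝ (E d) = (d - 1) + 1) := ⟨by simp; omega⟩
  let b := OrthonormalBasis.fromOrthogonalSpanSingleton (𝕜 := ℝ) (d - 1) hn0
  let K : Submodule ℝ (E d) := (Submodule.span ℝ {n})ᗮ
  let L : E d →L[ℝ] E (d - 1) :=
    (b.repr.toContinuousLinearEquiv : K →L[ℝ] E (d - 1)) ∘L K.orthogonalProjectionOnto
  refine ⟨L, fun v => ?_, fun w => ?_⟩
  · have h1 : ‖L v‖ = ‖K.orthogonalProjectionOnto v‖ := b.repr.norm_map _
    have h2 := Submodule.norm_sq_eq_add_norm_sq_projection v (Submodule.span ℝ {n})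
    have h3 : ‖(Submodule.span ℝ {n}).orthogonalProjectionOnto v‖ = |inner ℝ n v| := by
      rw [← Submodule.norm_coe, ← Submodule.starProjection_apply,
        Submodule.starProjection_unit_singleton ℝ hn, norm_smul, hn, mul_one, Real.norm_eq_abs]
    rw [h1, h2, h3, sq_abs]
    ring
  · refine ⟨(b.repr.symm w : K), ?_, ?_⟩
    · exact Submodule.mem_orthogonal_singleton_iff_inner_right.1 (b.repr.symm w).2
    · simp [L]

theorem surf_apply (A : Set (E d)) (F : Set (E d)) (hA : MeasurableSet A) :
    surf F A = Measure.euclideanHausdorffMeasure (d - 1) (A ∩ F) := Measure.restrict_apply hA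

theorem hausdorffMeasure_le_of_dist_le {X Y : Type*} [EMetricSpace X] [EMetricSpace Y]
    [MeasurableSpace X] [BorelSpace X] [MeasurableSpace Y] [BorelSpace Y] {f : X → Y} {S : Set X}
    {K : NNReal} (h : ∀ a ∈ S, ∀ b ∈ S, edist a b ≤ K * edist (f a) (f b)) (m : ℕ) :
    (Measure.euclideanHausdorffMeasure m S : ENNReal) ≤
      K ^ m * Measure.euclideanHausdorffMeasure m (f '' S) := by
  have h1 : AntilipschitzWith K (fun a : S => f a) := fun a b => h a a.2 b b.2
  have h2 := h1.le_hausdorffMeasure_image (d := m) (by positivity) Set.univ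
  have h3 := (isometry_subtype_coe (s := S)).hausdorffMeasure_image (d := (m:ℝ))
    (Or.inl (by positivity)) Set.univ
  rw [Set.image_univ, Subtype.range_coe] at h3
  rw [← h3, Set.image_univ, ← Set.image_eq_range] at h2
  simp only [Measure.euclideanHausdorffMeasure_def, Measure.smul_apply, ENNReal.smul_def, smul_eq_mul]
  rw [mul_left_comm]
  gcongr
  simpa using h2

/-- Along the boundary `ρ` vanishes, so a chord has component at most a quarter of its length along
`n`. Projection along `n` thus shrinks distances by at most 2, and the piece of `F` is compared with
a ball of dimension `d - 1`. -/
theorem IsSide.measure_le (hd : 1 ≤ d) (h : IsSide ρ T x n (1/4) r) (hT : IsOpen T) (hF : F ⊆ frontier T)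
    {s : ℝ} (hs0 : 0 ≤ s) (hs : s < r) : surf F (Metric.closedBall x s) ≤
      ENNReal.ofReal (s ^ (d - 1)) * (2 ^ (d - 1) * volume (Metric.ball (0 : E (d - 1)) 1)) := by
  obtain ⟨L, hL, -⟩ := exists_projection_along hd h.unit
  rw [surf_apply _ _ measurableSet_closedBall]
  have h0 : ∀ a ∈ Metric.closedBall x s ∩ F, a ∈ Metric.ball x r ∧ ρ a = 0 := fun a ha => by
    have hb := Metric.closedBall_subset_ball hs ha.1
    exact ⟨hb, (h.frontier_iff hT (by norm_num) (by norm_num) hb).1 (hF ha.2)⟩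
  have hK : ∀ a ∈ Metric.closedBall x s ∩ F, ∀ b ∈ Metric.closedBall x s ∩ F,
      edist a b ≤ (2 : NNReal) * edist (L a) (L b) := by
    intro a ha b hb
    have h1 := h.est a (h0 a ha).1 b (h0 b hb).1
    rw [(h0 a ha).2, (h0 b hb).2, sub_zero, zero_sub, abs_neg] at h1
    have h2 := hL (a - b)
    have h3 : inner ℝ n (a - b) ^ 2 ≤ (1 / 4 * ‖a - b‖) ^ 2 := sq_le_sq' (by linarith [(abs_le.1 h1).1]) (abs_le.1 h1).2
    have h4 : ‖a - b‖ ≤ 2 * ‖L (a - b)‖ := by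
      refine le_of_sq_le_sq ?_ (by positivity)
      nlinarith [sq_nonneg ‖a - b‖]
    rw [edist_dist, edist_dist, ← ENNReal.ofReal_coe_nnreal, ← ENNReal.ofReal_mul (by positivity)]
    apply ENNReal.ofReal_le_ofReal
    rw [dist_eq_norm, dist_eq_norm, ← map_sub]
    exact h4
  refine (hausdorffMeasure_le_of_dist_le hK (d - 1)).trans ?_
  have hLip : ∀ v, ‖L v‖ ≤ ‖v‖ := fun v => by
    refine le_of_sq_le_sq ?_ (norm_nonneg _)
    nlinarith [hL v, sq_nonneg (inner ℝ n v)]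
  have hsub : L '' (Metric.closedBall x s ∩ F) ⊆ Metric.closedBall (L x) s := by
    rintro _ ⟨a, ⟨ha, -⟩, rfl⟩
    rw [Metric.mem_closedBall, dist_eq_norm] at ha ⊢
    rw [← map_sub]
    exact (hLip _).trans ha
  calc ((2 : NNReal) : ENNReal) ^ (d - 1) * Measure.euclideanHausdorffMeasure (d - 1) (L '' (Metric.closedBall x s ∩ F))
      ≤ ((2 : NNReal) : ENNReal) ^ (d - 1) * Measure.euclideanHausdorffMeasure (d - 1) (Metric.closedBall (L x) s) := by
        gcongr
    _ = _ := by
        rw [EuclideanSpace.euclideanHausdorffMeasure_eq_volume, Measure.addHaar_closedBall _ _ hs0]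
        simp
        ring

/-- On each short line parallel to `n` near `x`, `ρ` changes sign, so the intermediate value theorem
puts a boundary point on it. Hence the projection of the piece contains a ball, and projections do
not increase measure. -/
theorem IsSide.measure_pos (hd : 1 ≤ d) (h : IsSide ρ T x n (1/4) r) (hT : IsOpen T)
    (hF : ∀ y ∈ Metric.ball x r, y ∈ frontier T → y ∈ F) {s : ℝ} (hs : 0 < s) :
    0 < surf F (Metric.closedBall x s) := by
  obtain ⟨L, hL, hLs⟩ := exists_projection_along hd h.unit
  rw [surf_apply _ _ measurableSet_closedBall]
  set s' := min r s / 3 with hs'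
  have hs'0 : 0 < s' := by have := lt_min h.pos hs; positivity
  have hs'r : 2 * s' < r := by have := min_le_left r s; have := h.pos; linarith
  have hs's : 2 * s' ≤ s := by have := min_le_right r s; linarith
  have hLip : LipschitzWith 1 L := by
    refine LipschitzWith.of_dist_le_mul fun a b => ?_
    rw [dist_eq_norm, dist_eq_norm, ← map_sub, NNReal.coe_one, one_mul]
    refine le_of_sq_le_sq ?_ (norm_nonneg _)
    nlinarith [hL (a - b), sq_nonneg (inner ℝ n (a - b))]
  have hsub : Metric.ball (L x) s' ⊆ L '' (Metric.closedBall x s ∩ F) := by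
    intro w hw
    obtain ⟨v, hv, hLv⟩ := hLs (w - L x)
    have hvn : ‖v‖ < s' := by
      rw [Metric.mem_ball, dist_eq_norm, ← hLv] at hw
      have h1 := hL v
      rw [hv] at h1
      have : ‖L v‖ = ‖v‖ := (sq_eq_sq₀ (norm_nonneg _) (norm_nonneg _)).1 (by linarith)
      linarith
    have hnorm : ∀ t ∈ Set.Icc (-s') s', ‖v + t • n‖ < 2 * s' := by
      intro t ht
      have h1 := norm_add_le v (t • n)
      rw [norm_smul, h.unit, mul_one, Real.norm_eq_abs] at h1
      have := abs_le.2 ht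
      linarith
    have hmem : ∀ t ∈ Set.Icc (-s') s', x + (v + t • n) ∈ Metric.ball x r := by
      intro t ht
      rw [Metric.mem_ball, dist_eq_norm, add_sub_cancel_left]
      linarith [hnorm t ht]
    have hval : ∀ t ∈ Set.Icc (-s') s', |ρ (x + (v + t • n)) - t| ≤ s' / 2 := by
      intro t ht
      have h1 := h.est _ (hmem t ht) x (Metric.mem_ball_self h.pos)
      rw [h.zero, sub_zero, add_sub_cancel_left, inner_add_right, hv, zero_add, real_inner_smul_right,
        real_inner_self_eq_norm_sq, h.unit, one_pow, mul_one] at h1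
      linarith [hnorm t ht]
    have hc : ContinuousOn (fun t : ℝ => ρ (x + (v + t • n))) (Set.Icc (-s') s') :=
      (h.continuousOn (by norm_num)).comp (by fun_prop) hmem
    have h1 := (abs_le.1 (hval (-s') ⟨le_rfl, by linarith⟩)).2
    have h2 := (abs_le.1 (hval s' ⟨by linarith, le_rfl⟩)).1
    obtain ⟨t, ht, ht0⟩ := intermediate_value_Icc (by linarith) hc (show (0:ℝ) ∈ Set.Icc _ _ from
      ⟨by linarith, by linarith⟩)
    refine ⟨x + (v + t • n), ⟨?_, ?_⟩, ?_⟩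
    · rw [Metric.mem_closedBall, dist_eq_norm, add_sub_cancel_left]
      linarith [hnorm t ht]
    · exact hF _ (hmem t ht) ((h.frontier_iff hT (by norm_num) (by norm_num) (hmem t ht)).2 ht0)
    · have hLn : L n = 0 := by
        have := hL n
        rw [real_inner_self_eq_norm_sq, h.unit] at this
        rw [← norm_eq_zero]
        nlinarith [norm_nonneg (L n)]
      simp [hLn, hLv]
  have hpos : 0 < Measure.euclideanHausdorffMeasure (d - 1) (Metric.ball (L x) s') := by
    rw [EuclideanSpace.euclideanHausdorffMeasure_eq_volume]
    exact Metric.measure_ball_pos _ _ hs'0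
  refine hpos.trans_le ((measure_mono hsub).trans ?_)
  have := hLip.hausdorffMeasure_image_le (d := ((d - 1 : ℕ) : ℝ)) (by positivity) (Metric.closedBall x s ∩ F)
  simp only [Measure.euclideanHausdorffMeasure_def, Measure.smul_apply, ENNReal.smul_def, smul_eq_mul]
  gcongr
  simpa using this

end Local

/-! ### Traces on regular faces. -/

section Trace

variable {d : ℕ} {T F : Set (E d)}

theorem volume_eq_zero_of_surf_ne_top (hd : 1 ≤ d) (h : surf F Set.univ ≠ ⊤) : volume F = 0 := by
  rw [surf_apply _ _ MeasurableSet.univ, Set.univ_inter] at h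
  rw [← EuclideanSpace.euclideanHausdorffMeasure_eq_volume]
  exact (Measure.euclideanHausdorffMeasure_zero_or_top (by omega : d - 1 < d) F).resolve_right h

/-- The faces of an element, seen from the element: a relatively open part of the boundary along
which the boundary is regular. -/
structure IsRegularFace (T F : Set (E d)) : Prop where
  subset : F ⊆ frontier T
  normal : ∀ x ∈ F, ∃ n, IsOutwardNormal T x n
  relOpen : ∀ x ∈ F, ∀ᶠ y in 𝓝 x, y ∈ frontier T → y ∈ F
  finite : surf F Set.univ ≠ ⊤

/-- Being relatively open in the boundary, a face is the intersection of the closed frontier and an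
open set. -/
theorem IsRegularFace.measurableSet (h : IsRegularFace T F) : MeasurableSet F := by
  have : F = frontier T ∩ {x | ∀ᶠ y in 𝓝 x, y ∈ frontier T → y ∈ F} := by
    ext x
    constructor
    · intro hx; exact ⟨h.subset hx, h.relOpen x hx⟩
    · rintro ⟨hx, hx'⟩
      exact hx'.self_of_nhds hx
  rw [this]
  exact isClosed_frontier.measurableSet.inter (isOpen_setOfPred_eventually_nhds).measurableSet

theorem IsRegularFace.exists_isSide (h : IsRegularFace T F) {x : E d} (hx : x ∈ F) :
    ∃ ρ r, IsSide ρ T x (EnrichedHHO.normal T x) (1/4) r ∧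
      ∀ y ∈ Metric.ball x r, y ∈ frontier T → y ∈ F := by
  obtain ⟨ρ, r, hs⟩ := (isOutwardNormal_normal (h.normal x hx)).exists_isSide (ε := 1/4) (by norm_num)
  obtain ⟨r', hr', h'⟩ := Metric.eventually_nhds_iff_ball.1 (h.relOpen x hx)
  exact ⟨ρ, min r r', hs.mono (lt_min hs.pos hr') (min_le_left _ _), fun y hy =>
    h' y (Metric.ball_subset_ball (min_le_right _ _) hy)⟩

/-- The measure `|G| dx` is singular to the surface measure, since a face of finite area has volume
zero. By Besicovitch differentiation their ratio on shrinking balls tends to zero almost everywhere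
on `F`, and `surf F` of a ball of radius `6 * r` is at most a multiple of `r ^ (d - 1)`. -/
theorem IsRegularFace.ae_tendsto_density (hd : 1 ≤ d) (hT : IsOpen T) (h : IsRegularFace T F)
    {G : E d → E d} (hG : Integrable G) : ∀ᵐ x ∂(surf F),
      Tendsto (fun r : ℝ => r * (∫ y in Metric.ball x (6 * r), ‖G y‖) / r ^ d) (𝓝[>] 0) (𝓝 0) := by
  have hfinm : IsFiniteMeasure (surf F) := ⟨lt_of_le_of_ne le_top h.finite⟩
  let μ : Measure (E d) := volume.withDensity fun y => ‖G y‖ₑ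
  have hμfin : IsFiniteMeasure μ := isFiniteMeasure_withDensity (ne_of_lt hG.2)
  have hsing : μ ⟂ₘ surf F := by
    refine ⟨F, h.measurableSet, ?_, ?_⟩
    · exact withDensity_absolutelyContinuous _ _ (volume_eq_zero_of_surf_ne_top hd h.finite)
    · rw [surf_apply _ _ h.measurableSet.compl]; simp
  have hrn := hsing.rnDeriv_ae_eq_zero
  filter_upwards [Besicovitch.ae_tendsto_rnDeriv μ (surf F), hrn, ae_restrict_mem h.measurableSet]
    with x hx hx0 hxF
  rw [hx0, Pi.zero_apply] at hx
  obtain ⟨ρ, r₀, hs, hF⟩ := h.exists_isSide hxF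
  set C : ENNReal := 2 ^ (d - 1) * volume (Metric.ball (0 : E (d - 1)) 1) with hC
  have hCfin : C ≠ ⊤ := ENNReal.mul_ne_top (by finiteness) measure_ball_lt_top.ne
  have h6 : Tendsto (fun r : ℝ => 6 * r) (𝓝[>] 0) (𝓝[>] 0) := by
    rw [tendsto_nhdsWithin_iff]
    refine ⟨?_, ?_⟩
    · have : Tendsto (fun r : ℝ => 6 * r) (𝓝 0) (𝓝 (6 * 0)) := tendsto_id.const_mul 6
      rw [mul_zero] at this
      exact this.mono_left nhdsWithin_le_nhds
    · filter_upwards [self_mem_nhdsWithin] with r hr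
      exact mul_pos (by norm_num : (0:ℝ) < 6) hr
  have hlim := (hx.comp h6)
  have hlim2 : Tendsto (fun r : ℝ => (μ (Metric.closedBall x (6 * r)) / surf F (Metric.closedBall x (6 * r))) *
      (ENNReal.ofReal (6 ^ (d - 1)) * C)) (𝓝[>] 0) (𝓝 0) := by
    have := ENNReal.Tendsto.mul_const (b := ENNReal.ofReal (6 ^ (d - 1)) * C) hlim
      (Or.inr (by finiteness))
    simpa using this
  have hlim3 := (ENNReal.tendsto_toReal ENNReal.zero_ne_top).comp hlim2
  rw [ENNReal.toReal_zero] at hlim3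
  have hev : ∀ᶠ r : ℝ in 𝓝[>] 0, (μ (Metric.closedBall x (6 * r)) / surf F (Metric.closedBall x (6 * r))) *
      (ENNReal.ofReal (6 ^ (d - 1)) * C) < ⊤ := hlim2.eventually (gt_mem_nhds ENNReal.zero_lt_top)
  refine squeeze_zero' ?_ ?_ hlim3
  · filter_upwards [self_mem_nhdsWithin] with r hr
    have hr : 0 < r := hr
    have : 0 ≤ ∫ y in Metric.ball x (6 * r), ‖G y‖ := integral_nonneg fun _ => norm_nonneg _
    positivity
  filter_upwards [hev, Ioo_mem_nhdsGT (show 0 < r₀ / 6 from div_pos hs.pos (by norm_num))] with r hfin hr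
  have hr0 : 0 < r := hr.1
  have hint : ENNReal.ofReal (∫ y in Metric.ball x (6 * r), ‖G y‖) ≤ μ (Metric.closedBall x (6 * r)) := by
    rw [ofReal_integral_eq_lintegral_ofReal hG.norm.integrableOn (Eventually.of_forall fun _ => norm_nonneg _)]
    simp_rw [ofReal_norm]
    rw [withDensity_apply _ measurableSet_closedBall]
    exact lintegral_mono_set Metric.ball_subset_closedBall
  have hpos := hs.measure_pos hd hT hF (s := 6 * r) (by linarith)
  have hle := hs.measure_le hd hT h.subset (s := 6 * r) (by linarith) (by linarith [hr.2])
  have hne : surf F (Metric.closedBall x (6 * r)) ≠ ⊤ := measure_ne_top _ _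
  rw [Function.comp_apply, ← ENNReal.ofReal_le_iff_le_toReal hfin.ne]
  have hdd : r ^ d = r * r ^ (d - 1) := by
    obtain ⟨e, rfl⟩ : ∃ e, d = e + 1 := ⟨d - 1, by omega⟩
    rw [Nat.add_sub_cancel, pow_succ, mul_comm]
  have e1 : r * (∫ y in Metric.ball x (6 * r), ‖G y‖) / r ^ d =
      (∫ y in Metric.ball x (6 * r), ‖G y‖) / r ^ (d - 1) := by
    rw [hdd]; field_simp
  rw [e1, ENNReal.ofReal_div_of_pos (by positivity)]
  refine ENNReal.div_le_of_le_mul ?_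
  calc ENNReal.ofReal (∫ y in Metric.ball x (6 * r), ‖G y‖) ≤ μ (Metric.closedBall x (6 * r)) := hint
    _ = μ (Metric.closedBall x (6 * r)) / surf F (Metric.closedBall x (6 * r)) *
        surf F (Metric.closedBall x (6 * r)) := (ENNReal.div_mul_cancel hpos.ne' hne).symm
    _ ≤ μ (Metric.closedBall x (6 * r)) / surf F (Metric.closedBall x (6 * r)) *
        (ENNReal.ofReal ((6 * r) ^ (d - 1)) * C) := by gcongr
    _ = _ := by
        rw [mul_pow, ENNReal.ofReal_mul (by positivity)]; ring

/-- For `x` in the closure only, replace it by a nearby `x' ∈ X` and move the target to `b + ((1 -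
t) / t) • (x - x')`: the point at height `t` is the same, and the new target is still in the ball.
-/
theorem seesBall_of_starConvex {X : Set (E d)} {c x : E d} {R : ℝ} (hXT : X ⊆ T)
    (hstar : ∀ z ∈ Metric.ball c R, StarConvex ℝ z X) (hx : x ∈ closure X) : SeesBall T x c R := by
  intro b hb t ht
  have hlim : Tendsto (fun x' : E d => b + ((1 - t) / t) • (x - x')) (𝓝 x) (𝓝 b) := by
    have : Tendsto (fun x' : E d => b + ((1 - t) / t) • (x - x')) (𝓝 x) (𝓝 (b + ((1 - t) / t) • (x - x))) :=
      (Continuous.tendsto (by fun_prop) x)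
    simpa using this
  obtain ⟨x', hx'b, hx'⟩ := mem_closure_iff_nhds.1 hx _ (hlim.eventually (Metric.isOpen_ball.mem_nhds hb))
  have h1 := (hstar _ hx'b) hx' ht.1.le (sub_nonneg.2 ht.2) (by ring)
  apply hXT
  convert h1 using 1
  rw [smul_add, smul_smul, mul_div_cancel₀ _ ht.1.ne']
  module

/-- `T` is a finite union of sets, each star-shaped with respect to every point of a ball. -/
def IsStarUnion (T : Set (E d)) : Prop :=
  ∃ R : ℝ, 0 < R ∧ ∃ (N : ℕ) (X : Fin N → Set (E d)) (c : Fin N → E d), T = ⋃ m, X m ∧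
    ∀ m, ∀ z ∈ Metric.ball (c m) R, StarConvex ℝ z (X m)

theorem integrableOn_sub_const_inter_ball {V : Type*} [NormedAddCommGroup V] {w : E d → V}
    (hw : IntegrableOn w T) (a : V) (x : E d) (r : ℝ) :
    IntegrableOn (fun y => ‖w y - a‖) (T ∩ Metric.ball x r) := by
  refine ((hw.mono_set Set.inter_subset_left).sub (integrableOn_const ?_)).norm
  exact ((measure_mono Set.inter_subset_right).trans_lt measure_ball_lt_top).ne

theorem volume_inter_ball_pos (hT : IsOpen T) {x : E d} (hx : x ∈ closure T) {r : ℝ} (hr : 0 < r) :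
    0 < (volume : Measure (E d)).real (T ∩ Metric.ball x r) := by
  refine ENNReal.toReal_pos ?_ ((measure_mono Set.inter_subset_right).trans_lt measure_ball_lt_top).ne
  refine ((hT.inter Metric.isOpen_ball).measure_pos _ ?_).ne'
  obtain ⟨y, hy1, hy2⟩ := mem_closure_iff_nhds.1 hx _ (Metric.ball_mem_nhds x hr)
  exact ⟨y, hy2, hy1⟩

/-- Approximate limits from inside `T` are unique. -/
theorem eq_of_tendsto_average {V : Type*} [NormedAddCommGroup V] (hT : IsOpen T)
    {w w' : E d → V} (hw : IntegrableOn w T) (hw' : IntegrableOn w' T)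
    (hww : w =ᵐ[volume.restrict T] w') {x : E d} (hx : x ∈ closure T) {a b : V}
    (ha : Tendsto (fun r : ℝ => ⨍ y in T ∩ Metric.ball x r, ‖w y - a‖) (𝓝[>] 0) (𝓝 0))
    (hb : Tendsto (fun r : ℝ => ⨍ y in T ∩ Metric.ball x r, ‖w' y - b‖) (𝓝[>] 0) (𝓝 0)) : a = b := by
  rw [← sub_eq_zero, ← norm_le_zero_iff]
  have hab := ha.add hb
  rw [add_zero] at hab
  refine ge_of_tendsto hab ?_
  filter_upwards [self_mem_nhdsWithin] with r hr
  have hpos := volume_inter_ball_pos hT hx hr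
  set S := T ∩ Metric.ball x r with hS
  have hSfin : volume S ≠ ⊤ := ((measure_mono Set.inter_subset_right).trans_lt measure_ball_lt_top).ne
  have hc : ⨍ y in S, ‖a - b‖ = ‖a - b‖ := setAverage_const (by
      intro h; rw [measureReal_def, h] at hpos; simp at hpos) hSfin _
  rw [← hc]
  simp only [setAverage_eq, smul_eq_mul]
  rw [← mul_add]
  refine mul_le_mul_of_nonneg_left ?_ (inv_nonneg.2 measureReal_nonneg)
  have h1 := integrableOn_sub_const_inter_ball hw a x r
  have h2 := integrableOn_sub_const_inter_ball hw' b x r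
  rw [← integral_add h1 h2]
  refine integral_mono_ae (integrableOn_const (by exact hSfin)) (h1.add h2) ?_
  filter_upwards [ae_restrict_of_ae_restrict_of_subset Set.inter_subset_left hww] with y hy
  have : a - b = (w' y - b) - (w y - a) := by rw [hy]; abel
  simp only [this]
  rw [add_comm]
  exact norm_sub_le _ _

/-- `F` is a finite union of the pieces in the closures of the star-shaped parts. The points of each
piece see a common ball, so the cone construction applies there. The piecewise limits fit together
because approximate limits from inside `T` are unique. -/
theorem exists_memLp_tendsto_average (hd : 2 ≤ d) (hT : IsOpen T) (hTb : Bornology.IsBounded T)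
    (hstar : IsStarUnion T) (hF : IsRegularFace T F) {u : E d → ℝ} {G : E d → E d}
    (hW : WeakGradOn T u G) (hu : Measurable u) (hG : Measurable G) (hG2 : ∫⁻ y, ‖G y‖ₑ ^ 2 ≠ ⊤) :
    ∃ g : E d → ℝ, MemLp g 2 (surf F) ∧ ∀ᵐ x ∂(surf F),
      Tendsto (fun r : ℝ => ⨍ y in T ∩ Metric.ball x r, ‖u y - g x‖) (𝓝[>] 0) (𝓝 0) := by
  have hfinm : IsFiniteMeasure (surf F) := ⟨lt_of_le_of_ne le_top hF.finite⟩
  obtain ⟨R, hR, N, X, c, hX, hXs⟩ := hstar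
  let D : Fin N → Set (E d) := fun m => F ∩ closure (X m)
  have hDm : ∀ m, MeasurableSet (D m) := fun m =>
    hF.measurableSet.inter isClosed_closure.measurableSet
  have hFD : F = ⋃ m, D m := by
    have : closure T = ⋃ m, closure (X m) := by rw [hX, closure_iUnion_of_finite]
    ext x
    simp only [D, ← Set.inter_iUnion, ← this, Set.mem_inter_iff]
    exact ⟨fun h => ⟨h, frontier_subset_closure (hF.subset h)⟩, fun h => h.1⟩
  have hle : ∀ m, surf (D m) ≤ surf F := fun m => Measure.restrict_mono Set.inter_subset_left le_rfl
  have hdens := hF.ae_tendsto_density (by omega) hT hW.int_G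
  have hm : ∀ m, ∃ g : E d → ℝ, MemLp g 2 (surf (D m)) ∧ ∀ᵐ x ∂(surf (D m)),
      Tendsto (fun r : ℝ => ⨍ y in T ∩ Metric.ball x r, ‖u y - g x‖) (𝓝[>] 0) (𝓝 0) := by
    intro m
    obtain ⟨φ, hφ⟩ := exists_mollifier (c m) (half_pos hR)
    have hsee : ∀ x ∈ D m, x ∉ T ∧ SeesBall T x (c m) R := fun x hx => by
      refine ⟨fun h => ?_, seesBall_of_starConvex (by rw [hX]; exact Set.subset_iUnion X m) (hXs m) hx.2⟩
      have := hF.subset hx.1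
      rw [hT.frontier_eq] at this
      exact this.2 h
    have hDb : Bornology.IsBounded (D m) := hTb.closure.subset
      (Set.inter_subset_left.trans (hF.subset.trans frontier_subset_closure))
    have hDfin : surf (D m) Set.univ ≠ ⊤ := ne_top_of_le_ne_top hF.finite (hle m _)
    obtain ⟨g, hg, hgt⟩ := exists_memLp_tendsto_coneAvg hd hW hu hG hG2 hR (hDm m) hDb hDfin hsee
      (by positivity) hφ
    refine ⟨g, hg, ?_⟩
    filter_upwards [hgt, (Measure.absolutelyContinuous_of_le (hle m)).ae_le hdens, ae_restrict_mem (hDm m)] with x hx hxd hxD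
    obtain ⟨ρ, r₀, hs, -⟩ := hF.exists_isSide hxD.1
    exact tendsto_average_of_tendsto_coneAvg hW hT.measurableSet hG (half_pos hR) (by positivity) hφ hx
      (fun b hb t ht => (hsee x hxD).2 b (Metric.closedBall_subset_ball (by linarith) hb) t ht)
      (div_pos hs.pos (by norm_num : (0:ℝ) < 6)) (fun s hs' => hs.exists_visible_ball hs') hxd
  choose g hg hgt using hm
  classical
  -- Choosing the approximate limit itself gives a function that does not depend on the piece.
  let g₀ : E d → ℝ := fun x => if h : ∃ a,
    Tendsto (fun r : ℝ => ⨍ y in T ∩ Metric.ball x r, ‖u y - a‖) (𝓝[>] 0) (𝓝 0) then h.choose else 0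
  have hg₀ : ∀ x, (∃ a, Tendsto (fun r : ℝ => ⨍ y in T ∩ Metric.ball x r, ‖u y - a‖) (𝓝[>] 0) (𝓝 0)) →
      Tendsto (fun r : ℝ => ⨍ y in T ∩ Metric.ball x r, ‖u y - g₀ x‖) (𝓝[>] 0) (𝓝 0) := by
    intro x hx
    simp only [g₀, dif_pos hx]
    exact hx.choose_spec
  have heq : ∀ m, g₀ =ᵐ[surf (D m)] g m := by
    intro m
    filter_upwards [hgt m, ae_restrict_mem (hDm m)] with x hx hxD
    exact eq_of_tendsto_average hT hW.int_u.integrableOn hW.int_u.integrableOn (ae_eq_refl _)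
      (frontier_subset_closure (hF.subset hxD.1)) (hg₀ x ⟨_, hx⟩) hx
  have hmem : ∀ m, MemLp g₀ 2 (surf (D m)) := fun m => (hg m).ae_eq (heq m).symm
  have hae : ∀ P : E d → Prop, (∀ m, ∀ᵐ x ∂(surf (D m)), P x) → ∀ᵐ x ∂(surf F), P x := by
    intro P hP
    have : surf F = surf (⋃ m, D m) := by rw [← hFD]
    rw [this, surf, ae_restrict_iUnion_iff]
    exact hP
  refine ⟨g₀, ⟨?_, ?_⟩, hae _ fun m => ?_⟩
  · have : surf F = surf (⋃ m, D m) := by rw [← hFD]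
    rw [this, surf, aestronglyMeasurable_iUnion_iff]
    exact fun m => (hmem m).1
  · rw [eLpNorm_lt_top_iff_lintegral_rpow_enorm_lt_top (by norm_num) (by norm_num)]
    have : surf F = surf (⋃ m, D m) := by rw [← hFD]
    rw [this]
    refine (lintegral_iUnion_le _ _).trans_lt ?_
    rw [tsum_fintype]
    refine ENNReal.sum_lt_top.2 fun m _ => ?_
    exact (eLpNorm_lt_top_iff_lintegral_rpow_enorm_lt_top (by norm_num) (by norm_num)).1 (hmem m).2
  · filter_upwards [hgt m] with x hx
    exact hg₀ x ⟨_, hx⟩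

end Trace

/-! ### Linearity of the differential operators -/

/-- `f` is linear on the subspace `W`. -/
structure LinOn {H H' : Type*} [AddCommGroup H] [Module ℝ H] [AddCommGroup H'] [Module ℝ H']
    (W : Submodule ℝ H) (f : H → H') : Prop where
  add : ∀ x ∈ W, ∀ y ∈ W, f (x + y) = f x + f y
  smul : ∀ (c : ℝ), ∀ x ∈ W, f (c • x) = c • f x

section LinOn

variable {H H' : Type*} [AddCommGroup H] [Module ℝ H] [AddCommGroup H'] [Module ℝ H']
  {W : Submodule ℝ H} {f : H → H'}

/-- The restriction of `f` to `W`, as a linear map. -/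
def LinOn.toLin (h : LinOn W f) : W →ₗ[ℝ] H' where
  toFun x := f x
  map_add' x y := h.add x x.2 y y.2
  map_smul' c x := h.smul c x x.2

theorem LinOn.mono (h : LinOn W f) {W' : Submodule ℝ H} (hW : W' ≤ W) : LinOn W' f :=
  ⟨fun x hx y hy => h.add x (hW hx) y (hW hy), fun c x hx => h.smul c x (hW hx)⟩

end LinOn

section WeakDerivatives

variable {d : ℕ} {T : Set (E d)}

theorem isFiniteMeasure_restrict_of_isBounded (hTb : Bornology.IsBounded T) :
    IsFiniteMeasure ((volume : Measure (E d)).restrict T) :=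
  ⟨by rw [Measure.restrict_apply_univ]; exact hTb.measure_lt_top⟩

theorem Lp_integrable {V : Type*} [NormedAddCommGroup V] {α : Type*} [MeasurableSpace α]
    {μ : Measure α} [IsFiniteMeasure μ] (w : Lp V 2 μ) : Integrable w μ :=
  (Lp.memLp w).integrable (by norm_num)

theorem IsTest.exists_bound {φ : E d → ℝ} (h : IsTest T φ) : ∃ C, ∀ x, ‖φ x‖ ≤ C :=
  h.1.continuous.bounded_above_of_compact_support h.2.1

theorem IsTest.continuous_pd {φ : E d → ℝ} (h : IsTest T φ) (j : Fin d) : Continuous (pd j φ) :=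
  (h.1.continuous_fderiv (by simp)).clm_apply continuous_const

theorem IsTest.exists_bound_pd {φ : E d → ℝ} (h : IsTest T φ) (j : Fin d) :
    ∃ C, ∀ x, ‖pd j φ x‖ ≤ C :=
  (h.continuous_pd j).bounded_above_of_compact_support (h.2.1.fderiv_apply (𝕜 := ℝ) _)

theorem IsTest.integrable_mul {φ : E d → ℝ} (h : IsTest T φ) {μ : Measure (E d)} {f : E d → ℝ}
    (hf : Integrable f μ) : Integrable (fun x => f x * φ x) μ := by
  obtain ⟨C, hC⟩ := h.exists_bound
  exact hf.mul_bdd h.1.continuous.aestronglyMeasurable (Eventually.of_forall hC)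

theorem IsTest.integrable_mul_pd {φ : E d → ℝ} (h : IsTest T φ) (j : Fin d) {μ : Measure (E d)}
    {f : E d → ℝ} (hf : Integrable f μ) : Integrable (fun x => f x * pd j φ x) μ := by
  obtain ⟨C, hC⟩ := h.exists_bound_pd j
  exact hf.mul_bdd (h.continuous_pd j).aestronglyMeasurable (Eventually.of_forall hC)

theorem ae_eq_zero_of_forall_test (hT : IsOpen T) {f : E d → ℝ} (hf : IntegrableOn f T)
    (h : ∀ φ, IsTest T φ → ∫ x in T, f x * φ x = 0) : f =ᵐ[volume.restrict T] 0 := by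
  have := hT.ae_eq_zero_of_integral_contDiff_smul_eq_zero hf.locallyIntegrableOn
    (fun g h1 h2 h3 => ?_)
  · rw [EventuallyEq, ae_restrict_iff' hT.measurableSet]
    exact this
  · rw [← setIntegral_eq_integral_of_forall_compl_eq_zero (s := T)]
    · rw [← h g ⟨h1, h2, h3⟩]
      simp [mul_comm]
    · intro x hx
      rw [image_eq_zero_of_notMem_tsupport fun h' => hx (h3 h'), zero_smul]

theorem coord_integrable {V : Type*} [Fintype V] {α : Type*} [MeasurableSpace α] {μ : Measure α}
    {w : α → EuclideanSpace ℝ V} (hw : Integrable w μ) (i : V) : Integrable (fun x => w x i) μ :=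
  (EuclideanSpace.proj i : EuclideanSpace ℝ V →L[ℝ] ℝ).integrable_comp hw

theorem Lp_ext_coord {V : Type*} [Fintype V] {α : Type*} [MeasurableSpace α] {μ : Measure α}
    {w w' : Lp (EuclideanSpace ℝ V) 2 μ} (h : ∀ i, (fun x => w x i) =ᵐ[μ] fun x => w' x i) : w = w' := by
  refine Lp.ext ?_
  have : ∀ᵐ x ∂μ, ∀ i, w x i = w' x i := ae_all_iff.2 h
  filter_upwards [this] with x hx
  ext i
  exact hx i

theorem ae_eq_of_forall_test (hT : IsOpen T) {f g : E d → ℝ} (hf : IntegrableOn f T)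
    (hg : IntegrableOn g T) (h : ∀ φ, IsTest T φ → ∫ x in T, f x * φ x = ∫ x in T, g x * φ x) :
    f =ᵐ[volume.restrict T] g := by
  have := ae_eq_zero_of_forall_test hT (hf.sub hg) fun φ hφ => by
    simp only [Pi.sub_apply, sub_mul]
    rw [integral_sub (hφ.integrable_mul hf) (hφ.integrable_mul hg), h φ hφ, sub_self]
  filter_upwards [this] with x hx
  simpa [sub_eq_zero] using hx

theorem setIntegral_add_mul {f f' s : E d → ℝ} {w : E d → ℝ} (hf : Integrable (fun x => f x * w x) (volume.restrict T))
    (hf' : Integrable (fun x => f' x * w x) (volume.restrict T)) (hs : s =ᵐ[volume.restrict T] fun x => f x + f' x) :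
    ∫ x in T, s x * w x = (∫ x in T, f x * w x) + ∫ x in T, f' x * w x := by
  rw [← integral_add hf hf']
  refine integral_congr_ae ?_
  filter_upwards [hs] with x hx
  rw [hx]; ring

theorem setIntegral_smul_mul {f s : E d → ℝ} {w : E d → ℝ} (c : ℝ) (hs : s =ᵐ[volume.restrict T] fun x => c * f x) :
    ∫ x in T, s x * w x = c * ∫ x in T, f x * w x := by
  rw [← integral_const_mul]
  refine integral_congr_ae ?_
  filter_upwards [hs] with x hx
  rw [hx]; ring

theorem coeFn_add_coord {V : Type*} [Fintype V] (w w' : L2 (EuclideanSpace ℝ V) T) (i : V) :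
    (fun x => (w + w') x i) =ᵐ[volume.restrict T] fun x => w x i + w' x i := by
  filter_upwards [Lp.coeFn_add w w'] with x hx
  rw [hx]; rfl

theorem coeFn_smul_coord {V : Type*} [Fintype V] (c : ℝ) (w : L2 (EuclideanSpace ℝ V) T) (i : V) :
    (fun x => (c • w) x i) =ᵐ[volume.restrict T] fun x => c * w x i := by
  filter_upwards [Lp.coeFn_smul c w] with x hx
  rw [hx]; rfl

theorem isWeakGrad_zero : IsWeakGrad T (0 : L2 ℝ T) 0 := by
  have h1 := Lp.coeFn_zero ℝ 2 ((volume : Measure (E d)).restrict T)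
  have h2 := Lp.coeFn_zero (E d) 2 ((volume : Measure (E d)).restrict T)
  intro φ hφ j
  rw [integral_eq_zero_of_ae, integral_eq_zero_of_ae, neg_zero]
  · filter_upwards [h2] with x hx
    rw [hx]; simp
  · filter_upwards [h1] with x hx
    rw [hx]; simp

theorem isWeakJac_zero : IsWeakJac T (0 : L2 (E d) T) 0 := by
  have h1 := Lp.coeFn_zero (E d) 2 ((volume : Measure (E d)).restrict T)
  have h2 := Lp.coeFn_zero (Mat d) 2 ((volume : Measure (E d)).restrict T)
  intro φ hφ i j
  rw [integral_eq_zero_of_ae, integral_eq_zero_of_ae, neg_zero]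
  · filter_upwards [h2] with x hx
    rw [hx]; simp
  · filter_upwards [h1] with x hx
    rw [hx]; simp

theorem isWeakLap_of_isWeakJac_zero {w : L2 (E d) T} (h : IsWeakJac T w 0) : IsWeakLap T w 0 := by
  have h1 := Lp.coeFn_zero (E d) 2 ((volume : Measure (E d)).restrict T)
  have h2 := Lp.coeFn_zero (Mat d) 2 ((volume : Measure (E d)).restrict T)
  refine ⟨0, h, fun φ hφ i => ?_⟩
  rw [integral_eq_zero_of_ae, neg_zero]
  · refine Finset.sum_eq_zero fun j _ => integral_eq_zero_of_ae ?_
    filter_upwards [h2] with x hx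
    rw [hx]; simp
  · filter_upwards [h1] with x hx
    rw [hx]; simp

section Unique

variable [IsFiniteMeasure ((volume : Measure (E d)).restrict T)]

theorem IsWeakGrad.unique (hT : IsOpen T) {q : L2 ℝ T} {G G' : L2 (E d) T} (h : IsWeakGrad T q G)
    (h' : IsWeakGrad T q G') : G = G' :=
  Lp_ext_coord fun j => ae_eq_of_forall_test hT (coord_integrable (Lp_integrable G) j)
    (coord_integrable (Lp_integrable G') j) fun φ hφ => by
      rw [← neg_inj, ← h φ hφ j, h' φ hφ j]

theorem IsWeakJac.unique (hT : IsOpen T) {w : L2 (E d) T} {G G' : L2 (Mat d) T} (h : IsWeakJac T w G)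
    (h' : IsWeakJac T w G') : G = G' :=
  Lp_ext_coord fun p => ae_eq_of_forall_test hT (coord_integrable (Lp_integrable G) p)
    (coord_integrable (Lp_integrable G') p) fun φ hφ => by
      obtain ⟨i, j⟩ := p
      rw [← neg_inj, ← h φ hφ i j, h' φ hφ i j]

theorem IsWeakLap.unique (hT : IsOpen T) {w : L2 (E d) T} {L L' : L2 (E d) T} (h : IsWeakLap T w L)
    (h' : IsWeakLap T w L') : L = L' := by
  obtain ⟨G, hG, h⟩ := h
  obtain ⟨G', hG', h'⟩ := h'
  obtain rfl := hG.unique hT hG'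
  exact Lp_ext_coord fun i => ae_eq_of_forall_test hT (coord_integrable (Lp_integrable L) i)
    (coord_integrable (Lp_integrable L') i) fun φ hφ => by
      rw [← neg_inj, ← h φ hφ i, h' φ hφ i]

theorem IsWeakGrad.add {q q' : L2 ℝ T} {G G' : L2 (E d) T} (h : IsWeakGrad T q G)
    (h' : IsWeakGrad T q' G') : IsWeakGrad T (q + q') (G + G') := by
  intro φ hφ j
  rw [setIntegral_add_mul (hφ.integrable_mul_pd j (Lp_integrable q)) (hφ.integrable_mul_pd j (Lp_integrable q'))
    (Lp.coeFn_add q q'), setIntegral_add_mul (f := fun x => G x j) (f' := fun x => G' x j)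
    (hφ.integrable_mul (coord_integrable (Lp_integrable G) j))
    (hφ.integrable_mul (coord_integrable (Lp_integrable G') j)) (coeFn_add_coord G G' j), h φ hφ j, h' φ hφ j]
  ring

omit [IsFiniteMeasure ((volume : Measure (E d)).restrict T)] in
theorem IsWeakGrad.smul (c : ℝ) {q : L2 ℝ T} {G : L2 (E d) T} (h : IsWeakGrad T q G) :
    IsWeakGrad T (c • q) (c • G) := by
  intro φ hφ j
  rw [setIntegral_smul_mul c (Lp.coeFn_smul c q), setIntegral_smul_mul (f := fun x => G x j) c
    (coeFn_smul_coord c G j), h φ hφ j]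
  ring

theorem IsWeakJac.add {w w' : L2 (E d) T} {G G' : L2 (Mat d) T} (h : IsWeakJac T w G)
    (h' : IsWeakJac T w' G') : IsWeakJac T (w + w') (G + G') := by
  intro φ hφ i j
  rw [setIntegral_add_mul (f := fun x => w x i) (f' := fun x => w' x i)
    (hφ.integrable_mul_pd j (coord_integrable (Lp_integrable w) i))
    (hφ.integrable_mul_pd j (coord_integrable (Lp_integrable w') i))
    (coeFn_add_coord w w' i), setIntegral_add_mul (f := fun x => G x (i, j)) (f' := fun x => G' x (i, j))
    (hφ.integrable_mul (coord_integrable (Lp_integrable G) (i, j)))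
    (hφ.integrable_mul (coord_integrable (Lp_integrable G') (i, j))) (coeFn_add_coord G G' (i, j)),
    h φ hφ i j, h' φ hφ i j]
  ring

omit [IsFiniteMeasure ((volume : Measure (E d)).restrict T)] in
theorem IsWeakJac.smul (c : ℝ) {w : L2 (E d) T} {G : L2 (Mat d) T} (h : IsWeakJac T w G) :
    IsWeakJac T (c • w) (c • G) := by
  intro φ hφ i j
  rw [setIntegral_smul_mul (f := fun x => w x i) c (coeFn_smul_coord c w i),
    setIntegral_smul_mul (f := fun x => G x (i, j)) c (coeFn_smul_coord c G (i, j)), h φ hφ i j]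
  ring

theorem IsWeakLap.add {w w' L L' : L2 (E d) T} (h : IsWeakLap T w L) (h' : IsWeakLap T w' L') :
    IsWeakLap T (w + w') (L + L') := by
  obtain ⟨G, hG, h⟩ := h
  obtain ⟨G', hG', h'⟩ := h'
  refine ⟨G + G', hG.add hG', fun φ hφ i => ?_⟩
  rw [setIntegral_add_mul (f := fun x => L x i) (f' := fun x => L' x i)
    (hφ.integrable_mul (coord_integrable (Lp_integrable L) i))
    (hφ.integrable_mul (coord_integrable (Lp_integrable L') i)) (coeFn_add_coord L L' i), neg_add,
    ← h φ hφ i, ← h' φ hφ i, ← Finset.sum_add_distrib]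
  refine Finset.sum_congr rfl fun j _ => ?_
  exact setIntegral_add_mul (f := fun x => G x (i, j)) (f' := fun x => G' x (i, j))
    (hφ.integrable_mul_pd j (coord_integrable (Lp_integrable G) (i, j)))
    (hφ.integrable_mul_pd j (coord_integrable (Lp_integrable G') (i, j))) (coeFn_add_coord G G' (i, j))

omit [IsFiniteMeasure ((volume : Measure (E d)).restrict T)] in
theorem IsWeakLap.smul (c : ℝ) {w L : L2 (E d) T} (h : IsWeakLap T w L) :
    IsWeakLap T (c • w) (c • L) := by
  obtain ⟨G, hG, h⟩ := h
  refine ⟨c • G, hG.smul c, fun φ hφ i => ?_⟩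
  rw [setIntegral_smul_mul (f := fun x => L x i) c (coeFn_smul_coord c L i), ← mul_neg, ← h φ hφ i,
    Finset.mul_sum]
  refine Finset.sum_congr rfl fun j _ => ?_
  exact setIntegral_smul_mul (f := fun x => G x (i, j)) c (coeFn_smul_coord c G (i, j))

variable (T)

/-- `H¹(T)`. -/
def h1 : Submodule ℝ (L2 ℝ T) where
  carrier := {q | MemH1 T q}
  add_mem' := fun ⟨G, hG⟩ ⟨G', hG'⟩ => ⟨G + G', hG.add hG'⟩
  zero_mem' := ⟨0, isWeakGrad_zero⟩
  smul_mem' := fun c _ ⟨G, hG⟩ => ⟨c • G, hG.smul c⟩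

/-- `H¹(T)ᵈ`. -/
def h1Vec : Submodule ℝ (L2 (E d) T) where
  carrier := {w | MemH1Vec T w}
  add_mem' := fun ⟨G, hG⟩ ⟨G', hG'⟩ => ⟨G + G', hG.add hG'⟩
  zero_mem' := ⟨0, isWeakJac_zero⟩
  smul_mem' := fun c _ ⟨G, hG⟩ => ⟨c • G, hG.smul c⟩

/-- Functions in `H¹(T)ᵈ` with square-integrable Laplacian. -/
def lapDomain : Submodule ℝ (L2 (E d) T) where
  carrier := {w | ∃ L, IsWeakLap T w L}
  add_mem' := fun ⟨L, hL⟩ ⟨L', hL'⟩ => ⟨L + L', hL.add hL'⟩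
  zero_mem' := ⟨0, isWeakLap_of_isWeakJac_zero isWeakJac_zero⟩
  smul_mem' := fun c _ ⟨L, hL⟩ => ⟨c • L, hL.smul c⟩

theorem lapDomain_le : lapDomain T ≤ h1Vec T := fun _ ⟨_, G, hG, _⟩ => ⟨G, hG⟩

variable {T}

theorem isWeakGrad_weakGrad {q : L2 ℝ T} (h : q ∈ h1 T) : IsWeakGrad T q (weakGrad T q) := by
  have h : ∃ G, IsWeakGrad T q G := h
  rw [weakGrad, dif_pos h]; exact h.choose_spec

theorem isWeakJac_weakJac {w : L2 (E d) T} (h : w ∈ h1Vec T) : IsWeakJac T w (weakJac T w) := by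
  have h : ∃ G, IsWeakJac T w G := h
  rw [weakJac, dif_pos h]; exact h.choose_spec

theorem isWeakLap_weakLap {w : L2 (E d) T} (h : w ∈ lapDomain T) : IsWeakLap T w (weakLap T w) := by
  have h : ∃ L, IsWeakLap T w L := h
  rw [weakLap, dif_pos h]; exact h.choose_spec

theorem IsWeakGrad.weakGrad_eq (hT : IsOpen T) {q : L2 ℝ T} {G : L2 (E d) T} (h : IsWeakGrad T q G) :
    weakGrad T q = G := (isWeakGrad_weakGrad ⟨G, h⟩).unique hT h

theorem IsWeakJac.weakJac_eq (hT : IsOpen T) {w : L2 (E d) T} {G : L2 (Mat d) T} (h : IsWeakJac T w G) :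
    weakJac T w = G := (isWeakJac_weakJac ⟨G, h⟩).unique hT h

theorem IsWeakLap.weakLap_eq (hT : IsOpen T) {w L : L2 (E d) T} (h : IsWeakLap T w L) :
    weakLap T w = L := (isWeakLap_weakLap ⟨L, h⟩).unique hT h

/-- The operator is a choice among weak gradients; uniqueness of the weak gradient makes the choice
linear. -/
theorem linOn_weakGrad (hT : IsOpen T) : LinOn (h1 T) (weakGrad T) :=
  ⟨fun _ hx _ hy => ((isWeakGrad_weakGrad hx).add (isWeakGrad_weakGrad hy)).weakGrad_eq hT,
    fun c _ hx => ((isWeakGrad_weakGrad hx).smul c).weakGrad_eq hT⟩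

theorem linOn_weakJac (hT : IsOpen T) : LinOn (h1Vec T) (weakJac T) :=
  ⟨fun _ hx _ hy => ((isWeakJac_weakJac hx).add (isWeakJac_weakJac hy)).weakJac_eq hT,
    fun c _ hx => ((isWeakJac_weakJac hx).smul c).weakJac_eq hT⟩

theorem linOn_weakLap (hT : IsOpen T) : LinOn (lapDomain T) (weakLap T) :=
  ⟨fun _ hx _ hy => ((isWeakLap_weakLap hx).add (isWeakLap_weakLap hy)).weakLap_eq hT,
    fun c _ hx => ((isWeakLap_weakLap hx).smul c).weakLap_eq hT⟩

theorem weakLap_eq_zero (hT : IsOpen T) {w : L2 (E d) T} (hw : w ∈ h1Vec T) (h : weakJac T w = 0) :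
    weakLap T w = 0 := by
  have := isWeakJac_weakJac hw
  rw [h] at this
  exact (isWeakLap_of_isWeakJac_zero this).weakLap_eq hT

end Unique

/-- Test functions are supported in `T`, so extension by zero preserves the identities; nothing is
claimed about derivatives across the boundary. -/
theorem weakGradOn_indicator (hT : MeasurableSet T) {q : E d → ℝ} {G : E d → E d} (hq : IntegrableOn q T)
    (hG : IntegrableOn G T)
    (h : ∀ φ, IsTest T φ → ∀ j, ∫ x in T, q x * pd j φ x = -∫ x in T, G x j * φ x) :
    WeakGradOn T (T.indicator q) (T.indicator G) := by
  refine ⟨hq.integrable_indicator hT, hG.integrable_indicator hT, fun φ hφ j => ?_⟩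
  have e1 : ∀ x, T.indicator q x * pd j φ x = T.indicator (fun x => q x * pd j φ x) x := fun x => by
    by_cases hx : x ∈ T <;> simp [hx]
  have e2 : ∀ x, T.indicator G x j * φ x = T.indicator (fun x => G x j * φ x) x := fun x => by
    by_cases hx : x ∈ T <;> simp [hx]
  simp_rw [e1, e2]
  rw [integral_indicator hT, integral_indicator hT]
  exact h φ hφ j

theorem ae_const_of_weakGradOn_zero (hT : IsOpen T) (hTc : IsPreconnected T) {q : E d → ℝ}
    (hq : IntegrableOn q T) (h : ∀ φ, IsTest T φ → ∀ j, ∫ x in T, q x * pd j φ x = 0) :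
    ∃ a, q =ᵐ[volume.restrict T] fun _ => a := by
  have h1 := weakGradOn_indicator (G := fun _ => 0) hT.measurableSet hq (integrable_zero _ _ _)
    (fun φ hφ j => by simpa using h φ hφ j)
  rw [Set.indicator_zero] at h1
  obtain ⟨a, ha⟩ := WeakGradOn.ae_eq_const hT hTc h1
  refine ⟨a, ?_⟩
  rw [EventuallyEq, ae_restrict_iff' hT.measurableSet]
  filter_upwards [ha] with x hx hxT
  rw [← hx hxT, Set.indicator_of_mem hxT]

variable [IsFiniteMeasure ((volume : Measure (E d)).restrict T)]

theorem exists_ae_const_of_weakGrad_eq_zero (hT : IsOpen T) (hTc : IsPreconnected T) {q : L2 ℝ T}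
    (hq : q ∈ h1 T) (h : weakGrad T q = 0) : ∃ a : ℝ, q =ᵐ[volume.restrict T] fun _ => a := by
  refine ae_const_of_weakGradOn_zero hT hTc (Lp_integrable q) fun φ hφ j => ?_
  rw [isWeakGrad_weakGrad hq φ hφ j, h, neg_eq_zero]
  refine integral_eq_zero_of_ae ?_
  filter_upwards [Lp.coeFn_zero (E d) 2 ((volume : Measure (E d)).restrict T)] with x hx
  rw [hx]; simp

theorem exists_ae_const_of_weakJac_eq_zero (hT : IsOpen T) (hTc : IsPreconnected T) {w : L2 (E d) T}
    (hw : w ∈ h1Vec T) (h : weakJac T w = 0) : ∃ a : E d, w =ᵐ[volume.restrict T] fun _ => a := by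
  have : ∀ i, ∃ a : ℝ, (fun x => w x i) =ᵐ[volume.restrict T] fun _ => a := fun i => by
    refine ae_const_of_weakGradOn_zero hT hTc (coord_integrable (Lp_integrable w) i) fun φ hφ j => ?_
    rw [isWeakJac_weakJac hw φ hφ i j, h, neg_eq_zero]
    refine integral_eq_zero_of_ae ?_
    filter_upwards [Lp.coeFn_zero (Mat d) 2 ((volume : Measure (E d)).restrict T)] with x hx
    rw [hx]; simp
  choose a ha using this
  refine ⟨WithLp.toLp 2 a, ?_⟩
  filter_upwards [ae_all_iff.2 ha] with x hx
  ext i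
  exact hx i

end WeakDerivatives

/-! ### Traces -/

/-- `a` is the strong approximate limit of `f` at `x` from inside `T`. -/
def ApproxLim {d : ℕ} {V : Type*} [NormedAddCommGroup V] (T : Set (E d)) (x : E d) (f : E d → V)
    (a : V) : Prop :=
  Tendsto (fun r : ℝ => ⨍ y in T ∩ Metric.ball x r, ‖f y - a‖) (𝓝[>] 0) (𝓝 0)

section ApproxLim

variable {d : ℕ} {T F : Set (E d)} {V V' : Type*} [NormedAddCommGroup V] [NormedAddCommGroup V']
  {x : E d} {f f' : E d → V} {a a' : V}

theorem setAverage_nonneg (S : Set (E d)) {h : E d → ℝ} (hh : ∀ y, 0 ≤ h y) : 0 ≤ ⨍ y in S, h y := by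
  rw [setAverage_eq]
  exact smul_nonneg (inv_nonneg.2 measureReal_nonneg) (integral_nonneg hh)

/-- The domination principle behind all stability properties of approximate limits. -/
theorem approxLim_of_le {κ : Type*} [Fintype κ] {h : κ → E d → ℝ}
    (hint : ∀ i r, IntegrableOn (h i) (T ∩ Metric.ball x r))
    (hlim : ∀ i, Tendsto (fun r : ℝ => ⨍ y in T ∩ Metric.ball x r, h i y) (𝓝[>] 0) (𝓝 0))
    (hle : ∀ᵐ y ∂(volume.restrict T), ‖f y - a‖ ≤ ∑ i, h i y) : ApproxLim T x f a := by
  have h0 := tendsto_finsetSum Finset.univ (fun i _ => hlim i)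
  rw [Finset.sum_const_zero] at h0
  refine squeeze_zero (fun r => setAverage_nonneg _ fun _ => norm_nonneg _) (fun r => ?_) h0
  simp only [setAverage_eq, smul_eq_mul]
  rw [← Finset.mul_sum, ← integral_finsetSum _ fun i _ => hint i r]
  refine mul_le_mul_of_nonneg_left ?_ (inv_nonneg.2 measureReal_nonneg)
  refine integral_mono_of_nonneg (Eventually.of_forall fun _ => norm_nonneg _)
    (integrable_finsetSum _ fun i _ => hint i r) ?_
  exact ae_restrict_of_ae_restrict_of_subset Set.inter_subset_left hle

theorem ApproxLim.add (hf : IntegrableOn f T) (hf' : IntegrableOn f' T) (h : ApproxLim T x f a)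
    (h' : ApproxLim T x f' a') {s : E d → V} (hs : s =ᵐ[volume.restrict T] fun y => f y + f' y) :
    ApproxLim T x s (a + a') := by
  refine approxLim_of_le (h := ![fun y => ‖f y - a‖, fun y => ‖f' y - a'‖]) (fun i r => ?_) (fun i => ?_) ?_
  · fin_cases i
    · exact integrableOn_sub_const_inter_ball hf a x r
    · exact integrableOn_sub_const_inter_ball hf' a' x r
  · fin_cases i
    · exact h
    · exact h'
  · filter_upwards [hs] with y hy
    rw [hy, Fin.sum_univ_two]
    have : f y + f' y - (a + a') = (f y - a) + (f' y - a') := by abel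
    rw [this]
    exact norm_add_le _ _

theorem ApproxLim.comp_le (hf : IntegrableOn f T) (h : ApproxLim T x f a) {s : E d → V'} {b : V'} {C : ℝ}
    (hs : ∀ᵐ y ∂(volume.restrict T), ‖s y - b‖ ≤ C * ‖f y - a‖) : ApproxLim T x s b := by
  refine approxLim_of_le (κ := Unit) (h := fun _ y => C * ‖f y - a‖) (fun _ r => ?_) (fun _ => ?_) ?_
  · exact (integrableOn_sub_const_inter_ball hf a x r).const_mul C
  · have := Tendsto.const_mul C h
    rw [mul_zero] at this
    refine this.congr fun r => ?_
    simp only [setAverage_eq, smul_eq_mul, integral_const_mul]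
    ring
  · simpa using hs

theorem ApproxLim.congr (hf : IntegrableOn f T) (h : ApproxLim T x f a)
    (hs : f' =ᵐ[volume.restrict T] f) : ApproxLim T x f' a :=
  h.comp_le hf (C := 1) (by filter_upwards [hs] with y hy; rw [hy, one_mul])

theorem ApproxLim.smul [NormedSpace ℝ V] (hf : IntegrableOn f T) (h : ApproxLim T x f a) (c : ℝ) {s : E d → V}
    (hs : s =ᵐ[volume.restrict T] fun y => c • f y) : ApproxLim T x s (c • a) :=
  h.comp_le hf (C := |c|) (by
    filter_upwards [hs] with y hy
    rw [hy, ← smul_sub, norm_smul, Real.norm_eq_abs])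

theorem approxLim_of_continuous (hf : Continuous f) : ApproxLim T x f (f x) := by
  rw [ApproxLim, Metric.tendsto_nhds]
  intro ε hε
  obtain ⟨δ, hδ, hb⟩ := Metric.continuousAt_iff.1 hf.continuousAt (ε / 2) (half_pos hε)
  filter_upwards [Ioo_mem_nhdsGT hδ] with r hr
  rw [Real.dist_eq, sub_zero, abs_of_nonneg (setAverage_nonneg _ fun _ => norm_nonneg _)]
  set S := T ∩ Metric.ball x r with hS
  have hSfin : volume S < ⊤ := (measure_mono Set.inter_subset_right).trans_lt measure_ball_lt_top
  have h1 : ∀ y ∈ S, ‖‖f y - f x‖‖ ≤ ε / 2 := fun y hy => by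
    rw [norm_norm, ← dist_eq_norm]
    exact (hb (lt_trans hy.2 hr.2)).le
  have h2 := norm_setIntegral_le_of_norm_le_const hSfin h1
  rw [setAverage_eq, smul_eq_mul]
  rw [Real.norm_of_nonneg (integral_nonneg fun _ => norm_nonneg _)] at h2
  -- `x` is not assumed to be in the closure of `T`, so the set may be null; its average is then
  -- zero by convention.
  rcases measureReal_nonneg (μ := (volume : Measure (E d))) (s := S) |>.eq_or_lt with h3 | h3
  · rw [← h3]; simpa using hε
  · rw [inv_mul_lt_iff₀ h3]
    nlinarith

theorem approxLim_of_coord {ι : Type*} [Fintype ι] {f : E d → EuclideanSpace ℝ ι} {a : EuclideanSpace ℝ ι}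
    (hf : IntegrableOn f T) (h : ∀ i, ApproxLim T x (fun y => f y i) (a i)) : ApproxLim T x f a := by
  refine approxLim_of_le (h := fun i y => ‖f y i - a i‖) (fun i r => ?_) h (Eventually.of_forall fun y => ?_)
  · exact integrableOn_sub_const_inter_ball (coord_integrable hf i) (a i) x r
  · rw [EuclideanSpace.norm_eq]
    refine (Real.sqrt_le_left (Finset.sum_nonneg fun i _ => norm_nonneg _)).2 ?_
    exact Finset.sum_sq_le_sq_sum_of_nonneg fun i _ => norm_nonneg _

end ApproxLim

/-- Bounded open connected finite unions of sets that are star-shaped with respect to a ball. -/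
structure IsElement {d : ℕ} (T : Set (E d)) : Prop where
  two_le : 2 ≤ d
  isOpen : IsOpen T
  connected : IsConnected T
  bounded : Bornology.IsBounded T
  star : IsStarUnion T

theorem IsElement.isFiniteMeasure {d : ℕ} {T : Set (E d)} (h : IsElement T) :
    IsFiniteMeasure ((volume : Measure (E d)).restrict T) :=
  isFiniteMeasure_restrict_of_isBounded h.bounded

theorem IsRegularFace.isFiniteMeasure {d : ℕ} {T F : Set (E d)} (h : IsRegularFace T F) :
    IsFiniteMeasure (surf F) := ⟨lt_of_le_of_ne le_top h.finite⟩

section Trace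

variable {d : ℕ} {T F : Set (E d)} {V : Type*} [NormedAddCommGroup V]
  [IsFiniteMeasure ((volume : Measure (E d)).restrict T)]

omit [IsFiniteMeasure ((volume : Measure (E d)).restrict T)] in
theorem isTrace_iff {w : L2 V T} {g : L2Face V F} :
    IsTrace T F w g ↔ ∀ᵐ x ∂(surf F), ApproxLim T x w (g x) := Iff.rfl

omit [IsFiniteMeasure ((volume : Measure (E d)).restrict T)] in
theorem IsRegularFace.ae_mem_closure (hF : IsRegularFace T F) : ∀ᵐ x ∂(surf F), x ∈ F ∧ x ∈ closure T := by
  filter_upwards [ae_restrict_mem hF.measurableSet] with x hx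
  exact ⟨hx, frontier_subset_closure (hF.subset hx)⟩

theorem IsTrace.unique (hT : IsOpen T) (hF : IsRegularFace T F) {w : L2 V T} {g g' : L2Face V F}
    (h : IsTrace T F w g) (h' : IsTrace T F w g') : g = g' := by
  refine Lp.ext ?_
  filter_upwards [h, h', hF.ae_mem_closure] with x hx hx' hxT
  exact eq_of_tendsto_average hT (Lp_integrable w) (Lp_integrable w) (ae_eq_refl _) hxT.2 hx hx'

theorem IsTrace.add {w w' : L2 V T} {g g' : L2Face V F}
    (h : IsTrace T F w g) (h' : IsTrace T F w' g') : IsTrace T F (w + w') (g + g') := by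
  rw [isTrace_iff]
  filter_upwards [h, h', Lp.coeFn_add g g'] with x hx hx' hg
  rw [hg]
  exact ApproxLim.add (Lp_integrable w) (Lp_integrable w') hx hx' (Lp.coeFn_add w w')

theorem IsTrace.smul [NormedSpace ℝ V] (c : ℝ) {w : L2 V T} {g : L2Face V F}
    (h : IsTrace T F w g) : IsTrace T F (c • w) (c • g) := by
  rw [isTrace_iff]
  filter_upwards [h, Lp.coeFn_smul c g] with x hx hg
  rw [hg]
  exact ApproxLim.smul (Lp_integrable w) hx c (Lp.coeFn_smul c w)

omit [IsFiniteMeasure ((volume : Measure (E d)).restrict T)] in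
theorem isTrace_trace {w : L2 V T} (h : ∃ g, IsTrace T F w g) : IsTrace T F w (trace T F w) := by
  rw [trace, dif_pos h]; exact h.choose_spec

theorem IsTrace.trace_eq (hT : IsOpen T) (hF : IsRegularFace T F) {w : L2 V T} {g : L2Face V F}
    (h : IsTrace T F w g) : trace T F w = g := (isTrace_trace ⟨g, h⟩).unique hT hF h

/-- `trace` is defined by choice; its linearity rests on uniqueness of approximate limits. -/
theorem linOn_trace_of_exists [NormedSpace ℝ V] (hT : IsOpen T) (hF : IsRegularFace T F)
    {W : Submodule ℝ (L2 V T)} (h : ∀ w ∈ W, ∃ g, IsTrace T F w g) : LinOn W (trace T F) :=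
  ⟨fun _ hx _ hy => ((isTrace_trace (h _ hx)).add (isTrace_trace (h _ hy))).trace_eq hT hF,
    fun c _ hx => ((isTrace_trace (h _ hx)).smul c).trace_eq hT hF⟩

theorem exists_memLp_approxLim (hTe : IsElement T) (hF : IsRegularFace T F) {q : E d → ℝ} {G : E d → E d}
    (hq : IntegrableOn q T) (hqm : Measurable q) (hG : MemLp G 2 (volume.restrict T)) (hGm : Measurable G)
    (h : ∀ φ, IsTest T φ → ∀ j, ∫ x in T, q x * pd j φ x = -∫ x in T, G x j * φ x) :
    ∃ g : E d → ℝ, MemLp g 2 (surf F) ∧ ∀ᵐ x ∂(surf F), ApproxLim T x q (g x) := by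
  have hTm := hTe.isOpen.measurableSet
  have hW := weakGradOn_indicator hTm hq (hG.integrable (by norm_num)) h
  have hG2 : ∫⁻ y, ‖T.indicator G y‖ₑ ^ 2 ≠ ⊤ := by
    have h2 := hG.2
    rw [eLpNorm_lt_top_iff_lintegral_rpow_enorm_lt_top (by norm_num) (by norm_num)] at h2
    have e : ∀ y, ‖T.indicator G y‖ₑ ^ 2 = T.indicator (fun y => ‖G y‖ₑ ^ 2) y := fun y => by
      by_cases hy : y ∈ T <;> simp [hy]
    simp_rw [e]
    rw [lintegral_indicator hTm]
    simpa using h2.ne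
  obtain ⟨g, hg, hlim⟩ := exists_memLp_tendsto_average hTe.two_le hTe.isOpen hTe.bounded hTe.star hF hW
    (hqm.indicator hTm) (hGm.indicator hTm) hG2
  refine ⟨g, hg, ?_⟩
  filter_upwards [hlim] with x hx
  refine ApproxLim.congr hW.int_u.integrableOn hx ?_
  exact (indicator_ae_eq_restrict hTm).symm

theorem exists_isTrace (hTe : IsElement T) (hF : IsRegularFace T F) {q : L2 ℝ T} (hq : q ∈ h1 T) :
    ∃ g, IsTrace T F q g := by
  have hG := isWeakGrad_weakGrad hq
  obtain ⟨g, hg, hlim⟩ := exists_memLp_approxLim hTe hF (Lp_integrable q) (Lp.stronglyMeasurable q).measurable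
    (Lp.memLp (weakGrad T q)) (Lp.stronglyMeasurable _).measurable hG
  refine ⟨hg.toLp g, ?_⟩
  rw [isTrace_iff]
  filter_upwards [hlim, hg.coeFn_toLp] with x hx hgx
  rw [hgx]
  exact hx

theorem memLp_of_coord {α ι : Type*} [Fintype ι] [MeasurableSpace α] {μ : Measure α}
    {f : α → EuclideanSpace ℝ ι} (h : ∀ i, MemLp (fun x => f x i) 2 μ) : MemLp f 2 μ := by
  have : MemLp (fun x => WithLp.ofLp (f x)) 2 μ := MemLp.of_eval (f := fun x => WithLp.ofLp (f x)) h
  exact (PiLp.continuousLinearEquiv 2 ℝ (fun _ : ι => ℝ)).symm.toContinuousLinearMap.comp_memLp' this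

theorem exists_isTrace_vec (hTe : IsElement T) (hF : IsRegularFace T F) {w : L2 (E d) T} (hw : w ∈ h1Vec T) :
    ∃ g, IsTrace T F w g := by
  have hG := isWeakJac_weakJac hw
  have hex : ∀ i : Fin d, ∃ g : E d → ℝ, MemLp g 2 (surf F) ∧
      ∀ᵐ x ∂(surf F), ApproxLim T x (fun y => w y i) (g x) := by
    intro i
    let L : Mat d →L[ℝ] E d := LinearMap.toContinuousLinearMap
      { toFun := fun M => WithLp.toLp 2 fun j => M (i, j)
        map_add' := fun _ _ => rfl
        map_smul' := fun _ _ => rfl }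
    have hLm : MemLp (fun x => L (weakJac T w x)) 2 (volume.restrict T) := L.comp_memLp' (Lp.memLp _)
    refine exists_memLp_approxLim hTe hF (coord_integrable (Lp_integrable w) i) ?_ hLm ?_
      (fun φ hφ j => hG φ hφ i j)
    · exact (EuclideanSpace.proj i : E d →L[ℝ] ℝ).measurable.comp (Lp.stronglyMeasurable w).measurable
    · exact L.measurable.comp (Lp.stronglyMeasurable _).measurable
  choose g hg hlim using hex
  have hgm : MemLp (fun x => (WithLp.toLp 2 fun i => g i x : E d)) 2 (surf F) := memLp_of_coord hg
  refine ⟨hgm.toLp _, ?_⟩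
  rw [isTrace_iff]
  filter_upwards [ae_all_iff.2 hlim, hgm.coeFn_toLp] with x hx hgx
  rw [hgx]
  exact approxLim_of_coord (Lp_integrable w) hx

theorem linOn_trace (hTe : IsElement T) (hF : IsRegularFace T F) : LinOn (h1 T) (trace T F) :=
  linOn_trace_of_exists hTe.isOpen hF fun _ hq => exists_isTrace hTe hF hq

theorem linOn_trace_vec (hTe : IsElement T) (hF : IsRegularFace T F) : LinOn (h1Vec T) (trace T F) :=
  linOn_trace_of_exists hTe.isOpen hF fun _ hq => exists_isTrace_vec hTe hF hq

theorem isTrace_of_continuous {w : L2 V T} {g : L2Face V F} {f : E d → V} (hf : Continuous f)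
    (hw : w =ᵐ[volume.restrict T] f) (hg : g =ᵐ[surf F] f) : IsTrace T F w g := by
  rw [isTrace_iff]
  filter_upwards [hg] with x hx
  rw [hx]
  have hi : IntegrableOn f T := (integrable_congr hw).1 (Lp_integrable w)
  exact (approxLim_of_continuous hf).congr hi hw

/-! ### Normal traces -/

/-- The map `M ↦ M n`. -/
def matVecL (n : E d) : Mat d →L[ℝ] E d := LinearMap.toContinuousLinearMap
  { toFun := fun M => matVec M n
    map_add' := fun M M' => by
      ext i
      simp [matVec, add_mul, Finset.sum_add_distrib]
    map_smul' := fun c M => by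
      ext i
      simp [matVec, mul_assoc, Finset.mul_sum] }

theorem matVecL_apply (n : E d) (M : Mat d) : matVecL n M = matVec M n := rfl

omit [IsFiniteMeasure ((volume : Measure (E d)).restrict T)] in
theorem isNormalTrace_iff {w : L2 (E d) T} {g : L2Face (E d) F} : IsNormalTrace T F w g ↔
    ∀ᵐ x ∂(surf F), ApproxLim T x (fun y => matVec (weakJac T w y) (normal T x)) (g x) := Iff.rfl

theorem integrable_matVec (J : L2 (Mat d) T) (n : E d) :
    IntegrableOn (fun y => matVec (J y) n) T := (matVecL n).integrable_comp (Lp_integrable J)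

theorem IsNormalTrace.unique (hT : IsOpen T) (hF : IsRegularFace T F) {w : L2 (E d) T}
    {g g' : L2Face (E d) F} (h : IsNormalTrace T F w g) (h' : IsNormalTrace T F w g') : g = g' := by
  refine Lp.ext ?_
  filter_upwards [h, h', hF.ae_mem_closure] with x hx hx' hxT
  exact eq_of_tendsto_average hT (integrable_matVec _ _) (integrable_matVec _ _) (ae_eq_refl _) hxT.2 hx hx'

theorem IsNormalTrace.add (hT : IsOpen T) {w w' : L2 (E d) T} {g g' : L2Face (E d) F} (hw : w ∈ h1Vec T)
    (hw' : w' ∈ h1Vec T) (h : IsNormalTrace T F w g) (h' : IsNormalTrace T F w' g') :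
    IsNormalTrace T F (w + w') (g + g') := by
  rw [isNormalTrace_iff, (linOn_weakJac hT).add w hw w' hw']
  filter_upwards [h, h', Lp.coeFn_add g g'] with x hx hx' hg
  rw [hg]
  refine ApproxLim.add (integrable_matVec _ _) (integrable_matVec _ _) hx hx' ?_
  filter_upwards [Lp.coeFn_add (weakJac T w) (weakJac T w')] with y hy
  rw [hy, ← matVecL_apply, Pi.add_apply, map_add]
  rfl

theorem IsNormalTrace.smul (hT : IsOpen T) (c : ℝ) {w : L2 (E d) T} {g : L2Face (E d) F} (hw : w ∈ h1Vec T)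
    (h : IsNormalTrace T F w g) : IsNormalTrace T F (c • w) (c • g) := by
  rw [isNormalTrace_iff, (linOn_weakJac hT).smul c w hw]
  filter_upwards [h, Lp.coeFn_smul c g] with x hx hg
  rw [hg]
  refine ApproxLim.smul (integrable_matVec _ _) hx c ?_
  filter_upwards [Lp.coeFn_smul c (weakJac T w)] with y hy
  rw [hy, ← matVecL_apply, Pi.smul_apply, map_smul]
  rfl

omit [IsFiniteMeasure ((volume : Measure (E d)).restrict T)] in
theorem isNormalTrace_normalTrace {w : L2 (E d) T} (h : ∃ g, IsNormalTrace T F w g) :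
    IsNormalTrace T F w (normalTrace T F w) := by
  rw [normalTrace, dif_pos h]; exact h.choose_spec

theorem IsNormalTrace.normalTrace_eq (hT : IsOpen T) (hF : IsRegularFace T F) {w : L2 (E d) T}
    {g : L2Face (E d) F} (h : IsNormalTrace T F w g) : normalTrace T F w = g :=
  (isNormalTrace_normalTrace ⟨g, h⟩).unique hT hF h

omit [IsFiniteMeasure ((volume : Measure (E d)).restrict T)] in
theorem isNormalTrace_of_weakJac_eq_zero {w : L2 (E d) T} (h : weakJac T w = 0) :
    IsNormalTrace T F w 0 := by
  rw [isNormalTrace_iff, h]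
  filter_upwards [Lp.coeFn_zero (E d) 2 (surf F)] with x hx
  rw [hx]
  refine ApproxLim.congr (f := fun _ => 0) (integrable_zero _ _ _)
    (approxLim_of_continuous (f := fun _ : E d => (0 : E d)) continuous_const) ?_
  filter_upwards [Lp.coeFn_zero (Mat d) 2 ((volume : Measure (E d)).restrict T)] with y hy
  rw [hy, ← matVecL_apply, Pi.zero_apply, map_zero]

theorem weakJac_zero (hT : IsOpen T) : weakJac T (0 : L2 (E d) T) = 0 :=
  isWeakJac_zero.weakJac_eq hT

variable (F) in
/-- Functions in `H¹(T)ᵈ` that have a normal trace in `L²(F)ᵈ`. -/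
def nTraceDomain (hT : IsOpen T) : Submodule ℝ (L2 (E d) T) where
  carrier := {w | w ∈ h1Vec T ∧ ∃ g, IsNormalTrace T F w g}
  add_mem' := fun ⟨hw, g, hg⟩ ⟨hw', g', hg'⟩ => ⟨(h1Vec T).add_mem hw hw', g + g', hg.add hT hw hw' hg'⟩
  zero_mem' := ⟨(h1Vec T).zero_mem, 0, isNormalTrace_of_weakJac_eq_zero (weakJac_zero hT)⟩
  smul_mem' := fun c _ ⟨hw, g, hg⟩ => ⟨(h1Vec T).smul_mem c hw, c • g, hg.smul hT c hw⟩

theorem linOn_normalTrace (hT : IsOpen T) (hF : IsRegularFace T F) :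
    LinOn (nTraceDomain F hT) (normalTrace T F) :=
  ⟨fun _ hx _ hy => ((isNormalTrace_normalTrace hx.2).add hT hx.1 hy.1
      (isNormalTrace_normalTrace hy.2)).normalTrace_eq hT hF,
    fun c _ hx => ((isNormalTrace_normalTrace hx.2).smul hT c hx.1).normalTrace_eq hT hF⟩

end Trace

/-! ### Finite-dimensional spaces of functions given by parameters -/

section Param

variable {α V P : Type*} [MeasurableSpace α] {μ : Measure α} [NormedAddCommGroup V] [NormedSpace ℝ V]
  [AddCommGroup P] [Module ℝ P] {R : P → α → V}

theorem exists_param_of_mem_span (hadd : ∀ A B, R (A + B) =ᵐ[μ] R A + R B)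
    (hsmul : ∀ (c : ℝ) A, R (c • A) =ᵐ[μ] c • R A) {v : Lp V 2 μ}
    (hv : v ∈ Submodule.span ℝ {v : Lp V 2 μ | ∃ A, v =ᵐ[μ] R A}) : ∃ A, v =ᵐ[μ] R A := by
  induction hv using Submodule.span_induction with
  | mem x h => exact h
  | zero =>
    refine ⟨0, ?_⟩
    have := hsmul 0 0
    rw [zero_smul, zero_smul] at this
    exact (Lp.coeFn_zero V 2 μ).trans this.symm
  | add x y _ _ hx hy =>
    obtain ⟨A, hA⟩ := hx
    obtain ⟨B, hB⟩ := hy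
    exact ⟨A + B, (Lp.coeFn_add x y).trans ((hA.add hB).trans (hadd A B).symm)⟩
  | smul c x _ hx =>
    obtain ⟨A, hA⟩ := hx
    exact ⟨c • A, (Lp.coeFn_smul c x).trans ((hA.const_smul c).trans (hsmul c A).symm)⟩

/-- No `R A` is assumed to be square-integrable. Those parameters for which it is form a subspace,
on which `R` induces a linear map into `Lp` whose range contains all generators. -/
theorem finiteDimensional_span_param [FiniteDimensional ℝ P] (hadd : ∀ A B, R (A + B) =ᵐ[μ] R A + R B)
    (hsmul : ∀ (c : ℝ) A, R (c • A) =ᵐ[μ] c • R A) :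
    FiniteDimensional ℝ (Submodule.span ℝ {v : Lp V 2 μ | ∃ A, v =ᵐ[μ] R A}) := by
  let D : Submodule ℝ P :=
    { carrier := {A | MemLp (R A) 2 μ}
      add_mem' := fun {A B} hA hB => (MemLp.add hA hB).ae_eq (hadd A B).symm
      zero_mem' := by
        have := hsmul 0 0
        rw [zero_smul, zero_smul] at this
        exact MemLp.ae_eq this.symm MemLp.zero
      smul_mem' := fun c A hA => (MemLp.const_smul hA c).ae_eq (hsmul c A).symm }
  let L : D →ₗ[ℝ] Lp V 2 μ :=
    { toFun := fun A => MemLp.toLp (R A) A.2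
      map_add' := fun A B => by
        rw [← MemLp.toLp_add]
        exact MemLp.toLp_congr _ _ (hadd _ _)
      map_smul' := fun c A => by
        rw [RingHom.id_apply, ← MemLp.toLp_const_smul]
        exact MemLp.toLp_congr _ _ (hsmul _ _) }
  have hle : Submodule.span ℝ {v : Lp V 2 μ | ∃ A, v =ᵐ[μ] R A} ≤ LinearMap.range L := by
    rw [Submodule.span_le]
    rintro v ⟨A, hA⟩
    have hm : MemLp (R A) 2 μ := (Lp.memLp v).ae_eq hA
    refine ⟨⟨A, hm⟩, Lp.ext ?_⟩
    exact (MemLp.coeFn_toLp hm).trans hA.symm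
  exact Submodule.finiteDimensional_of_le hle

end Param

theorem finiteDimensional_span_iUnion {H ι : Type*} [Finite ι] [AddCommGroup H] [Module ℝ H] {S : ι → Set H}
    (h : ∀ i, FiniteDimensional ℝ (Submodule.span ℝ (S i))) :
    FiniteDimensional ℝ (Submodule.span ℝ (⋃ i, S i)) := by
  rw [Submodule.span_iUnion]
  infer_instance

theorem finiteDimensional_span_image {H H' : Type*} [AddCommGroup H] [Module ℝ H] [AddCommGroup H']
    [Module ℝ H'] {W : Submodule ℝ H} [FiniteDimensional ℝ W] {f : H → H'} (hf : LinOn W f) :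
    FiniteDimensional ℝ (Submodule.span ℝ (f '' W)) := by
  have hle : Submodule.span ℝ (f '' W) ≤ LinearMap.range hf.toLin := by
    rw [Submodule.span_le]
    rintro _ ⟨w, hw, rfl⟩
    exact ⟨⟨w, hw⟩, rfl⟩
  exact Submodule.finiteDimensional_of_le hle

/-! ### Polynomial functions -/

section Polynomials

open MvPolynomial

variable {d : ℕ} {T F : Set (E d)} {l : ℕ}

theorem contDiff_pev (p : MvPolynomial (Fin d) ℝ) : ContDiff ℝ ∞ (pev p : E d → ℝ) := by
  induction p using MvPolynomial.induction_on with
  | C a =>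
    have : (pev (C a) : E d → ℝ) = fun _ => a := by ext x; simp [pev]
    rw [this]; exact contDiff_const
  | add p q hp hq =>
    have : (pev (p + q) : E d → ℝ) = fun x => pev p x + pev q x := by ext x; simp [pev]
    rw [this]; exact hp.add hq
  | mul_X p i hp =>
    have : (pev (p * X i) : E d → ℝ) = fun x => pev p x * x i := by ext x; simp [pev]
    rw [this]; exact hp.mul (EuclideanSpace.proj i : E d →L[ℝ] ℝ).contDiff

theorem continuous_pev (p : MvPolynomial (Fin d) ℝ) : Continuous (pev p : E d → ℝ) :=
  (contDiff_pev p).continuous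

theorem differentiable_pev (p : MvPolynomial (Fin d) ℝ) : Differentiable ℝ (pev p : E d → ℝ) :=
  (contDiff_pev p).differentiable (by simp)

theorem pd_pev (j : Fin d) (p : MvPolynomial (Fin d) ℝ) (x : E d) : pd j (pev p) x = pev (pderiv j p) x := by
  induction p using MvPolynomial.induction_on with
  | C a =>
    have : (pev (C a) : E d → ℝ) = fun _ => a := by ext x; simp [pev]
    rw [pd, this]; simp [pev]
  | add p q hp hq =>
    have : (pev (p + q) : E d → ℝ) = pev p + pev q := by ext x; simp [pev]
    rw [pd, this, fderiv_add (differentiable_pev p x) (differentiable_pev q x)]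
    simp only [pd] at hp hq
    rw [add_apply, hp, hq]
    simp [pev]
  | mul_X p i hp =>
    have : (pev (p * X i) : E d → ℝ) = pev p * (EuclideanSpace.proj i : E d →L[ℝ] ℝ) := by
      ext x; simp [pev]
    rw [pd, this, fderiv_mul (differentiable_pev p x) (ContinuousLinearMap.differentiableAt _)]
    simp only [pd] at hp
    simp only [ContinuousLinearMap.fderiv, add_apply, smul_apply, hp,
      smul_eq_mul, pderiv_mul, pev, map_add, map_mul, eval_X, pderiv_X]
    by_cases h : i = j
    · subst h; simp; ring
    · simp [h]; ring

theorem totalDegree_pderiv_le (j : Fin d) {p : MvPolynomial (Fin d) ℝ} (hp : p.totalDegree ≤ l) :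
    (pderiv j p).totalDegree ≤ l := by
  refine Finset.sup_le fun m hm => ?_
  rw [mem_support_iff, coeff_pderiv] at hm
  have h2 := (le_totalDegree (mem_support_iff.2 (left_ne_zero_of_mul hm))).trans hp
  refine le_trans ?_ h2
  rw [Finsupp.sum_add_index' (by simp) (by simp)]
  exact Nat.le_add_right _ _

theorem memLp_of_continuous {V : Type*} [NormedAddCommGroup V] [SecondCountableTopology V] {μ : Measure (E d)} [IsFiniteMeasure μ]
    {B : Set (E d)} (hB : Bornology.IsBounded B) (hμ : ∀ᵐ x ∂μ, x ∈ B) {f : E d → V} (hf : Continuous f) :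
    MemLp f 2 μ := by
  obtain ⟨C, hC⟩ := (hB.isCompact_closure.image hf).isBounded.exists_norm_le
  refine MemLp.of_bound hf.aestronglyMeasurable C ?_
  filter_upwards [hμ] with x hx
  exact hC _ ⟨x, subset_closure hx, rfl⟩

theorem IsTest.integral_mul_pd {φ f : E d → ℝ} (hφ : IsTest T φ) (hf : ContDiff ℝ ∞ f) (j : Fin d) :
    ∫ x in T, f x * pd j φ x = -∫ x in T, pd j f x * φ x := by
  have hφ0 : ∀ x ∉ T, φ x = 0 := fun x hx => image_eq_zero_of_notMem_tsupport fun h => hx (hφ.2.2 h)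
  have hφ1 : ∀ x ∉ T, pd j φ x = 0 := fun x hx => by
    have h1 : x ∉ tsupport (fderiv ℝ φ) := fun h => hx (hφ.2.2 (tsupport_fderiv_subset ℝ h))
    rw [pd, image_eq_zero_of_notMem_tsupport h1]
    rfl
  rw [setIntegral_eq_integral_of_forall_compl_eq_zero fun x hx => by rw [hφ1 x hx, mul_zero],
    setIntegral_eq_integral_of_forall_compl_eq_zero fun x hx => by rw [hφ0 x hx, mul_zero]]
  have hfd : Continuous (pd j f) := (hf.continuous_fderiv (by simp)).clm_apply continuous_const
  refine integral_mul_fderiv_eq_neg_fderiv_mul_of_integrable ?_ ?_ ?_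
    (fun x _ => hf.differentiable (by simp) x) (fun x _ => hφ.1.differentiable (by simp) x)
  · exact (hfd.mul hφ.1.continuous).integrable_of_hasCompactSupport hφ.2.1.mul_left
  · exact (hf.continuous.mul (hφ.continuous_pd j)).integrable_of_hasCompactSupport
      (hφ.2.1.fderiv_apply (𝕜 := ℝ) _).mul_left
  · exact (hf.continuous.mul hφ.1.continuous).integrable_of_hasCompactSupport hφ.2.1.mul_left

theorem pev_add (p q : MvPolynomial (Fin d) ℝ) (x : E d) : pev (p + q) x = pev p x + pev q x := by simp [pev]

theorem pev_smul (c : ℝ) (p : MvPolynomial (Fin d) ℝ) (x : E d) : pev (c • p) x = c * pev p x := by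
  simp [pev, smul_eval]

/-! ### The polynomial spaces -/

theorem polyT_eq_span : polyT l T = Submodule.span ℝ {v : L2 ℝ T | ∃ p : restrictTotalDegree (Fin d) ℝ l,
    v =ᵐ[volume.restrict T] pev (p : MvPolynomial (Fin d) ℝ)} := by
  rw [polyT]
  congr 1
  ext v
  simp [mem_restrictTotalDegree]

theorem exists_of_mem_polyT {q : L2 ℝ T} (hq : q ∈ polyT l T) : ∃ p : MvPolynomial (Fin d) ℝ,
    p.totalDegree ≤ l ∧ q =ᵐ[volume.restrict T] pev p := by
  rw [polyT_eq_span] at hq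
  obtain ⟨p, hp⟩ := exists_param_of_mem_span (P := restrictTotalDegree (Fin d) ℝ l)
    (fun A B => Eventually.of_forall fun x => pev_add _ _ x)
    (fun c A => Eventually.of_forall fun x => pev_smul _ _ x) hq
  exact ⟨p, (mem_restrictTotalDegree _ _ _).1 p.2, hp⟩

instance finiteDimensional_polyT : FiniteDimensional ℝ (polyT l T) := by
  rw [polyT_eq_span]
  exact finiteDimensional_span_param (fun A B => Eventually.of_forall fun x => pev_add _ _ x)
    (fun c A => Eventually.of_forall fun x => pev_smul _ _ x)

/-- The polynomial map with given components. -/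
def pevVec {ι : Type*} (p : ι → MvPolynomial (Fin d) ℝ) (x : E d) : EuclideanSpace ℝ ι :=
  WithLp.toLp 2 fun i => pev (p i) x

theorem pevVec_add {ι : Type*} (p q : ι → MvPolynomial (Fin d) ℝ) (x : E d) :
    pevVec (p + q) x = pevVec p x + pevVec q x := by
  ext i; simp [pevVec, pev]

theorem pevVec_smul {ι : Type*} (c : ℝ) (p : ι → MvPolynomial (Fin d) ℝ) (x : E d) :
    pevVec (c • p) x = c • pevVec p x := by
  ext i; simp [pevVec, pev, smul_eval]

theorem continuous_pevVec {ι : Type*} [Fintype ι] (p : ι → MvPolynomial (Fin d) ℝ) :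
    Continuous (pevVec p) := by
  exact (PiLp.continuous_toLp 2 _).comp (continuous_pi fun i => continuous_pev (p i))

theorem polyVecT_eq_span : polyVecT l T = Submodule.span ℝ
    {v : L2 (E d) T | ∃ p : Fin d → restrictTotalDegree (Fin d) ℝ l,
      v =ᵐ[volume.restrict T] pevVec fun i => (p i : MvPolynomial (Fin d) ℝ)} := by
  rw [polyVecT]
  congr 1
  ext v
  constructor
  · rintro ⟨p, hp, hv⟩
    exact ⟨fun i => ⟨p i, (mem_restrictTotalDegree _ _ _).2 (hp i)⟩, hv⟩
  · rintro ⟨p, hv⟩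
    exact ⟨fun i => p i, fun i => (mem_restrictTotalDegree _ _ _).1 (p i).2, hv⟩

theorem exists_of_mem_polyVecT {w : L2 (E d) T} (hw : w ∈ polyVecT l T) :
    ∃ p : Fin d → MvPolynomial (Fin d) ℝ, (∀ i, (p i).totalDegree ≤ l) ∧
      w =ᵐ[volume.restrict T] pevVec p := by
  rw [polyVecT_eq_span] at hw
  obtain ⟨p, hp⟩ := exists_param_of_mem_span (fun A B => Eventually.of_forall fun x => pevVec_add _ _ x)
    (fun c A => Eventually.of_forall fun x => pevVec_smul _ _ x) hw
  exact ⟨fun i => p i, fun i => (mem_restrictTotalDegree _ _ _).1 (p i).2, hp⟩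

instance finiteDimensional_polyVecT : FiniteDimensional ℝ (polyVecT l T) := by
  rw [polyVecT_eq_span]
  exact finiteDimensional_span_param (fun A B => Eventually.of_forall fun x => pevVec_add _ _ x)
    (fun c A => Eventually.of_forall fun x => pevVec_smul _ _ x)

theorem mem_polyVecT {p : Fin d → MvPolynomial (Fin d) ℝ} (hp : ∀ i, (p i).totalDegree ≤ l) {w : L2 (E d) T}
    (hw : w =ᵐ[volume.restrict T] pevVec p) : w ∈ polyVecT l T :=
  Submodule.subset_span ⟨p, hp, hw⟩

theorem const_mem_polyVecT {c : E d} {w : L2 (E d) T} (hw : w =ᵐ[volume.restrict T] fun _ => c) :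
    w ∈ polyVecT l T := by
  refine mem_polyVecT (p := fun i => C (c i)) (fun i => by simp) (hw.trans (Eventually.of_forall fun x => ?_))
  ext i
  simp [pevVec, pev]

/-! ### Functions on regular faces -/

theorem IsRegularFace.isBounded (hTb : Bornology.IsBounded T) (hF : IsRegularFace T F) : Bornology.IsBounded F :=
  hTb.closure.subset (hF.subset.trans frontier_subset_closure)

/-- The normal is chosen pointwise; its measurability comes from its continuity along the face. -/
theorem IsRegularFace.aestronglyMeasurable_normal (hT : IsOpen T) (hF : IsRegularFace T F) :
    AEStronglyMeasurable (EnrichedHHO.normal T) (surf F) :=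
  (continuousOn_normal hT hF.normal).aestronglyMeasurable hF.measurableSet

theorem IsRegularFace.ae_norm_normal (hF : IsRegularFace T F) : ∀ᵐ x ∂(surf F), ‖EnrichedHHO.normal T x‖ = 1 := by
  filter_upwards [ae_restrict_mem hF.measurableSet] with x hx
  exact (isOutwardNormal_normal (hF.normal x hx)).1

theorem IsRegularFace.memLp_smul_normal (hT : IsOpen T) (hF : IsRegularFace T F) {g : E d → ℝ}
    (hg : MemLp g 2 (surf F)) : MemLp (fun x => g x • EnrichedHHO.normal T x) 2 (surf F) := by
  refine hg.mono (hg.1.smul (hF.aestronglyMeasurable_normal hT)) ?_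
  filter_upwards [hF.ae_norm_normal] with x hx
  rw [norm_smul, hx, mul_one]

theorem norm_matVec_le (M : Mat d) (n : E d) : ‖matVec M n‖ ≤ ‖M‖ * ‖n‖ := by
  have hp : 0 ≤ ‖M‖ * ‖n‖ := by positivity
  rw [EuclideanSpace.norm_eq, ← Real.sqrt_sq hp]
  refine Real.sqrt_le_sqrt ?_
  rw [mul_pow, EuclideanSpace.norm_sq_eq, EuclideanSpace.norm_sq_eq, Fintype.sum_prod_type, Finset.sum_mul]
  refine Finset.sum_le_sum fun i _ => ?_
  simp only [matVec, Real.norm_eq_abs, sq_abs]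
  exact Finset.sum_mul_sq_le_sq_mul_sq _ _ _

theorem continuous_matVec : Continuous fun a : Mat d × E d => matVec a.1 a.2 := by
  refine (PiLp.continuous_toLp 2 _).comp (continuous_pi fun i => ?_)
  fun_prop

theorem IsRegularFace.memLp_matVec_normal (hT : IsOpen T) (hF : IsRegularFace T F) {g : E d → Mat d}
    (hg : MemLp g 2 (surf F)) : MemLp (fun x => matVec (g x) (EnrichedHHO.normal T x)) 2 (surf F) := by
  refine hg.mono (continuous_matVec.comp_aestronglyMeasurable
    (hg.1.prodMk (hF.aestronglyMeasurable_normal hT))) ?_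
  filter_upwards [hF.ae_norm_normal] with x hx
  refine (norm_matVec_le _ _).trans ?_
  rw [hx, mul_one]

theorem IsRegularFace.memLp_continuous {V : Type*} [NormedAddCommGroup V] [SecondCountableTopology V]
    (hTb : Bornology.IsBounded T)
    (hF : IsRegularFace T F) {f : E d → V} (hf : Continuous f) : MemLp f 2 (surf F) :=
  haveI := hF.isFiniteMeasure
  memLp_of_continuous (hF.isBounded hTb) (ae_restrict_mem hF.measurableSet) hf

section Bounded

variable [IsFiniteMeasure ((volume : Measure (E d)).restrict T)]

theorem memLp_pevVec {ι : Type*} [Fintype ι] (hT : IsOpen T) (hTb : Bornology.IsBounded T)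
    (p : ι → MvPolynomial (Fin d) ℝ) : MemLp (pevVec p) 2 (volume.restrict T) :=
  memLp_of_continuous hTb (ae_restrict_mem hT.measurableSet) (continuous_pevVec p)

theorem isWeakGrad_of_polynomial (hT : IsOpen T) (hTb : Bornology.IsBounded T) {q : L2 ℝ T}
    {p : MvPolynomial (Fin d) ℝ} (hq : q =ᵐ[volume.restrict T] pev p) :
    IsWeakGrad T q ((memLp_pevVec hT hTb fun j => pderiv j p).toLp _) := by
  intro φ hφ j
  have e : ∫ x in T, q x * pd j φ x = ∫ x in T, pev p x * pd j φ x :=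
    integral_congr_ae (hq.mul (ae_eq_refl (pd j φ)))
  rw [e, hφ.integral_mul_pd (contDiff_pev p) j]
  congr 1
  refine integral_congr_ae ?_
  filter_upwards [(memLp_pevVec hT hTb fun j => pderiv j p).coeFn_toLp] with x hx
  rw [hx, pd_pev]
  rfl

theorem polyT_le_h1 (hT : IsOpen T) (hTb : Bornology.IsBounded T) : polyT l T ≤ h1 T := by
  intro q hq
  obtain ⟨p, -, hp⟩ := exists_of_mem_polyT hq
  exact ⟨_, isWeakGrad_of_polynomial hT hTb hp⟩

theorem weakGrad_mem_polyVecT (hT : IsOpen T) (hTb : Bornology.IsBounded T) {q : L2 ℝ T}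
    (hq : q ∈ polyT l T) : weakGrad T q ∈ polyVecT l T := by
  obtain ⟨p, hpl, hp⟩ := exists_of_mem_polyT hq
  rw [(isWeakGrad_of_polynomial hT hTb hp).weakGrad_eq hT]
  exact mem_polyVecT (fun j => totalDegree_pderiv_le j hpl) (MemLp.coeFn_toLp _)

theorem isWeakJac_of_polynomial (hT : IsOpen T) (hTb : Bornology.IsBounded T) {w : L2 (E d) T}
    {p : Fin d → MvPolynomial (Fin d) ℝ} (hw : w =ᵐ[volume.restrict T] pevVec p) :
    IsWeakJac T w ((memLp_pevVec hT hTb fun a : Fin d × Fin d => pderiv a.2 (p a.1)).toLp _) := by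
  intro φ hφ i j
  have hwi : (fun x => w x i) =ᵐ[volume.restrict T] pev (p i) := by
    filter_upwards [hw] with x hx
    rw [hx]; rfl
  have e : ∫ x in T, w x i * pd j φ x = ∫ x in T, pev (p i) x * pd j φ x :=
    integral_congr_ae (hwi.mul (ae_eq_refl (pd j φ)))
  rw [e, hφ.integral_mul_pd (contDiff_pev (p i)) j]
  congr 1
  refine integral_congr_ae ?_
  filter_upwards [(memLp_pevVec hT hTb fun a : Fin d × Fin d => pderiv a.2 (p a.1)).coeFn_toLp] with x hx
  rw [hx, pd_pev]
  rfl

theorem isWeakLap_of_polynomial (hT : IsOpen T) (hTb : Bornology.IsBounded T) {w : L2 (E d) T}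
    {p : Fin d → MvPolynomial (Fin d) ℝ} (hw : w =ᵐ[volume.restrict T] pevVec p) :
    IsWeakLap T w ((memLp_pevVec hT hTb fun i => ∑ j, pderiv j (pderiv j (p i))).toLp _) := by
  refine ⟨_, isWeakJac_of_polynomial hT hTb hw, fun φ hφ i => ?_⟩
  have h1 : ∀ j, ∫ x in T, ((memLp_pevVec hT hTb fun a : Fin d × Fin d =>
      pderiv a.2 (p a.1)).toLp _ : E d → Mat d) x (i, j) * pd j φ x =
      -∫ x in T, pev (pderiv j (pderiv j (p i))) x * φ x := by
    intro j
    have : ∫ x in T, ((memLp_pevVec hT hTb fun a : Fin d × Fin d =>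
        pderiv a.2 (p a.1)).toLp _ : E d → Mat d) x (i, j) * pd j φ x =
        ∫ x in T, pev (pderiv j (p i)) x * pd j φ x := by
      refine integral_congr_ae ?_
      filter_upwards [(memLp_pevVec hT hTb fun a : Fin d × Fin d => pderiv a.2 (p a.1)).coeFn_toLp] with x hx
      rw [hx]
      rfl
    rw [this, hφ.integral_mul_pd (contDiff_pev _) j]
    simp_rw [pd_pev]
  simp_rw [h1]
  rw [Finset.sum_neg_distrib, ← integral_finsetSum]
  · congr 1
    refine integral_congr_ae ?_
    filter_upwards [(memLp_pevVec hT hTb fun i => ∑ j, pderiv j (pderiv j (p i))).coeFn_toLp] with x hx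
    rw [hx, ← Finset.sum_mul]
    simp [pevVec, pev, map_sum]
  · intro j _
    exact hφ.integrable_mul ((memLp_of_continuous hTb (ae_restrict_mem hT.measurableSet)
      (continuous_pev _)).integrable (by norm_num))

theorem polyVecT_le_lapDomain (hT : IsOpen T) (hTb : Bornology.IsBounded T) :
    polyVecT l T ≤ lapDomain T := by
  intro w hw
  obtain ⟨p, -, hp⟩ := exists_of_mem_polyVecT hw
  exact ⟨_, isWeakLap_of_polynomial hT hTb hp⟩

/-! ### Traces of polynomials -/

theorem polyVecT_le_nTraceDomain (hT : IsOpen T) (hTb : Bornology.IsBounded T) (hF : IsRegularFace T F) :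
    polyVecT l T ≤ nTraceDomain F hT := by
  intro w hw
  refine ⟨lapDomain_le T (polyVecT_le_lapDomain hT hTb hw), ?_⟩
  obtain ⟨p, -, hp⟩ := exists_of_mem_polyVecT hw
  have hJ := isWeakJac_of_polynomial hT hTb hp
  set P : Fin d × Fin d → MvPolynomial (Fin d) ℝ := fun a => pderiv a.2 (p a.1)
  have hm := hF.memLp_matVec_normal hT (hF.memLp_continuous hTb (continuous_pevVec P))
  refine ⟨hm.toLp _, ?_⟩
  rw [isNormalTrace_iff, hJ.weakJac_eq hT]
  filter_upwards [hm.coeFn_toLp] with x hx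
  rw [hx]
  have hc : Continuous fun y => matVec (pevVec P y) (EnrichedHHO.normal T x) :=
    (matVecL (EnrichedHHO.normal T x)).continuous.comp (continuous_pevVec P)
  refine (approxLim_of_continuous hc (x := x)).congr ?_ ?_
  · exact (memLp_of_continuous hTb (ae_restrict_mem hT.measurableSet) hc).integrable (by norm_num)
  · filter_upwards [(memLp_pevVec hT hTb P).coeFn_toLp] with y hy
    rw [hy]

theorem trace_ae_eq_of_polynomial (hT : IsOpen T) (hTb : Bornology.IsBounded T) (hF : IsRegularFace T F)
    {q : L2 ℝ T} {p : MvPolynomial (Fin d) ℝ} (hq : q =ᵐ[volume.restrict T] pev p) :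
    trace T F q =ᵐ[surf F] pev p := by
  have hm := hF.memLp_continuous hTb (continuous_pev p)
  rw [(isTrace_of_continuous (continuous_pev p) hq hm.coeFn_toLp).trace_eq hT hF]
  exact hm.coeFn_toLp

theorem trace_ae_eq_of_const {V : Type*} [NormedAddCommGroup V] [SecondCountableTopology V]
    (hT : IsOpen T) (hTb : Bornology.IsBounded T) (hF : IsRegularFace T F)
    {q : L2 V T} {c : V} (hq : q =ᵐ[volume.restrict T] fun _ => c) :
    trace T F q =ᵐ[surf F] fun _ => c := by
  have hm := hF.memLp_continuous hTb (continuous_const (y := c))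
  rw [(isTrace_of_continuous continuous_const hq hm.coeFn_toLp).trace_eq hT hF]
  exact hm.coeFn_toLp

end Bounded

end Polynomials

/-! ### Negligible sets do not separate -/

section Separation

variable {d : ℕ}

theorem projection_null {n : E d} {L : E d →L[ℝ] E (d - 1)}
    (hL : ∀ v, ‖L v‖ ^ 2 + inner ℝ n v ^ 2 = ‖v‖ ^ 2) {N : Set (E d)} (hN : surf N Set.univ = 0) :
    volume (L '' N) = 0 := by
  have hLip : LipschitzWith 1 L := by
    refine LipschitzWith.of_dist_le_mul fun a b => ?_
    rw [dist_eq_norm, dist_eq_norm, ← map_sub, NNReal.coe_one, one_mul]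
    refine le_of_sq_le_sq ?_ (norm_nonneg _)
    nlinarith [hL (a - b), sq_nonneg (inner ℝ n (a - b))]
  rw [surf_apply _ _ MeasurableSet.univ, Set.univ_inter] at hN
  rw [← EuclideanSpace.euclideanHausdorffMeasure_eq_volume]
  have := hLip.hausdorffMeasure_image_le (d := ((d - 1 : ℕ) : ℝ)) (by positivity) N
  simp only [Measure.euclideanHausdorffMeasure_def, Measure.smul_apply, ENNReal.smul_def, smul_eq_mul] at hN ⊢
  refine le_antisymm (le_trans ?_ hN.le) bot_le
  gcongr
  simpa using this

/-- Project along `b - a`: each parallel segment becomes a point, while `N` becomes a null set in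
dimension `d - 1`. Some point arbitrarily close to the image of `a` avoids it. -/
theorem exists_parallel_segment (hd : 1 ≤ d) {N : Set (E d)} (hN : surf N Set.univ = 0) {a b : E d}
    (hab : a ≠ b) {δ : ℝ} (hδ : 0 < δ) : ∃ v : E d, ‖v‖ < δ ∧ Disjoint (segment ℝ (a + v) (b + v)) N := by
  set n : E d := ‖b - a‖⁻¹ • (b - a) with hn
  have hba : ‖b - a‖ ≠ 0 := norm_ne_zero_iff.2 (sub_ne_zero.2 hab.symm)
  have hn1 : ‖n‖ = 1 := by rw [hn, norm_smul, norm_inv, norm_norm, inv_mul_cancel₀ hba]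
  obtain ⟨L, hL, hLs⟩ := exists_projection_along hd hn1
  have hLn : L n = 0 := by
    have := hL n
    rw [real_inner_self_eq_norm_sq, hn1] at this
    rw [← norm_eq_zero]
    nlinarith [norm_nonneg (L n)]
  have hLab : L (b - a) = 0 := by
    have : b - a = ‖b - a‖ • n := by rw [hn, smul_smul, mul_inv_cancel₀ hba, one_smul]
    rw [this, map_smul, hLn, smul_zero]
  have h0 := projection_null hL hN
  have hpos : 0 < volume (Metric.ball (L a) δ) := Metric.measure_ball_pos _ _ hδ
  obtain ⟨w, hw, hwN⟩ : ∃ w ∈ Metric.ball (L a) δ, w ∉ L '' N := by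
    by_contra! hcon
    exact absurd (measure_mono_null hcon h0) hpos.ne'
  obtain ⟨v, hv, hLv⟩ := hLs (w - L a)
  refine ⟨v, ?_, ?_⟩
  · rw [Metric.mem_ball, dist_eq_norm, ← hLv] at hw
    have h1 := hL v
    rw [hv] at h1
    have : ‖L v‖ = ‖v‖ := (sq_eq_sq₀ (norm_nonneg _) (norm_nonneg _)).1 (by linarith)
    linarith
  · rw [Set.disjoint_left]
    intro y hy hyN
    apply hwN
    refine ⟨y, hyN, ?_⟩
    rw [segment_eq_image'] at hy
    obtain ⟨t, -, rfl⟩ := hy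
    simp only [add_sub_add_right_eq_sub]
    rw [map_add, map_add, map_smul, hLab, smul_zero, hLv]
    abel

/-- `N` has empty interior, so the closures of `U` and `V` cover `O` and, by connectedness, meet at
some `x ∈ O`. In a ball around `x`, join a point of `U` to one of `V` by a segment shifted off `N`;
it would be connected and covered by two disjoint open sets. -/
theorem not_separated_of_null (hd : 1 ≤ d) {O N U V : Set (E d)} (hO : IsOpen O) (hOc : IsPreconnected O)
    (hN : surf N Set.univ = 0) (hU : IsOpen U) (hV : IsOpen V) (hUV : Disjoint U V)
    (hcov : O \ N ⊆ U ∪ V) (hOU : (O ∩ U).Nonempty) (hOV : (O ∩ V).Nonempty) : False := by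
  have hNv : volume N = 0 := volume_eq_zero_of_surf_ne_top hd (by rw [hN]; simp)
  have hcl : O ⊆ closure U ∪ closure V := by
    intro x hx
    rw [← closure_union]
    by_contra hxc
    have hopen : IsOpen (O ∩ (closure (U ∪ V))ᶜ) := hO.inter isClosed_closure.isOpen_compl
    have hsub : O ∩ (closure (U ∪ V))ᶜ ⊆ N := fun y hy => by
      by_contra hyN
      exact hy.2 (subset_closure (hcov ⟨hy.1, hyN⟩))
    exact absurd (measure_mono_null hsub hNv) (hopen.measure_pos volume ⟨x, hx, hxc⟩).ne'
  obtain ⟨x, hxO, hxU, hxV⟩ := isPreconnected_closed_iff.1 hOc _ _ isClosed_closure isClosed_closure hcl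
    (hOU.mono (Set.inter_subset_inter_right _ subset_closure))
    (hOV.mono (Set.inter_subset_inter_right _ subset_closure))
  obtain ⟨r, hr, hball⟩ := Metric.isOpen_iff.1 hO x hxO
  obtain ⟨a, haB, haU⟩ := mem_closure_iff_nhds.1 hxU _ (Metric.ball_mem_nhds x hr)
  obtain ⟨b, hbB, hbV⟩ := mem_closure_iff_nhds.1 hxV _ (Metric.ball_mem_nhds x hr)
  have hab : a ≠ b := fun h => Set.disjoint_left.1 hUV haU (h ▸ hbV)
  obtain ⟨δ1, hδ1, hb1⟩ := Metric.isOpen_iff.1 (Metric.isOpen_ball.inter hU) a ⟨haB, haU⟩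
  obtain ⟨δ2, hδ2, hb2⟩ := Metric.isOpen_iff.1 (Metric.isOpen_ball.inter hV) b ⟨hbB, hbV⟩
  obtain ⟨v, hv, hseg⟩ := exists_parallel_segment hd hN hab (lt_min hδ1 hδ2)
  have ha' := hb1 (show a + v ∈ Metric.ball a δ1 by
    rw [Metric.mem_ball, dist_eq_norm, add_sub_cancel_left]; exact hv.trans_le (min_le_left _ _))
  have hb' := hb2 (show b + v ∈ Metric.ball b δ2 by
    rw [Metric.mem_ball, dist_eq_norm, add_sub_cancel_left]; exact hv.trans_le (min_le_right _ _))
  have hsegB : segment ℝ (a + v) (b + v) ⊆ Metric.ball x r := (convex_ball x r).segment_subset ha'.1 hb'.1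
  have hsub : segment ℝ (a + v) (b + v) ⊆ U ∪ V := fun y hy =>
    hcov ⟨hball (hsegB hy), Set.disjoint_left.1 hseg hy⟩
  obtain ⟨y, -, hyU, hyV⟩ := (convex_segment (a + v) (b + v)).isPreconnected U V hU hV hsub
    ⟨_, left_mem_segment ℝ _ _, ha'.2⟩ ⟨_, right_mem_segment ℝ _ _, hb'.2⟩
  exact Set.disjoint_left.1 hUV hyU hyV

end Separation

/-! ### Interfaces -/

section Interface

variable {d : ℕ} {T T' F : Set (E d)} {x : E d}

/-- Otherwise `e = n + n'` is nonzero and has the positive product `‖e‖² / 2` with both normals, so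
`x - t • e` enters both sets for small `t > 0`. -/
theorem IsOutwardNormal.eq_neg_of_disjoint (hTT' : Disjoint T T') {n n' : E d} (h : IsOutwardNormal T x n)
    (h' : IsOutwardNormal T' x n') : n' = -n := by
  have hsq : ‖n + n'‖ ^ 2 = 2 * (1 + inner ℝ n n') := by
    rw [norm_add_sq_real, h.1, h'.1]; ring
  by_contra hne
  have hpos : 0 < ‖n + n'‖ := norm_pos_iff.2 fun h0 => hne (eq_neg_of_add_eq_zero_right h0)
  set e := n + n' with he
  have h1 : inner ℝ n e = ‖e‖ ^ 2 / 2 := by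
    rw [hsq, he, inner_add_right, real_inner_self_eq_norm_sq, h.1]; ring
  have h2 : inner ℝ n' e = ‖e‖ ^ 2 / 2 := by
    rw [hsq, he, inner_add_right, real_inner_self_eq_norm_sq, h'.1, real_inner_comm]; ring
  have key : ∀ {S : Set (E d)} {m : E d}, IsOutwardNormal S x m → inner ℝ m e = ‖e‖ ^ 2 / 2 →
      ∀ᶠ t : ℝ in 𝓝[>] 0, x - t • e ∈ S := by
    intro S m hm hme
    obtain ⟨ρ, r, hs⟩ := hm.exists_isSide (ε := ‖e‖ / 4) (by positivity)
    have ht : Tendsto (fun t : ℝ => x - t • e) (𝓝[>] 0) (𝓝 x) := by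
      have : Tendsto (fun t : ℝ => x - t • e) (𝓝 0) (𝓝 (x - (0:ℝ) • e)) :=
        (continuous_const.sub (continuous_id.smul continuous_const)).tendsto 0
      rw [zero_smul, sub_zero] at this
      exact this.mono_left nhdsWithin_le_nhds
    filter_upwards [ht.eventually (Metric.ball_mem_nhds x hs.pos), self_mem_nhdsWithin] with t htb ht0
    have ht0 : 0 < t := ht0
    rw [hs.mem_iff _ htb]
    have h3 := (abs_le.1 (hs.est _ htb x (Metric.mem_ball_self hs.pos))).2
    have h4 : x - t • e - x = -(t • e) := by abel
    rw [h4, hs.zero, inner_neg_right, real_inner_smul_right, hme, norm_neg, norm_smul,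
      Real.norm_of_nonneg ht0.le] at h3
    have : 0 < t * ‖e‖ ^ 2 := by positivity
    nlinarith
  obtain ⟨t, ht, ht'⟩ := ((key h h1).and (key h' h2)).exists
  exact Set.disjoint_left.1 hTT' ht ht'

/-- Let `y` near `x` be outside all three sets, so `ρ y > 0`. Moving along `-n` one reaches `ρ = 0`,
at a point of `F`, where `ρ' = 0` too. But `ρ'` increases along `-n`, the outward normal of `T'`, so
`ρ' y < 0` and `y ∈ T'`, a contradiction. -/
theorem IsRegularFace.eventually_mem_union (hT : IsOpen T) (hT' : IsOpen T') (hTT' : Disjoint T T')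
    (hF : IsRegularFace T F) (hF' : IsRegularFace T' F) (hx : x ∈ F) :
    ∀ᶠ y in 𝓝 x, y ∈ T ∪ T' ∪ F := by
  obtain ⟨ρ, r, hs, hsF⟩ := hF.exists_isSide hx
  obtain ⟨ρ', r', hs', -⟩ := hF'.exists_isSide hx
  have hn : EnrichedHHO.normal T' x = -EnrichedHHO.normal T x :=
    (isOutwardNormal_normal (hF.normal x hx)).eq_neg_of_disjoint hTT'
      (isOutwardNormal_normal (hF'.normal x hx))
  rw [hn] at hs'
  set n := EnrichedHHO.normal T x
  set s := min r r' / 4 with hs0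
  have hspos : 0 < s := by have := lt_min hs.pos hs'.pos; positivity
  have hsr : 4 * s ≤ r := by have := min_le_left r r'; linarith
  have hsr' : 4 * s ≤ r' := by have := min_le_right r r'; linarith
  filter_upwards [Metric.ball_mem_nhds x hspos] with y hy
  rw [Metric.mem_ball, dist_eq_norm] at hy
  have hmem : ∀ t ∈ Set.Icc 0 (2 * s), ‖y - t • n - x‖ < 4 * s := by
    intro t ht
    have e : y - t • n - x = (y - x) - t • n := by abel
    have h1 := norm_sub_le (y - x) (t • n)
    rw [norm_smul, hs.unit, mul_one, Real.norm_of_nonneg ht.1] at h1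
    rw [e]
    linarith [ht.2]
  have hmr : ∀ t ∈ Set.Icc 0 (2 * s), y - t • n ∈ Metric.ball x r := fun t ht => by
    rw [Metric.mem_ball, dist_eq_norm]; linarith [hmem t ht]
  have hmr' : ∀ t ∈ Set.Icc 0 (2 * s), y - t • n ∈ Metric.ball x r' := fun t ht => by
    rw [Metric.mem_ball, dist_eq_norm]; linarith [hmem t ht]
  have h00 : (0 : ℝ) ∈ Set.Icc 0 (2 * s) := ⟨le_rfl, by linarith⟩
  have hyr : y ∈ Metric.ball x r := by simpa using hmr 0 h00
  have hyr' : y ∈ Metric.ball x r' := by simpa using hmr' 0 h00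
  by_contra hcon
  simp only [Set.mem_union, not_or] at hcon
  obtain ⟨⟨hy1, hy2⟩, hy3⟩ := hcon
  rw [hs.mem_iff y hyr, not_lt] at hy1
  rw [hs'.mem_iff y hyr', not_lt] at hy2
  have hne : ρ y ≠ 0 := fun h0 =>
    hy3 (hsF y hyr ((hs.frontier_iff hT (by norm_num) (by norm_num) hyr).2 h0))
  have hypos : 0 < ρ y := lt_of_le_of_ne hy1 hne.symm
  have hc : ContinuousOn (fun t : ℝ => ρ (y - t • n)) (Set.Icc 0 (2 * s)) :=
    (hs.continuousOn (by norm_num)).comp (by fun_prop) hmr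
  have h2s : (2 * s) ∈ Set.Icc 0 (2 * s) := ⟨by linarith, le_rfl⟩
  have hend : ρ (y - (2 * s) • n) ≤ 0 := by
    have h1 := (abs_le.1 (hs.est _ (hmr _ h2s) x (Metric.mem_ball_self hs.pos))).2
    have e : y - (2 * s) • n - x = (y - x) - (2 * s) • n := by abel
    have h2 := norm_sub_le (y - x) ((2 * s) • n)
    have h3 := real_inner_le_norm n (y - x)
    rw [norm_smul, hs.unit, mul_one, Real.norm_of_nonneg (by linarith)] at h2
    rw [hs.unit, one_mul] at h3
    rw [hs.zero, e, inner_sub_right, real_inner_smul_right, real_inner_self_eq_norm_sq, hs.unit] at h1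
    linarith
  obtain ⟨t, ht, ht0⟩ := intermediate_value_Icc' (by linarith) hc (show (0:ℝ) ∈ Set.Icc _ _ from
    ⟨hend, by simpa using hypos.le⟩)
  have ht0' : ρ (y - t • n) = 0 := ht0
  have htpos : 0 < t := lt_of_le_of_ne ht.1 fun h => by
    rw [← h, zero_smul, sub_zero] at ht0'
    exact hne ht0'
  have hzF : y - t • n ∈ F := hsF _ (hmr t ht)
    ((hs.frontier_iff hT (by norm_num) (by norm_num) (hmr t ht)).2 ht0')
  have hz' := (hs'.frontier_iff hT' (by norm_num) (by norm_num) (hmr' t ht)).1 (hF'.subset hzF)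
  have h1 := (abs_le.1 (hs'.est _ (hmr' t ht) y hyr')).1
  have e : y - t • n - y = -(t • n) := by abel
  rw [e, hz', inner_neg_neg, real_inner_smul_right, real_inner_self_eq_norm_sq, hs.unit, norm_neg, norm_smul,
    hs.unit, Real.norm_of_nonneg ht.1] at h1
  linarith

/-- A third element cannot reach the interface, whose neighbourhood is filled by `T`, `T'` and `F`;
hence a face has at most two neighbours. -/
theorem IsRegularFace.not_mem_closure_of_disjoint (hT : IsOpen T) (hT' : IsOpen T') (hTT' : Disjoint T T')
    (hF : IsRegularFace T F) (hF' : IsRegularFace T' F) (hx : x ∈ F) {S : Set (E d)} (hS : IsOpen S)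
    (hST : Disjoint S T) (hST' : Disjoint S T') : x ∉ closure S := by
  intro hxS
  obtain ⟨y, hy, hyS⟩ := mem_closure_iff_nhds.1 hxS _ (hF.eventually_mem_union hT hT' hTT' hF' hx)
  rcases hy with (hy | hy) | hy
  · exact Set.disjoint_left.1 hST hyS hy
  · exact Set.disjoint_left.1 hST' hyS hy
  · exact Set.disjoint_left.1 (hST.closure_right hS) hyS (frontier_subset_closure (hF.subset hy))

theorem IsRegularFace.measure_univ_pos (hd : 1 ≤ d) (hT : IsOpen T) (hF : IsRegularFace T F)
    (hne : F.Nonempty) : surf F Set.univ ≠ 0 := by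
  obtain ⟨x, hx⟩ := hne
  obtain ⟨ρ, r, hs, h⟩ := hF.exists_isSide hx
  exact ((hs.measure_pos hd hT h one_pos).trans_le (measure_mono (Set.subset_univ _))).ne'

end Interface

theorem nontrivial_of_two_le {d : ℕ} (hd : 2 ≤ d) : Nontrivial (E d) := by
  have : Nontrivial (Fin d) := Fin.nontrivial_iff_two_le.2 hd
  infer_instance

theorem diam_pos_of_isOpen {d : ℕ} (hd : 2 ≤ d) {T : Set (E d)} (hT : IsOpen T) (hne : T.Nonempty)
    (hb : Bornology.IsBounded T) : 0 < Metric.diam T := by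
  have := nontrivial_of_two_le hd
  obtain ⟨x, hx⟩ := hne
  obtain ⟨a, ha, b, hb', hab⟩ := (infinite_of_mem_nhds x (hT.mem_nhds hx)).nontrivial
  exact (dist_pos.2 hab).trans_le (Metric.dist_le_diam_of_mem hb ha hb')

theorem IsElement.diam_pos {d : ℕ} {T : Set (E d)} (hT : IsElement T) : 0 < Metric.diam T :=
  diam_pos_of_isOpen hT.two_le hT.isOpen hT.connected.nonempty hT.bounded

/-! ### Geometry of curved meshes -/

namespace CurvedMesh

variable {d : ℕ} {Ω : Set (E d)} {ι κ : Type*} (M : CurvedMesh Ω ι κ)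

theorem isRegularFace {i : ι} {j : κ} (h : M.face j ⊆ frontier (M.elt i)) :
    IsRegularFace (M.elt i) (M.face j) :=
  ⟨h, fun x hx => (M.face_C1 i j h x hx).1, fun x hx => (M.face_C1 i j h x hx).2, (M.face_finite j).ne⟩

theorem isElement {M : CurvedMesh Ω ι κ} (hd : 2 ≤ d) (hΩb : Bornology.IsBounded Ω) (hM : M.IsRegular) (i : ι) :
    IsElement (M.elt i) := by
  have hb : Bornology.IsBounded (M.elt i) := hΩb.subset (M.elt_subset i)
  refine ⟨hd, M.elt_open i, M.elt_connected i, hb, ?_⟩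
  obtain ⟨ϱ, hϱ, h⟩ := hM
  obtain ⟨N, X, c, hX, hXs⟩ := h i
  have hdiam := diam_pos_of_isOpen hd (M.elt_open i) (M.elt_connected i).nonempty hb
  exact ⟨ϱ * Metric.diam (M.elt i), by positivity, N, X, c, hX, fun m => (hXs m).2⟩

/-- The points of the skeleton that are possibly not in a face. -/
def faceRims : Set (E d) := ⋃ j, closure (M.face j) \ M.face j

theorem surf_faceRims [Finite κ] : surf M.faceRims Set.univ = 0 := by
  rw [surf_apply _ _ MeasurableSet.univ, Set.univ_inter, faceRims, measure_iUnion_null_iff]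
  intro j
  have := M.face_boundary j
  rwa [surf_apply _ _ MeasurableSet.univ, Set.univ_inter] at this

theorem eventually_mem_interface {i i' : ι} (hii' : i ≠ i') {j : κ} (h : M.face j ⊆ frontier (M.elt i))
    (h' : M.face j ⊆ frontier (M.elt i')) {x : E d} (hx : x ∈ M.face j) :
    ∀ᶠ y in 𝓝 x, y ∈ M.elt i ∪ M.elt i' ∪ M.face j :=
  (M.isRegularFace h).eventually_mem_union (M.elt_open i) (M.elt_open i') (M.elt_disjoint hii')
    (M.isRegularFace h') hx

theorem eq_or_eq_of_interface {i i' i'' : ι} (hii' : i ≠ i') {j : κ} (h : M.face j ⊆ frontier (M.elt i))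
    (h' : M.face j ⊆ frontier (M.elt i')) (h'' : M.face j ⊆ frontier (M.elt i''))
    (hne : (M.face j).Nonempty) : i'' = i ∨ i'' = i' := by
  by_contra! hcon
  obtain ⟨x, hx⟩ := hne
  exact (M.isRegularFace h).not_mem_closure_of_disjoint (M.elt_open i) (M.elt_open i') (M.elt_disjoint hii')
    (M.isRegularFace h') hx (M.elt_open i'') (M.elt_disjoint hcon.1) (M.elt_disjoint hcon.2)
    (frontier_subset_closure (h'' hx))

theorem normal_eq_neg {i i' : ι} (hii' : i ≠ i') {j : κ} (h : M.face j ⊆ frontier (M.elt i))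
    (h' : M.face j ⊆ frontier (M.elt i')) {x : E d} (hx : x ∈ M.face j) :
    normal (M.elt i') x = -normal (M.elt i) x :=
  (isOutwardNormal_normal ((M.isRegularFace h).normal x hx)).eq_neg_of_disjoint (M.elt_disjoint hii')
    (isOutwardNormal_normal ((M.isRegularFace h').normal x hx))

theorem exists_mem_face_of_mem_frontier {i : ι} {x : E d} (hx : x ∈ frontier (M.elt i))
    (hxN : x ∉ M.faceRims) : ∃ j, x ∈ M.face j := by
  have : x ∈ ⋃ j, closure (M.face j) := M.skeleton ▸ Set.mem_iUnion.2 ⟨i, hx⟩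
  obtain ⟨j, hj⟩ := Set.mem_iUnion.1 this
  refine ⟨j, ?_⟩
  by_contra hxj
  exact hxN (Set.mem_iUnion.2 ⟨j, hj, hxj⟩)

/-- The elements are connected to each other through the faces that are not contained in `∂Ω`. -/
theorem induction_on_elements [Finite κ] (hd : 1 ≤ d) (hΩo : IsOpen Ω) (hΩc : IsPreconnected Ω) {P : ι → Prop} {i₀ : ι}
    (h0 : P i₀) (hstep : ∀ i i' j, ¬ M.face j ⊆ frontier Ω → M.face j ⊆ frontier (M.elt i) →
      M.face j ⊆ frontier (M.elt i') → P i → P i') (i : ι) : P i := by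
  by_contra hi
  -- Interiors of unions of closures: a point on a face between two elements of the same class is
  -- then interior, so `U` and `V` cover `Ω` up to the rims.
  let U : Set (E d) := interior (⋃ i ∈ {i | P i}, closure (M.elt i))
  let V : Set (E d) := interior (⋃ i ∈ {i | ¬ P i}, closure (M.elt i))
  have hsubU : ∀ i, P i → M.elt i ⊆ U := fun i hi => interior_maximal
    (subset_closure.trans (Set.subset_biUnion_of_mem (u := fun i => closure (M.elt i)) hi)) (M.elt_open i)
  have hsubV : ∀ i, ¬ P i → M.elt i ⊆ V := fun i hi => interior_maximal
    (subset_closure.trans (Set.subset_biUnion_of_mem (u := fun i => closure (M.elt i)) hi)) (M.elt_open i)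
  have hne : ∀ i, (M.elt i).Nonempty := fun i => (M.elt_connected i).nonempty
  refine not_separated_of_null hd hΩo hΩc M.surf_faceRims (U := U) (V := V) isOpen_interior isOpen_interior
    ?_ ?_ ?_ ?_
  · rw [Set.disjoint_left]
    intro x hxU hxV
    have hxU' := interior_subset hxU
    simp only [Set.mem_iUnion] at hxU'
    obtain ⟨a, ha, hxa⟩ := hxU'
    obtain ⟨y, hyV, hya⟩ := mem_closure_iff_nhds.1 hxa _ (isOpen_interior.mem_nhds hxV)
    have hyV' := interior_subset hyV
    simp only [Set.mem_iUnion] at hyV'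
    obtain ⟨b, hb, hyb⟩ := hyV'
    have hab : a ≠ b := fun h => hb (h ▸ ha)
    exact Set.disjoint_left.1 ((M.elt_disjoint hab).closure_right (M.elt_open a)) hya hyb
  · rintro x ⟨hxΩ, hxN⟩
    have hxc : x ∈ ⋃ i, closure (M.elt i) := M.elt_cover ▸ subset_closure hxΩ
    obtain ⟨a, ha⟩ := Set.mem_iUnion.1 hxc
    by_cases hxa : x ∈ M.elt a
    · by_cases hPa : P a
      · exact Or.inl (hsubU a hPa hxa)
      · exact Or.inr (hsubV a hPa hxa)
    · have hfr : x ∈ frontier (M.elt a) := by rw [(M.elt_open a).frontier_eq]; exact ⟨ha, hxa⟩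
      obtain ⟨j, hj⟩ := M.exists_mem_face_of_mem_frontier hfr hxN
      have hjΩ : ¬ M.face j ⊆ frontier Ω := fun h => by
        have := h hj
        rw [hΩo.frontier_eq] at this
        exact this.2 hxΩ
      rcases M.face_incidence j with ⟨b, c, hbc, hsub⟩ | ⟨b, hsub⟩
      · have hb := hsub.trans Set.inter_subset_left
        have hc := hsub.trans Set.inter_subset_right
        have hev := M.eventually_mem_interface hbc hb hc hj
        by_cases hPb : P b
        · have hPc := hstep b c j hjΩ hb hc hPb
          refine Or.inl (mem_interior_iff_mem_nhds.2 ?_)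
          filter_upwards [hev] with y hy
          rcases hy with (hy | hy) | hy
          · exact interior_subset (hsubU b hPb hy)
          · exact interior_subset (hsubU c hPc hy)
          · exact Set.mem_biUnion (show b ∈ {i | P i} from hPb) (frontier_subset_closure (hb hy))
        · have hPc : ¬ P c := fun h => hPb (hstep c b j hjΩ hc hb h)
          refine Or.inr (mem_interior_iff_mem_nhds.2 ?_)
          filter_upwards [hev] with y hy
          rcases hy with (hy | hy) | hy
          · exact interior_subset (hsubV b hPb hy)
          · exact interior_subset (hsubV c hPc hy)
          · exact Set.mem_biUnion (show b ∈ {i | ¬ P i} from hPb) (frontier_subset_closure (hb hy))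
      · exact absurd (hsub.trans Set.inter_subset_right) hjΩ
  · obtain ⟨x, hx⟩ := hne i₀
    exact ⟨x, M.elt_subset _ hx, hsubU _ h0 hx⟩
  · obtain ⟨x, hx⟩ := hne i
    exact ⟨x, M.elt_subset _ hx, hsubV _ hi hx⟩

/-- If the frontier of `closure Ω` were contained in the rims, these would separate the interior of
`closure Ω` from the nonempty complement. A frontier point off the rims lies in a face, and that
face is not internal, since a neighbourhood of an internal one is contained in `closure Ω`. -/
theorem exists_boundary_face [Finite κ] (hd : 2 ≤ d) (hΩc : IsConnected Ω) (hΩb : Bornology.IsBounded Ω) :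
    ∃ i j, M.face j ⊆ frontier (M.elt i) ∧ M.face j ⊆ frontier Ω ∧ (M.face j).Nonempty := by
  have hnt := nontrivial_of_two_le hd
  obtain ⟨x, hx, hxN⟩ : ∃ x ∈ frontier (closure Ω), x ∉ M.faceRims := by
    by_contra! hcon
    have hne : ∃ i, (M.elt i).Nonempty := by
      obtain ⟨y, hy⟩ := hΩc.nonempty
      have hyc : y ∈ ⋃ i, closure (M.elt i) := M.elt_cover ▸ subset_closure hy
      obtain ⟨i, -⟩ := Set.mem_iUnion.1 hyc
      exact ⟨i, (M.elt_connected i).nonempty⟩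
    obtain ⟨i, y, hy⟩ := hne
    refine not_separated_of_null (by omega) isOpen_univ isPreconnected_univ M.surf_faceRims
      (U := interior (closure Ω)) (V := (closure Ω)ᶜ) isOpen_interior isClosed_closure.isOpen_compl
      (disjoint_compl_right.mono_left interior_subset) ?_ ⟨y, trivial, ?_⟩ ?_
    · rintro z ⟨-, hz⟩
      by_cases hzc : z ∈ closure Ω
      · refine Or.inl ?_
        by_contra hzi
        exact hz (hcon z ⟨subset_closure hzc, hzi⟩)
      · exact Or.inr hzc
    · exact interior_maximal ((M.elt_subset i).trans subset_closure) (M.elt_open i) hy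
    · rw [Set.univ_inter, Set.nonempty_compl]
      intro h
      have := hΩb.closure
      rw [h] at this
      exact NormedSpace.unbounded_univ ℝ (E d) this
  have hxcl : x ∈ closure Ω := isClosed_closure.frontier_subset hx
  have hxint : x ∉ interior (closure Ω) := hx.2
  have hxc : x ∈ ⋃ i, closure (M.elt i) := M.elt_cover ▸ hxcl
  obtain ⟨a, ha⟩ := Set.mem_iUnion.1 hxc
  have hxa : x ∉ M.elt a := fun h => hxint
    (interior_maximal ((M.elt_subset a).trans subset_closure) (M.elt_open a) h)
  have hfr : x ∈ frontier (M.elt a) := by rw [(M.elt_open a).frontier_eq]; exact ⟨ha, hxa⟩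
  obtain ⟨j, hj⟩ := M.exists_mem_face_of_mem_frontier hfr hxN
  rcases M.face_incidence j with ⟨b, c, hbc, hsub⟩ | ⟨b, hsub⟩
  · exfalso
    have hb := hsub.trans Set.inter_subset_left
    have hc := hsub.trans Set.inter_subset_right
    refine hxint (mem_interior_iff_mem_nhds.2 ?_)
    filter_upwards [M.eventually_mem_interface hbc hb hc hj] with y hy
    rcases hy with (hy | hy) | hy
    · exact subset_closure (M.elt_subset b hy)
    · exact subset_closure (M.elt_subset c hy)
    · exact closure_mono (M.elt_subset b) (frontier_subset_closure (hb hy))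
  · exact ⟨b, j, hsub.trans Set.inter_subset_left, hsub.trans Set.inter_subset_right, ⟨x, hj⟩⟩

theorem volume_diff_iUnion_elt [Finite κ] (hd : 1 ≤ d) : volume (Ω \ ⋃ i, M.elt i) = 0 := by
  have hsub : Ω \ (⋃ i, M.elt i) ⊆ ⋃ j, closure (M.face j) := by
    rintro x ⟨hx, hxT⟩
    rw [← M.skeleton]
    have hxc : x ∈ ⋃ i, closure (M.elt i) := M.elt_cover ▸ subset_closure hx
    obtain ⟨a, ha⟩ := Set.mem_iUnion.1 hxc
    refine Set.mem_iUnion.2 ⟨a, ?_⟩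
    rw [(M.elt_open a).frontier_eq]
    exact ⟨ha, fun h => hxT (Set.mem_iUnion.2 ⟨a, h⟩)⟩
  refine measure_mono_null hsub ((measure_iUnion_null_iff).2 fun j => ?_)
  have h1 : volume (M.face j) = 0 := volume_eq_zero_of_surf_ne_top hd (M.face_finite j).ne
  have h2 : volume (closure (M.face j) \ M.face j) = 0 :=
    volume_eq_zero_of_surf_ne_top hd (by rw [M.face_boundary j]; simp)
  refine measure_mono_null (fun x hx => ?_) (measure_union_null h1 h2)
  by_cases h : x ∈ M.face j
  · exact Or.inl h
  · exact Or.inr ⟨hx, h⟩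

theorem ae_mem_elt [Finite ι] [Finite κ] (hd : 1 ≤ d) {p : E d → Prop} (h : ∀ i, ∀ᵐ x ∂(volume.restrict (M.elt i)), p x) :
    ∀ᵐ x ∂(volume.restrict Ω), p x := by
  have h1 : ∀ᵐ x ∂(volume.restrict (⋃ i, M.elt i)), p x := (ae_restrict_iUnion_iff _ _).2 h
  have h2 : (Ω : Set (E d)) ⊆ (⋃ i, M.elt i) ∪ (Ω \ ⋃ i, M.elt i) := by
    intro x hx
    by_cases h : x ∈ ⋃ i, M.elt i
    · exact Or.inl h
    · exact Or.inr ⟨hx, h⟩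
  refine ae_restrict_of_ae_restrict_of_subset h2 ((ae_restrict_union_iff _ _ _).2 ⟨h1, ?_⟩)
  rw [Measure.restrict_eq_zero.2 (M.volume_diff_iUnion_elt hd)]
  simp

end CurvedMesh

/-! ### Finite-dimensional variational problems -/

section Hilbert

variable {H : Type*} [NormedAddCommGroup H] [InnerProductSpace ℝ H]

theorem existsUnique_riesz (K : Submodule ℝ H) [FiniteDimensional ℝ K] {f : H → ℝ} (hf : LinOn K f) :
    ∃! x, x ∈ K ∧ ∀ w ∈ K, inner ℝ x w = f w := by
  let ℓ : StrongDual ℝ K := LinearMap.toContinuousLinearMap hf.toLin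
  have hx : ∀ w ∈ K, inner ℝ ((InnerProductSpace.toDual ℝ K).symm ℓ : H) w = f w := fun w hw => by
    have := InnerProductSpace.toDual_symm_apply (𝕜 := ℝ) (x := (⟨w, hw⟩ : K)) (y := ℓ)
    rw [Submodule.coe_inner] at this
    exact this
  refine ⟨_, ⟨((InnerProductSpace.toDual ℝ K).symm ℓ).2, hx⟩, ?_⟩
  rintro y ⟨hyK, hy⟩
  have hmem := K.sub_mem hyK ((InnerProductSpace.toDual ℝ K).symm ℓ).2
  have : inner ℝ (y - ((InnerProductSpace.toDual ℝ K).symm ℓ : H))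
      (y - ((InnerProductSpace.toDual ℝ K).symm ℓ : H)) = 0 := by
    rw [inner_sub_left, hy _ hmem, hx _ hmem, sub_self]
  exact sub_eq_zero.1 (inner_self_eq_zero.1 this)

/-- Solvability of a Neumann problem: `⟨J r, J w⟩ = f w` for all `w`, with prescribed mean. -/
theorem existsUnique_neumann {W X : Type*} [AddCommGroup W] [Module ℝ W] [FiniteDimensional ℝ W]
    [AddCommGroup X] [Module ℝ X] (J : W →ₗ[ℝ] H) (m : W →ₗ[ℝ] X) (f : W →ₗ[ℝ] ℝ)
    (hker : ∀ w, J w = 0 → m w = 0 → w = 0) (hsurj : ∀ c, ∃ w, J w = 0 ∧ m w = c)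
    (hf : ∀ w, J w = 0 → f w = 0) (c : X) :
    ∃! r, (∀ w, inner ℝ (J r) (J w) = f w) ∧ m r = c := by
  -- As `f` vanishes on the kernel of `J`, it factors through the range; the right inverse `g`
  -- expresses this, and Riesz representation on the range solves the equation up to that kernel.
  -- The kernel then adjusts the mean.
  obtain ⟨g, hg⟩ := J.rangeRestrict.exists_rightInverse_of_surjective J.range_rangeRestrict
  have hJg : ∀ w, J (g (J.rangeRestrict w)) = J w := fun w =>
    congrArg Subtype.val (LinearMap.congr_fun hg (J.rangeRestrict w))
  let ℓ : StrongDual ℝ (LinearMap.range J) := LinearMap.toContinuousLinearMap (f ∘ₗ g)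
  obtain ⟨r₀, hr₀⟩ := ((InnerProductSpace.toDual ℝ (LinearMap.range J)).symm ℓ).2
  have h0 : ∀ w, inner ℝ (J r₀) (J w) = f w := fun w => by
    have h1 := InnerProductSpace.toDual_symm_apply (𝕜 := ℝ) (x := J.rangeRestrict w) (y := ℓ)
    rw [Submodule.coe_inner, ← hr₀] at h1
    have h2 : f (g (J.rangeRestrict w) - w) = 0 := hf _ (by rw [map_sub, hJg, sub_self])
    rw [map_sub, sub_eq_zero] at h2
    exact h1.trans h2
  obtain ⟨w₁, hw₁, hm₁⟩ := hsurj (c - m r₀)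
  refine ⟨r₀ + w₁, ⟨fun w => by rw [map_add, hw₁, add_zero, h0], by rw [map_add, hm₁]; abel⟩, ?_⟩
  rintro y ⟨hy, hmy⟩
  rw [← sub_eq_zero]
  have hJ : ∀ w, inner ℝ (J (y - (r₀ + w₁))) (J w) = 0 := fun w => by
    rw [map_sub, map_add, hw₁, add_zero, inner_sub_left, hy, h0, sub_self]
  refine hker _ (inner_self_eq_zero.1 (hJ _)) ?_
  rw [map_sub, hmy, map_add, hm₁]
  abel

/-! ### Orthogonal projections -/

variable (K : Submodule ℝ H) [FiniteDimensional ℝ K]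

theorem orthProj_eq_starProjection (v : H) : (orthProj K v : H) = K.starProjection v := by
  have h : ∃ p : K, ∀ w ∈ K, inner ℝ (v - (p : H)) w = 0 :=
    ⟨⟨K.starProjection v, K.starProjection_apply_mem v⟩, K.starProjection_inner_eq_zero v⟩
  rw [orthProj, dif_pos h]
  exact (Submodule.eq_starProjection_of_mem_of_inner_eq_zero h.choose.2 h.choose_spec).symm

theorem orthProj_add (v w : H) : (orthProj K (v + w) : H) = orthProj K v + orthProj K w := by
  simp only [orthProj_eq_starProjection, map_add]

theorem orthProj_smul (c : ℝ) (v : H) : (orthProj K (c • v) : H) = c • (orthProj K v : H) := by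
  simp only [orthProj_eq_starProjection, map_smul]

theorem orthProj_of_mem {v : H} (hv : v ∈ K) : (orthProj K v : H) = v := by
  rw [orthProj_eq_starProjection]
  exact Submodule.starProjection_eq_self_iff.2 hv

end Hilbert

/-! ### The flux of a pressure through a face -/

section Flux

variable {d : ℕ} {T F : Set (E d)}

/-- The flux `q n` of `q` through the face `F`. -/
def flux (hT : IsOpen T) (hF : IsRegularFace T F) (q : L2 ℝ T) : L2Face (E d) F :=
  (hF.memLp_smul_normal hT (Lp.memLp (trace T F q))).toLp _

theorem flux_ae_eq (hT : IsOpen T) (hF : IsRegularFace T F) (q : L2 ℝ T) :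
    flux hT hF q =ᵐ[surf F] fun x => trace T F q x • normal T x :=
  MemLp.coeFn_toLp _

theorem inner_flux (hT : IsOpen T) (hF : IsRegularFace T F) (v : L2Face (E d) F) (q : L2 ℝ T) :
    ∫ x, inner ℝ (v x) (trace T F q x • normal T x) ∂(surf F) = inner ℝ v (flux hT hF q) := by
  rw [MeasureTheory.L2.inner_def]
  refine integral_congr_ae ?_
  filter_upwards [flux_ae_eq hT hF q] with x hx
  rw [hx]

theorem linOn_flux [IsFiniteMeasure ((volume : Measure (E d)).restrict T)] (hTe : IsElement T)
    (hF : IsRegularFace T F) : LinOn (h1 T) (flux hTe.isOpen hF) := by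
  have hl := linOn_trace hTe hF
  refine ⟨fun x hx y hy => Lp.ext ?_, fun c x hx => Lp.ext ?_⟩
  · filter_upwards [flux_ae_eq hTe.isOpen hF (x + y), flux_ae_eq hTe.isOpen hF x, flux_ae_eq hTe.isOpen hF y,
      Lp.coeFn_add (flux hTe.isOpen hF x) (flux hTe.isOpen hF y),
      Lp.coeFn_add (trace T F x) (trace T F y)] with z h1 h2 h3 h4 h5
    rw [h1, h4, Pi.add_apply, h2, h3, hl.add x hx y hy, h5, Pi.add_apply, add_smul]
  · filter_upwards [flux_ae_eq hTe.isOpen hF (c • x), flux_ae_eq hTe.isOpen hF x,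
      Lp.coeFn_smul c (flux hTe.isOpen hF x), Lp.coeFn_smul c (trace T F x)] with z h1 h2 h4 h5
    rw [h1, h4, Pi.smul_apply, h2, hl.smul c x hx, h5, Pi.smul_apply, smul_assoc]

end Flux

theorem integral_Lp_add {α V : Type*} [MeasurableSpace α] {μ : Measure α} [IsFiniteMeasure μ]
    [NormedAddCommGroup V] [NormedSpace ℝ V] (u v : Lp V 2 μ) :
    ∫ x, (u + v : Lp V 2 μ) x ∂μ = ∫ x, u x ∂μ + ∫ x, v x ∂μ := by
  rw [← integral_add (Lp_integrable u) (Lp_integrable v)]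
  exact integral_congr_ae (Lp.coeFn_add u v)

theorem integral_Lp_smul {α V : Type*} [MeasurableSpace α] {μ : Measure α}
    [NormedAddCommGroup V] [NormedSpace ℝ V] (c : ℝ) (u : Lp V 2 μ) :
    ∫ x, (c • u : Lp V 2 μ) x ∂μ = c • ∫ x, u x ∂μ := by
  rw [← integral_smul]
  exact integral_congr_ae (Lp.coeFn_smul c u)

namespace CurvedMesh

variable {d : ℕ} {Ω : Set (E d)} {ι κ : Type*} {M : CurvedMesh Ω ι κ} {k : ℕ}
  {Ψ : ∀ i, Submodule ℝ (L2 (E d) (M.elt i))} {Φ : ∀ i, Submodule ℝ (L2 ℝ (M.elt i))}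

/-! ### The discrete spaces -/

theorem finiteDimensional_extVel (hE : M.IsEnrichment Ψ Φ) (i : ι) :
    FiniteDimensional ℝ (M.extVel k Ψ i) := by
  have := hE.finite_velocity i
  unfold extVel
  infer_instance

theorem const_mem_extVel {i : ι} {w : L2 (E d) (M.elt i)} {c : E d}
    (hw : w =ᵐ[volume.restrict (M.elt i)] fun _ => c) : w ∈ M.extVel k Ψ i :=
  le_sup_left (a := polyVecT (k + 1) (M.elt i)) (const_mem_polyVecT hw)

theorem finiteDimensional_cellPres (hE : M.IsEnrichment Ψ Φ) (i : ι) :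
    FiniteDimensional ℝ (M.cellPres k Φ i) := by
  have := hE.finite_pressure i
  unfold cellPres
  infer_instance

theorem finiteDimensional_polyFace [Finite ι] (j : κ) : FiniteDimensional ℝ (M.polyFace k j) := by
  have h1 : FiniteDimensional ℝ (Submodule.span ℝ
      {v : L2Face (E d) (M.face j) | ∃ c : E d, v =ᵐ[surf (M.face j)] (fun (c : E d) (_ : E d) => c) c}) :=
    finiteDimensional_span_param (fun _ _ => ae_eq_refl _) (fun _ _ => ae_eq_refl _)
  have h2 : ∀ i, FiniteDimensional ℝ (Submodule.span ℝ {v : L2Face (E d) (M.face j) |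
      ∃ A : Fin d × Fin d → MvPolynomial.restrictTotalDegree (Fin d) ℝ k,
        v =ᵐ[surf (M.face j)] fun x =>
          matVecL (normal (M.elt i) x) (pevVec (fun a => (A a : MvPolynomial (Fin d) ℝ)) x)}) := fun i =>
    finiteDimensional_span_param
      (R := fun (A : Fin d × Fin d → MvPolynomial.restrictTotalDegree (Fin d) ℝ k) x =>
        matVecL (normal (M.elt i) x) (pevVec (fun a => (A a : MvPolynomial (Fin d) ℝ)) x))
      (fun A B => Eventually.of_forall fun x => by
        change matVecL _ (pevVec ((fun a => (A a : MvPolynomial (Fin d) ℝ)) + fun a => (B a : MvPolynomial (Fin d) ℝ)) x) = _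
        rw [pevVec_add, map_add]
        rfl)
      (fun c A => Eventually.of_forall fun x => by
        change matVecL _ (pevVec (c • fun a => (A a : MvPolynomial (Fin d) ℝ)) x) = _
        rw [pevVec_smul, map_smul]
        rfl)
  have h3 := finiteDimensional_span_iUnion h2
  -- The incidence condition on `i` is dropped here: an upper bound is enough.
  have hle : M.polyFace k j ≤
      Submodule.span ℝ {v : L2Face (E d) (M.face j) | ∃ c : E d, v =ᵐ[surf (M.face j)] fun _ => c} ⊔
      Submodule.span ℝ (⋃ i, {v : L2Face (E d) (M.face j) |
        ∃ A : Fin d × Fin d → MvPolynomial.restrictTotalDegree (Fin d) ℝ k,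
          v =ᵐ[surf (M.face j)] fun x =>
            matVecL (normal (M.elt i) x) (pevVec (fun a => (A a : MvPolynomial (Fin d) ℝ)) x)}) := by
    refine Submodule.span_le.2 ?_
    rintro v (hv | ⟨i, -, A, hA, hv⟩)
    · exact Submodule.mem_sup_left (Submodule.subset_span hv)
    · refine Submodule.mem_sup_right (Submodule.subset_span (Set.mem_iUnion.2 ⟨i, ?_⟩))
      exact ⟨fun a => ⟨A a, (MvPolynomial.mem_restrictTotalDegree _ _ _).2 (hA a)⟩, hv⟩
  exact Submodule.finiteDimensional_of_le hle

theorem const_mem_polyFace {j : κ} {v : L2Face (E d) (M.face j)} {c : E d}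
    (hv : v =ᵐ[surf (M.face j)] fun _ => c) : v ∈ M.polyFace k j :=
  Submodule.subset_span (Or.inl ⟨c, hv⟩)

theorem polyFace_le_faceVel (j : κ) : M.polyFace k j ≤ M.faceVel k Ψ Φ j :=
  le_sup_left.trans le_sup_left

theorem polyVecT_le_cellVel (i : ι) : polyVecT k (M.elt i) ≤ M.cellVel k Ψ Φ i :=
  le_sup_left.trans le_sup_left

variable [∀ i, IsFiniteMeasure ((volume : Measure (E d)).restrict (M.elt i))]

theorem extVel_le_lapDomain (hT : ∀ i, IsElement (M.elt i)) (hE : M.IsEnrichment Ψ Φ) (i : ι) :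
    M.extVel k Ψ i ≤ lapDomain (M.elt i) :=
  sup_le (polyVecT_le_lapDomain (hT i).isOpen (hT i).bounded) fun ψ hψ => hE.U2 i ψ hψ

theorem extVel_le_h1Vec (hT : ∀ i, IsElement (M.elt i)) (hE : M.IsEnrichment Ψ Φ) (i : ι) :
    M.extVel k Ψ i ≤ h1Vec (M.elt i) :=
  (extVel_le_lapDomain hT hE i).trans (lapDomain_le _)

theorem extVel_le_nTraceDomain (hT : ∀ i, IsElement (M.elt i)) (hE : M.IsEnrichment Ψ Φ) (i : ι)
    (j : M.facesOf i) : M.extVel k Ψ i ≤ nTraceDomain (M.face j) (M.elt_open i) :=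
  sup_le (polyVecT_le_nTraceDomain (hT i).isOpen (hT i).bounded (M.isRegularFace j.2))
    fun ψ hψ => ⟨hE.U1 i ψ hψ, hE.U3 i ψ hψ j⟩

theorem cellPres_le_h1 (hT : ∀ i, IsElement (M.elt i)) (hE : M.IsEnrichment Ψ Φ) (i : ι) :
    M.cellPres k Φ i ≤ h1 (M.elt i) :=
  sup_le (polyT_le_h1 (hT i).isOpen (hT i).bounded) fun φ hφ => hE.P1 i φ hφ

theorem finiteDimensional_cellVel (hE : M.IsEnrichment Ψ Φ) (i : ι) :
    FiniteDimensional ℝ (M.cellVel k Ψ Φ i) := by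
  have := hE.finite_velocity i
  have := hE.finite_pressure i
  have h1 := finiteDimensional_span_image (W := Ψ i)
    ((linOn_weakLap (M.elt_open i)).mono fun ψ hψ => hE.U2 i ψ hψ)
  have h2 := finiteDimensional_span_image (W := Φ i)
    ((linOn_weakGrad (M.elt_open i)).mono fun φ hφ => hE.P1 i φ hφ)
  unfold cellVel
  infer_instance

theorem finiteDimensional_faceVel [Finite ι] (hT : ∀ i, IsElement (M.elt i)) (hE : M.IsEnrichment Ψ Φ) (j : κ) :
    FiniteDimensional ℝ (M.faceVel k Ψ Φ j) := by
  have := finiteDimensional_polyFace (M := M) (k := k) j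
  have h1 : ∀ i : {i // M.face j ⊆ frontier (M.elt i)}, FiniteDimensional ℝ
      (Submodule.span ℝ (normalTrace (M.elt i) (M.face j) '' Ψ i)) := fun i => by
    have := hE.finite_velocity i
    exact finiteDimensional_span_image ((linOn_normalTrace (M.elt_open i) (M.isRegularFace i.2)).mono
      fun ψ hψ => ⟨hE.U1 i ψ hψ, hE.U3 i ψ hψ ⟨j, i.2⟩⟩)
  have h2 : ∀ i : {i // M.face j ⊆ frontier (M.elt i)}, FiniteDimensional ℝ
      (Submodule.span ℝ (flux (M.elt_open i) (M.isRegularFace i.2) '' Φ i)) := fun i => by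
    have := hE.finite_pressure i
    exact finiteDimensional_span_image ((linOn_flux (hT i) (M.isRegularFace i.2)).mono
      fun φ hφ => hE.P1 i φ hφ)
  have h1' := finiteDimensional_span_iUnion h1
  have h2' := finiteDimensional_span_iUnion h2
  have h3 : FiniteDimensional ℝ (Submodule.span ℝ {v | ∃ i, M.face j ⊆ frontier (M.elt i) ∧ ∃ ψ ∈ Ψ i,
      v = normalTrace (M.elt i) (M.face j) ψ}) := by
    refine Submodule.finiteDimensional_of_le (Submodule.span_mono (s := {v | ∃ i, M.face j ⊆ frontier (M.elt i) ∧
      ∃ ψ ∈ Ψ i, v = normalTrace (M.elt i) (M.face j) ψ}) (t := ⋃ i : {i // M.face j ⊆ frontier (M.elt i)},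
        normalTrace (M.elt i) (M.face j) '' Ψ i) ?_)
    rintro v ⟨i, hi, ψ, hψ, rfl⟩
    exact Set.mem_iUnion.2 ⟨⟨i, hi⟩, ψ, hψ, rfl⟩
  have h4 : FiniteDimensional ℝ (Submodule.span ℝ {v : L2Face (E d) (M.face j) |
      ∃ i, M.face j ⊆ frontier (M.elt i) ∧ ∃ φ ∈ Φ i,
        v =ᵐ[surf (M.face j)] fun x => trace (M.elt i) (M.face j) φ x • normal (M.elt i) x}) := by
    refine Submodule.finiteDimensional_of_le (Submodule.span_mono
      (t := ⋃ i : {i // M.face j ⊆ frontier (M.elt i)}, flux (M.elt_open i) (M.isRegularFace i.2) '' Φ i) ?_)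
    rintro v ⟨i, hi, φ, hφ, hv⟩
    refine Set.mem_iUnion.2 ⟨⟨i, hi⟩, φ, hφ, Lp.ext ?_⟩
    exact (flux_ae_eq (M.elt_open i) (M.isRegularFace hi) φ).trans hv.symm
  unfold faceVel
  infer_instance

/-- With `flux_mem_faceVel`, this makes the test velocity built from a discrete pressure admissible.
-/
theorem weakGrad_mem_cellVel (hT : ∀ i, IsElement (M.elt i)) (hE : M.IsEnrichment Ψ Φ) {i : ι}
    {q : L2 ℝ (M.elt i)} (hq : q ∈ M.cellPres k Φ i) : weakGrad (M.elt i) q ∈ M.cellVel k Ψ Φ i := by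
  obtain ⟨p, hp, φ, hφ, rfl⟩ := Submodule.mem_sup.1 hq
  rw [(linOn_weakGrad (M.elt_open i)).add p (polyT_le_h1 (hT i).isOpen (hT i).bounded hp) φ (hE.P1 i φ hφ)]
  refine Submodule.add_mem _ (polyVecT_le_cellVel i (weakGrad_mem_polyVecT (hT i).isOpen (hT i).bounded hp)) ?_
  exact Submodule.mem_sup_right (Submodule.subset_span ⟨φ, hφ, rfl⟩)

theorem flux_mem_faceVel (hT : ∀ i, IsElement (M.elt i)) (hE : M.IsEnrichment Ψ Φ) {i : ι} {j : κ}
    (hj : M.face j ⊆ frontier (M.elt i)) {q : L2 ℝ (M.elt i)} (hq : q ∈ M.cellPres k Φ i) :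
    flux (M.elt_open i) (M.isRegularFace hj) q ∈ M.faceVel k Ψ Φ j := by
  obtain ⟨p, hp, φ, hφ, rfl⟩ := Submodule.mem_sup.1 hq
  rw [(linOn_flux (hT i) (M.isRegularFace hj)).add p (polyT_le_h1 (hT i).isOpen (hT i).bounded hp) φ
    (hE.P1 i φ hφ)]
  refine Submodule.add_mem _ (polyFace_le_faceVel j ?_) ?_
  · obtain ⟨P, hPk, hP⟩ := exists_of_mem_polyT hp
    -- The tensor is `P` times the identity, so that its product with the normal is `P n`.
    refine Submodule.subset_span (Or.inr ⟨i, hj, fun a => if a.1 = a.2 then P else 0, fun a => ?_, ?_⟩)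
    · dsimp only
      split_ifs
      · exact hPk
      · simp
    · filter_upwards [flux_ae_eq (M.elt_open i) (M.isRegularFace hj) p,
        trace_ae_eq_of_polynomial (hT i).isOpen (hT i).bounded (M.isRegularFace hj) hP] with x hx hx'
      rw [hx, hx']
      ext a
      simp [matVec, pev, apply_ite, ite_mul]
  · exact Submodule.mem_sup_right (Submodule.subset_span ⟨i, hj, φ, hφ, flux_ae_eq _ _ _⟩)

end CurvedMesh

/-! ### Constant functions on elements and faces. -/

section Constants

variable {d : ℕ} {T : Set (E d)}

theorem IsElement.measureReal_pos (hTe : IsElement T) : 0 < (volume : Measure (E d)).real T :=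
  ENNReal.toReal_pos (hTe.isOpen.measure_pos _ hTe.connected.nonempty).ne' hTe.bounded.measure_lt_top.ne

theorem integral_of_ae_const {V : Type*} [NormedAddCommGroup V] [NormedSpace ℝ V] [CompleteSpace V]
    {w : E d → V} {c : V} (hw : w =ᵐ[volume.restrict T] fun _ => c) :
    ∫ x in T, w x = (volume : Measure (E d)).real T • c := by
  rw [integral_congr_ae hw]
  simp

theorem eq_const_of_ae_const {F : Set (E d)} {V : Type*} {c c' : V} (hF : surf F Set.univ ≠ 0)
    {v : E d → V} (h : v =ᵐ[surf F] fun _ => c) (h' : v =ᵐ[surf F] fun _ => c') : c = c' := by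
  have : NeZero (surf F) := ⟨fun h0 => hF (by rw [h0]; rfl)⟩
  obtain ⟨x, hx⟩ := (h.symm.trans h').exists
  exact hx

theorem weakJac_eq_zero_of_const [IsFiniteMeasure ((volume : Measure (E d)).restrict T)]
    (hTe : IsElement T) {w : L2 (E d) T} {c : E d}
    (hw : w =ᵐ[volume.restrict T] fun _ => c) : weakJac T w = 0 := by
  have hp : w =ᵐ[volume.restrict T] pevVec fun i => MvPolynomial.C (c i) :=
    hw.trans (Eventually.of_forall fun x => by ext i; simp [pevVec, pev])
  rw [(isWeakJac_of_polynomial hTe.isOpen hTe.bounded hp).weakJac_eq hTe.isOpen]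
  refine Lp.ext ?_
  filter_upwards [MemLp.coeFn_toLp (memLp_pevVec hTe.isOpen hTe.bounded fun a : Fin d × Fin d =>
    MvPolynomial.pderiv a.2 (MvPolynomial.C (c a.1))),
    Lp.coeFn_zero (Mat d) 2 ((volume : Measure (E d)).restrict T)] with x h1 h2
  rw [h1, h2]
  ext a
  simp [pevVec, pev]

end Constants

namespace CurvedMesh

variable {d : ℕ} {Ω : Set (E d)} {ι κ : Type*} [Fintype κ] {M : CurvedMesh Ω ι κ} {k : ℕ}
  {Ψ : ∀ i, Submodule ℝ (L2 (E d) (M.elt i))} {Φ : ∀ i, Submodule ℝ (L2 ℝ (M.elt i))}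
  [∀ i, IsFiniteMeasure ((volume : Measure (E d)).restrict (M.elt i))]

/-! ### The velocity reconstruction -/

section Reconstruction

variable (hT : ∀ i, IsElement (M.elt i)) (hE : M.IsEnrichment Ψ Φ) {i : ι}

include hT hE

theorem linOn_reconRhs (v : M.LocalVel k Ψ Φ i) : LinOn (M.extVel k Ψ i) (fun w : L2 (E d) (M.elt i) =>
    -inner ℝ (v.1 : L2 (E d) (M.elt i)) (weakLap (M.elt i) w) +
        ∑ j : M.facesOf i, inner ℝ (v.2 j : L2Face (E d) (M.face j))
          (normalTrace (M.elt i) (M.face j) w)) := by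
  have hL := (linOn_weakLap (M.elt_open i)).mono (extVel_le_lapDomain (k := k) hT hE i)
  have hN := fun j : M.facesOf i => (linOn_normalTrace (M.elt_open i) (M.isRegularFace j.2)).mono
    (extVel_le_nTraceDomain (k := k) hT hE i j)
  refine ⟨fun x hx y hy => ?_, fun c x hx => ?_⟩
  · simp only [hL.add x hx y hy, fun j => (hN j).add x hx y hy, inner_add_right, Finset.sum_add_distrib]
    ring
  · simp only [hL.smul c x hx, fun j => (hN j).smul c x hx, inner_smul_right, ← Finset.mul_sum, smul_eq_mul]
    ring

/-- A Neumann problem: on a connected element the kernel of the Jacobian consists of the constants,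
which the extended space contains. The right-hand side vanishes on them since their Laplacian and
normal derivative are zero, and the mean condition selects one. -/
theorem existsUnique_isReconstruction (v : M.LocalVel k Ψ Φ i) : ∃! r, M.IsReconstruction v r := by
  have := finiteDimensional_extVel (k := k) hE i
  have hle := extVel_le_h1Vec (k := k) hT hE i
  have hvol := (hT i).measureReal_pos
  let J := ((linOn_weakJac (M.elt_open i)).mono hle).toLin
  let m : M.extVel k Ψ i →ₗ[ℝ] E d :=
    { toFun := fun w => ∫ x in M.elt i, (w : L2 (E d) (M.elt i)) x
      map_add' := fun u w => integral_Lp_add (u : L2 (E d) (M.elt i)) w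
      map_smul' := fun c w => integral_Lp_smul c (w : L2 (E d) (M.elt i)) }
  have hcst : ∀ w : M.extVel k Ψ i, J w = 0 → ∃ a : E d,
      (w : L2 (E d) (M.elt i)) =ᵐ[volume.restrict (M.elt i)] fun _ => a := fun w hw =>
    exists_ae_const_of_weakJac_eq_zero (M.elt_open i) (M.elt_connected i).isPreconnected (hle w.2) hw
  obtain ⟨r, ⟨h1, h2⟩, h3⟩ := existsUnique_neumann J m (linOn_reconRhs hT hE v).toLin
    (fun w hw hm => by
      obtain ⟨a, ha⟩ := hcst w hw
      have hm' : ∫ x in M.elt i, (w : L2 (E d) (M.elt i)) x = 0 := hm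
      rw [integral_of_ae_const ha, smul_eq_zero, or_iff_right hvol.ne'] at hm'
      rw [hm'] at ha
      exact Subtype.ext (Lp.ext (ha.trans (Lp.coeFn_zero _ _ _).symm)))
    (fun c => by
      have hc : MemLp (fun _ : E d => (volume.real (M.elt i))⁻¹ • c) 2 (volume.restrict (M.elt i)) :=
        memLp_const _
      refine ⟨⟨hc.toLp _, const_mem_extVel hc.coeFn_toLp⟩, weakJac_eq_zero_of_const (hT i) hc.coeFn_toLp, ?_⟩
      change ∫ x in M.elt i, (hc.toLp _ : L2 (E d) (M.elt i)) x = c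
      rw [integral_of_ae_const hc.coeFn_toLp, smul_smul, mul_inv_cancel₀ hvol.ne', one_smul])
    (fun w hw => by
      change -inner ℝ (v.1 : L2 (E d) (M.elt i)) (weakLap (M.elt i) w) +
        ∑ j : M.facesOf i, inner ℝ (v.2 j : L2Face (E d) (M.face j))
          (normalTrace (M.elt i) (M.face j) w) = 0
      rw [weakLap_eq_zero (M.elt_open i) (hle w.2) hw, inner_zero_right, neg_zero, zero_add]
      refine Finset.sum_eq_zero fun j _ => ?_
      rw [(isNormalTrace_of_weakJac_eq_zero hw).normalTrace_eq (M.elt_open i) (M.isRegularFace j.2),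
        inner_zero_right])
    (∫ x in M.elt i, (v.1 : L2 (E d) (M.elt i)) x)
  refine ⟨r, ⟨r.2, fun w hw => h1 ⟨w, hw⟩, h2⟩, ?_⟩
  rintro y ⟨hy, hy1, hy2⟩
  exact congrArg Subtype.val (h3 ⟨y, hy⟩ ⟨fun w => hy1 w w.2, hy2⟩)

theorem isReconstruction_recon (v : M.LocalVel k Ψ Φ i) : M.IsReconstruction v (M.recon v) := by
  have h := (existsUnique_isReconstruction hT hE v).exists
  rw [recon, dif_pos h]
  exact h.choose_spec

/-- By uniqueness: a combination of reconstructions solves the problem that defines the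
reconstruction of the combination. -/
theorem isLinearMap_recon : IsLinearMap ℝ (M.recon : M.LocalVel k Ψ Φ i → L2 (E d) (M.elt i)) := by
  have hJ := (linOn_weakJac (M.elt_open i)).mono (extVel_le_h1Vec (k := k) hT hE i)
  refine ⟨fun u v => (existsUnique_isReconstruction hT hE _).unique (isReconstruction_recon hT hE _) ?_,
    fun c v => (existsUnique_isReconstruction hT hE _).unique (isReconstruction_recon hT hE _) ?_⟩
  · obtain ⟨hu1, hu2, hu3⟩ := isReconstruction_recon hT hE u
    obtain ⟨hv1, hv2, hv3⟩ := isReconstruction_recon hT hE v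
    refine ⟨Submodule.add_mem _ hu1 hv1, fun w hw => ?_, ?_⟩
    · simp only [hJ.add _ hu1 _ hv1, inner_add_left, hu2 w hw, hv2 w hw, Prod.fst_add, Prod.snd_add, Pi.add_apply,
        Submodule.coe_add, Finset.sum_add_distrib]
      ring
    · rw [integral_Lp_add, hu3, hv3, Prod.fst_add, Submodule.coe_add, integral_Lp_add]
  · obtain ⟨hv1, hv2, hv3⟩ := isReconstruction_recon hT hE v
    refine ⟨Submodule.smul_mem _ c hv1, fun w hw => ?_, ?_⟩
    · simp only [hJ.smul c _ hv1, real_inner_smul_left, hv2 w hw, Prod.smul_fst, Prod.smul_snd, Pi.smul_apply,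
        Submodule.coe_smul, ← Finset.mul_sum]
      ring
    · rw [integral_Lp_smul, hv3, Prod.smul_fst, Submodule.coe_smul, integral_Lp_smul]

theorem recon_mem_h1Vec (v : M.LocalVel k Ψ Φ i) : M.recon v ∈ h1Vec (M.elt i) :=
  extVel_le_h1Vec hT hE i (isReconstruction_recon hT hE v).1

theorem isLinearMap_weakJac_recon :
    IsLinearMap ℝ (fun v : M.LocalVel k Ψ Φ i => weakJac (M.elt i) (M.recon v)) := by
  have hJ := linOn_weakJac (M.elt_open i)
  have hr := isLinearMap_recon (k := k) hT hE (i := i)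
  refine ⟨fun u v => ?_, fun c v => ?_⟩
  · rw [hr.map_add, hJ.add _ (recon_mem_h1Vec hT hE u) _ (recon_mem_h1Vec hT hE v)]
  · rw [hr.map_smul, hJ.smul c _ (recon_mem_h1Vec hT hE v)]

theorem exists_ae_const_recon {v : M.LocalVel k Ψ Φ i} (h : weakJac (M.elt i) (M.recon v) = 0) :
    ∃ c : E d, M.recon v =ᵐ[volume.restrict (M.elt i)] fun _ => c :=
  exists_ae_const_of_weakJac_eq_zero (M.elt_open i) (M.elt_connected i).isPreconnected
    (recon_mem_h1Vec hT hE v) h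

/-! ### The divergence reconstruction -/

theorem linOn_divRhs (v : M.LocalVel k Ψ Φ i) : LinOn (M.cellPres k Φ i) (fun q : L2 ℝ (M.elt i) =>
    -inner ℝ (v.1 : L2 (E d) (M.elt i)) (weakGrad (M.elt i) q) +
        ∑ j : M.facesOf i, inner ℝ (v.2 j : L2Face (E d) (M.face j))
          (flux (M.elt_open i) (M.isRegularFace j.2) q)) := by
  have hG := (linOn_weakGrad (M.elt_open i)).mono (cellPres_le_h1 (k := k) hT hE i)
  have hN := fun j : M.facesOf i => (linOn_flux (hT i) (M.isRegularFace j.2)).mono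
    (cellPres_le_h1 (k := k) hT hE i)
  refine ⟨fun x hx y hy => ?_, fun c x hx => ?_⟩
  · simp only [hG.add x hx y hy, fun j => (hN j).add x hx y hy, inner_add_right, Finset.sum_add_distrib]
    ring
  · simp only [hG.smul c x hx, fun j => (hN j).smul c x hx, inner_smul_right, ← Finset.mul_sum, smul_eq_mul]
    ring

omit [∀ i, IsFiniteMeasure ((volume : Measure (E d)).restrict (M.elt i))] hT hE in
theorem isDivReconstruction_iff {v : M.LocalVel k Ψ Φ i} {D : L2 ℝ (M.elt i)} :
    M.IsDivReconstruction v D ↔ D ∈ M.cellPres k Φ i ∧ ∀ q ∈ M.cellPres k Φ i, inner ℝ D q =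
      -inner ℝ (v.1 : L2 (E d) (M.elt i)) (weakGrad (M.elt i) q) +
        ∑ j : M.facesOf i, inner ℝ (v.2 j : L2Face (E d) (M.face j))
          (flux (M.elt_open i) (M.isRegularFace j.2) q) := by
  simp only [IsDivReconstruction, ← inner_flux]

theorem existsUnique_isDivReconstruction (v : M.LocalVel k Ψ Φ i) : ∃! D, M.IsDivReconstruction v D := by
  have := finiteDimensional_cellPres (k := k) hE i
  simp only [isDivReconstruction_iff]
  exact existsUnique_riesz _ (linOn_divRhs hT hE v)

theorem isDivReconstruction_divRecon (v : M.LocalVel k Ψ Φ i) : M.IsDivReconstruction v (M.divRecon v) := by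
  have h := (existsUnique_isDivReconstruction hT hE v).exists
  rw [divRecon, dif_pos h]
  exact h.choose_spec

theorem isLinearMap_divRecon : IsLinearMap ℝ (M.divRecon : M.LocalVel k Ψ Φ i → L2 ℝ (M.elt i)) := by
  refine ⟨fun u v => (existsUnique_isDivReconstruction hT hE _).unique (isDivReconstruction_divRecon hT hE _) ?_,
    fun c v => (existsUnique_isDivReconstruction hT hE _).unique (isDivReconstruction_divRecon hT hE _) ?_⟩
  · obtain ⟨hu1, hu2⟩ := isDivReconstruction_iff.1 (isDivReconstruction_divRecon hT hE u)
    obtain ⟨hv1, hv2⟩ := isDivReconstruction_iff.1 (isDivReconstruction_divRecon hT hE v)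
    refine isDivReconstruction_iff.2 ⟨Submodule.add_mem _ hu1 hv1, fun w hw => ?_⟩
    simp only [inner_add_left, hu2 w hw, hv2 w hw, Prod.fst_add, Prod.snd_add, Pi.add_apply,
      Submodule.coe_add, Finset.sum_add_distrib]
    ring
  · obtain ⟨hv1, hv2⟩ := isDivReconstruction_iff.1 (isDivReconstruction_divRecon hT hE v)
    refine isDivReconstruction_iff.2 ⟨Submodule.smul_mem _ c hv1, fun w hw => ?_⟩
    simp only [real_inner_smul_left, hv2 w hw, Prod.smul_fst, Prod.smul_snd, Pi.smul_apply,
      Submodule.coe_smul, ← Finset.mul_sum]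
    ring

/-! ### Stabilisation -/

theorem isLinearMap_cellResidual (KT : Submodule ℝ (L2 (E d) (M.elt i))) [FiniteDimensional ℝ KT] :
    IsLinearMap ℝ (fun v : M.LocalVel k Ψ Φ i => (v.1 : L2 (E d) (M.elt i)) - orthProj KT (M.recon v)) := by
  have hr := isLinearMap_recon (k := k) hT hE (i := i)
  refine ⟨fun u v => ?_, fun c v => ?_⟩
  · rw [hr.map_add, orthProj_add, Prod.fst_add, Submodule.coe_add]; abel
  · rw [hr.map_smul, orthProj_smul, Prod.smul_fst, Submodule.coe_smul, smul_sub]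

theorem isLinearMap_faceResidual (j : M.facesOf i) (KF : Submodule ℝ (L2Face (E d) (M.face j)))
    [FiniteDimensional ℝ KF] :
    IsLinearMap ℝ (fun v : M.LocalVel k Ψ Φ i => (v.2 j : L2Face (E d) (M.face j)) -
      orthProj KF (trace (M.elt i) (M.face j) (M.recon v))) := by
  have hr := isLinearMap_recon (k := k) hT hE (i := i)
  have ht := linOn_trace_vec (hT i) (M.isRegularFace j.2)
  refine ⟨fun u v => ?_, fun c v => ?_⟩
  · rw [hr.map_add, ht.add _ (recon_mem_h1Vec hT hE u) _ (recon_mem_h1Vec hT hE v), orthProj_add,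
      Prod.snd_add, Pi.add_apply, Submodule.coe_add]
    abel
  · rw [hr.map_smul, ht.smul c _ (recon_mem_h1Vec hT hE v), orthProj_smul, Prod.smul_snd, Pi.smul_apply,
      Submodule.coe_smul, smul_sub]

omit [Fintype κ] [∀ i, IsFiniteMeasure ((volume : Measure (E d)).restrict (M.elt i))] hT hE in
/-- The discrete velocity is equal to the constant `c` on the element and on its faces. -/
def IsConstVel (v : M.LocalVel k Ψ Φ i) (c : E d) : Prop :=
  (v.1 : L2 (E d) (M.elt i)) =ᵐ[volume.restrict (M.elt i)] (fun _ => c) ∧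
    ∀ j : M.facesOf i, (v.2 j : L2Face (E d) (M.face j)) =ᵐ[surf (M.face j)] fun _ => c

omit hE in
-- The projectors fix constants, which belong to all the spaces considered, the plain polynomial
-- ones included.
theorem isConstVel_of_residual_eq_zero {v : M.LocalVel k Ψ Φ i} {c : E d}
    (hc : M.recon v =ᵐ[volume.restrict (M.elt i)] fun _ => c)
    (KT : Submodule ℝ (L2 (E d) (M.elt i))) [FiniteDimensional ℝ KT] (hKT : polyVecT k (M.elt i) ≤ KT)
    (KF : ∀ j : M.facesOf i, Submodule ℝ (L2Face (E d) (M.face j))) [∀ j, FiniteDimensional ℝ (KF j)]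
    (hKF : ∀ j : M.facesOf i, M.polyFace k j ≤ KF j)
    (h1 : (v.1 : L2 (E d) (M.elt i)) - orthProj KT (M.recon v) = 0)
    (h2 : ∀ j : M.facesOf i, (v.2 j : L2Face (E d) (M.face j)) -
      orthProj (KF j) (trace (M.elt i) (M.face j) (M.recon v)) = 0) : IsConstVel v c := by
  refine ⟨?_, fun j => ?_⟩
  · rw [sub_eq_zero, orthProj_of_mem _ (hKT (const_mem_polyVecT hc))] at h1
    rw [h1]
    exact hc
  · have ht := trace_ae_eq_of_const (M.elt_open i) (hT i).bounded (M.isRegularFace j.2) hc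
    have h := h2 j
    rw [sub_eq_zero, orthProj_of_mem _ (hKF j (const_mem_polyFace ht))] at h
    rw [h]
    exact ht

theorem explicitStab_spec (KT : Submodule ℝ (L2 (E d) (M.elt i))) [FiniteDimensional ℝ KT]
    (hKT : polyVecT k (M.elt i) ≤ KT)
    (KF : ∀ j : M.facesOf i, Submodule ℝ (L2Face (E d) (M.face j))) [∀ j, FiniteDimensional ℝ (KF j)]
    (hKF : ∀ j : M.facesOf i, M.polyFace k j ≤ KF j) :
    (∃ B : LinearMap.BilinForm ℝ (M.LocalVel k Ψ Φ i), ∀ u v, B u v = M.explicitStab i KT KF u v) ∧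
      (∀ v : M.LocalVel k Ψ Φ i, 0 ≤ M.explicitStab i KT KF v v) ∧
      ∀ v : M.LocalVel k Ψ Φ i, weakJac (M.elt i) (M.recon v) = 0 → M.explicitStab i KT KF v v = 0 →
        ∃ c, IsConstVel v c := by
  have hd := (hT i).diam_pos
  have h1 := isLinearMap_cellResidual (k := k) hT hE KT
  have h2 := fun j => isLinearMap_faceResidual (k := k) hT hE j (KF j)
  have e : ∀ v : M.LocalVel k Ψ Φ i, M.explicitStab i KT KF v v = (Metric.diam (M.elt i) ^ 2)⁻¹ *
      ‖(v.1 : L2 (E d) (M.elt i)) - orthProj KT (M.recon v)‖ ^ 2 + (Metric.diam (M.elt i))⁻¹ *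
      ∑ j : M.facesOf i, ‖(v.2 j : L2Face (E d) (M.face j)) -
        orthProj (KF j) (trace (M.elt i) (M.face j) (M.recon v))‖ ^ 2 := fun v => by
    simp only [explicitStab, real_inner_self_eq_norm_sq]
  refine ⟨⟨LinearMap.mk₂ ℝ (M.explicitStab i KT KF) ?_ ?_ ?_ ?_, fun u v => rfl⟩, fun v => ?_, fun v hv hs => ?_⟩
  · intro u u' v
    have h1' := h1.map_add u u'
    have h2' := fun j => (h2 j).map_add u u'
    simp only [explicitStab, h1', h2', inner_add_left, Finset.sum_add_distrib]
    ring
  · intro c u v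
    have h1' := h1.map_smul c u
    have h2' := fun j => (h2 j).map_smul c u
    simp only [explicitStab, h1', h2', real_inner_smul_left, ← Finset.mul_sum, smul_eq_mul]
    ring
  · intro u v v'
    have h1' := h1.map_add v v'
    have h2' := fun j => (h2 j).map_add v v'
    simp only [explicitStab, h1', h2', inner_add_right, Finset.sum_add_distrib]
    ring
  · intro c u v
    have h1' := h1.map_smul c v
    have h2' := fun j => (h2 j).map_smul c v
    simp only [explicitStab, h1', h2', real_inner_smul_right, ← Finset.mul_sum, smul_eq_mul]
    ring
  · rw [e]; positivity
  · obtain ⟨c, hc⟩ := exists_ae_const_recon hT hE hv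
    rw [e, add_eq_zero_iff_of_nonneg (by positivity) (by positivity), mul_eq_zero, mul_eq_zero,
      or_iff_right (by positivity), or_iff_right (by positivity),
      Finset.sum_eq_zero_iff_of_nonneg fun _ _ => by positivity] at hs
    refine ⟨c, isConstVel_of_residual_eq_zero hT hc KT hKT KF hKF (by simpa using hs.1) fun j => ?_⟩
    simpa using hs.2 j (Finset.mem_univ j)

/-- All that well-posedness uses of the stabilisation. In the abstract case the lower bound shows
that `w = v - I_T r v` has zero seminorm, so its reconstruction is constant and its residuals
vanish; `w` is then a constant velocity, and so is the interpolate of the constant `r v`. -/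
theorem isStab_spec [Finite ι] {s : M.LocalVel k Ψ Φ i → M.LocalVel k Ψ Φ i → ℝ} (hs : M.IsStab i s) :
    (∃ B : LinearMap.BilinForm ℝ (M.LocalVel k Ψ Φ i), ∀ u v, B u v = s u v) ∧
      (∀ v, 0 ≤ s v v) ∧ ∀ v, weakJac (M.elt i) (M.recon v) = 0 → s v v = 0 → ∃ c, IsConstVel v c := by
  have hfc := finiteDimensional_cellVel (k := k) hE i
  have hff := finiteDimensional_faceVel (k := k) hT hE
  have hfp := finiteDimensional_polyFace (M := M) (k := k)
  rcases hs with ⟨hB, -, hpos, C, hC, hb⟩ | rfl | rfl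
  · refine ⟨hB, hpos, fun v hv hsv => ?_⟩
    have hd := (hT i).diam_pos
    obtain ⟨c, hc⟩ := exists_ae_const_recon hT hE hv
    have hw := (hb v).1
    rw [hsv] at hw
    set w := v - M.interp i (M.recon v) with hw0
    have hw1 : M.seminormSq w ≤ 0 := by
      by_contra! h
      exact absurd hw (not_le.2 (by positivity))
    have hw2 : M.seminormSq w = 0 := le_antisymm hw1 (by unfold seminormSq; positivity)
    rw [seminormSq, add_eq_zero_iff_of_nonneg (by positivity) (by positivity),
      add_eq_zero_iff_of_nonneg (by positivity) (by positivity), mul_eq_zero, mul_eq_zero,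
      or_iff_right (by positivity), or_iff_right (by positivity),
      Finset.sum_eq_zero_iff_of_nonneg fun _ _ => by positivity] at hw2
    obtain ⟨⟨e1, e2⟩, e3⟩ := hw2
    obtain ⟨c', hc'⟩ := exists_ae_const_recon hT hE (v := w) (by simpa using e1)
    obtain ⟨k1, k2⟩ := isConstVel_of_residual_eq_zero hT hc' (M.cellVel k Ψ Φ i) (polyVecT_le_cellVel i)
      (fun j => M.faceVel k Ψ Φ j) (fun j => polyFace_le_faceVel (j : κ)) (by simpa using e2)
      (fun j => by simpa using e3 j (Finset.mem_univ j))
    -- `c'` is the value of `w` and `c` that of the reconstruction of `v`.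
    refine ⟨c' + c, ?_, fun j => ?_⟩
    · have e : (v.1 : L2 (E d) (M.elt i)) = (w.1 : L2 (E d) (M.elt i)) + M.recon v := by
        rw [hw0, Prod.fst_sub, Submodule.coe_sub]
        simp only [interp]
        rw [orthProj_of_mem _ (polyVecT_le_cellVel i (const_mem_polyVecT hc)), sub_add_cancel]
      rw [e]
      filter_upwards [Lp.coeFn_add (w.1 : L2 (E d) (M.elt i)) (M.recon v), k1, hc] with x h1 h2 h3
      rw [h1, Pi.add_apply, h2, h3]
    · have ht := trace_ae_eq_of_const (M.elt_open i) (hT i).bounded (M.isRegularFace j.2) hc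
      have e : (v.2 j : L2Face (E d) (M.face j)) = (w.2 j : L2Face (E d) (M.face j)) +
          trace (M.elt i) (M.face j) (M.recon v) := by
        rw [hw0, Prod.snd_sub, Pi.sub_apply, Submodule.coe_sub]
        simp only [interp]
        rw [orthProj_of_mem _ (polyFace_le_faceVel (j : κ) (const_mem_polyFace ht)), sub_add_cancel]
      rw [e]
      filter_upwards [Lp.coeFn_add (w.2 j : L2Face (E d) (M.face j))
        (trace (M.elt i) (M.face j) (M.recon v)), k2 j, ht] with x h1 h2 h3
      rw [h1, Pi.add_apply, h2, h3]
  · exact explicitStab_spec hT hE _ (polyVecT_le_cellVel i) _ fun j => polyFace_le_faceVel (j : κ)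
  · exact explicitStab_spec hT hE _ le_rfl _ fun j => le_rfl

end Reconstruction

end CurvedMesh

/-! ### Saddle point problems -/

/-- The system is a linear map from `V × Q` to the product of the duals, which has the same
dimension, so injectivity gives bijectivity. -/
theorem existsUnique_saddle {V Q : Type*} [AddCommGroup V] [Module ℝ V] [FiniteDimensional ℝ V]
    [AddCommGroup Q] [Module ℝ Q] [FiniteDimensional ℝ Q] (a : V →ₗ[ℝ] V →ₗ[ℝ] ℝ) (b : V →ₗ[ℝ] Q →ₗ[ℝ] ℝ)
    (hinj : ∀ u p, (∀ v, a u v + b v p = 0) → (∀ q, b u q = 0) → u = 0 ∧ p = 0) (ℓ : V →ₗ[ℝ] ℝ) :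
    ∃! x : V × Q, (∀ v, a x.1 v + b v x.2 = ℓ v) ∧ ∀ q, b x.1 q = 0 := by
  let L : V × Q →ₗ[ℝ] Module.Dual ℝ V × Module.Dual ℝ Q :=
    (a.coprod b.flip).prod (b ∘ₗ LinearMap.fst ℝ V Q)
  have hL : Function.Injective L := by
    rw [← LinearMap.ker_eq_bot, LinearMap.ker_eq_bot']
    rintro ⟨u, p⟩ h
    have h1 := congrArg Prod.fst h
    have h2 := congrArg Prod.snd h
    obtain ⟨rfl, rfl⟩ := hinj u p (fun v => LinearMap.congr_fun h1 v) (fun q => LinearMap.congr_fun h2 q)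
    rfl
  have hdim : Module.finrank ℝ (V × Q) = Module.finrank ℝ (Module.Dual ℝ V × Module.Dual ℝ Q) := by
    rw [Module.finrank_prod, Module.finrank_prod, Subspace.dual_finrank_eq, Subspace.dual_finrank_eq]
  have hsurj := (LinearMap.injective_iff_surjective_of_finrank_eq_finrank hdim).1 hL
  obtain ⟨x, hx⟩ := hsurj (ℓ, 0)
  refine ⟨x, ⟨fun v => ?_, fun q => ?_⟩, ?_⟩
  · exact LinearMap.congr_fun (congrArg Prod.fst hx) v
  · exact LinearMap.congr_fun (congrArg Prod.snd hx) q
  · rintro y ⟨hy1, hy2⟩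
    refine hL (Eq.trans ?_ hx.symm)
    exact Prod.ext (LinearMap.ext hy1) (LinearMap.ext hy2)

/-! ### Restriction of global functions to an element. -/

section Restrict

variable {d : ℕ} {V : Type*} [NormedAddCommGroup V] {Ω T : Set (E d)}

theorem restrictTo_ae_eq (h : T ⊆ Ω) (z : L2 V Ω) : restrictTo h z =ᵐ[volume.restrict T] z :=
  MemLp.coeFn_toLp _

theorem restrictTo_add (h : T ⊆ Ω) (z z' : L2 V Ω) :
    restrictTo h (z + z') = restrictTo h z + restrictTo h z' := by
  refine Lp.ext ?_
  filter_upwards [restrictTo_ae_eq h (z + z'), restrictTo_ae_eq h z, restrictTo_ae_eq h z',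
    Lp.coeFn_add (restrictTo h z) (restrictTo h z'),
    ae_restrict_of_ae_restrict_of_subset h (Lp.coeFn_add z z')] with x h1 h2 h3 h4 h5
  rw [h1, h5, h4, Pi.add_apply, Pi.add_apply, h2, h3]

theorem restrictTo_smul [NormedSpace ℝ V] (h : T ⊆ Ω) (c : ℝ) (z : L2 V Ω) :
    restrictTo h (c • z) = c • restrictTo h z := by
  refine Lp.ext ?_
  filter_upwards [restrictTo_ae_eq h (c • z), restrictTo_ae_eq h z, Lp.coeFn_smul c (restrictTo h z),
    ae_restrict_of_ae_restrict_of_subset h (Lp.coeFn_smul c z)] with x h1 h2 h3 h4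
  rw [h1, h4, h3, Pi.smul_apply, Pi.smul_apply, h2]

theorem restrictTo_zero (h : T ⊆ Ω) : restrictTo h (0 : L2 V Ω) = 0 := by
  simpa using restrictTo_add h (0 : L2 V Ω) 0

end Restrict

/-! ### The discrete problem as a linear system. -/

namespace CurvedMesh

variable {d : ℕ} {Ω : Set (E d)} {ι κ : Type*} [Fintype ι] [Fintype κ] {M : CurvedMesh Ω ι κ} {k : ℕ}
  {Ψ : ∀ i, Submodule ℝ (L2 (E d) (M.elt i))} {Φ : ∀ i, Submodule ℝ (L2 ℝ (M.elt i))}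

variable (M k Ψ Φ) in
/-- Discrete velocities that vanish on the boundary faces, as a subspace. -/
def velSpace : Submodule ℝ (M.GlobalVel k Ψ Φ) where
  carrier := M.velZero k Ψ Φ
  add_mem' := fun {u v} hu hv j hj => by rw [Prod.snd_add, Pi.add_apply, hu j hj, hv j hj, add_zero]
  zero_mem' := fun _ _ => rfl
  smul_mem' := fun c v hv j hj => by rw [Prod.smul_snd, Pi.smul_apply, hv j hj, smul_zero]

variable (M k Φ) in
/-- Discrete pressures, as a subspace. -/
def presSpace [IsFiniteMeasure ((volume : Measure (E d)).restrict Ω)] : Submodule ℝ (L2 ℝ Ω) where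
  carrier := M.presZero k Φ
  add_mem' := fun {p q} hp hq => ⟨fun i => by
    rw [restrictTo_add]; exact Submodule.add_mem _ (hp.1 i) (hq.1 i), by
    rw [integral_Lp_add, hp.2, hq.2, add_zero]⟩
  zero_mem' := ⟨fun i => by rw [restrictTo_zero]; exact Submodule.zero_mem _, by
    rw [integral_congr_ae (Lp.coeFn_zero ℝ 2 _)]; simp⟩
  smul_mem' := fun c p hp => ⟨fun i => by
    rw [restrictTo_smul]; exact Submodule.smul_mem _ c (hp.1 i), by
    rw [integral_Lp_smul, hp.2, smul_zero]⟩

/-- The elements cover `Ω` up to a null set, so a pressure is determined by its restrictions, which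
lie in finite-dimensional spaces. -/
theorem finiteDimensional_presSpace [IsFiniteMeasure ((volume : Measure (E d)).restrict Ω)] (hd : 1 ≤ d)
    (hE : M.IsEnrichment Ψ Φ) : FiniteDimensional ℝ (M.presSpace k Φ) := by
  have := finiteDimensional_cellPres (k := k) hE
  let R : M.presSpace k Φ →ₗ[ℝ] ∀ i, M.cellPres k Φ i :=
    { toFun := fun z i => ⟨restrictTo (M.elt_subset i) z.1, z.2.1 i⟩
      map_add' := fun z z' => funext fun i => Subtype.ext (restrictTo_add (M.elt_subset i) _ _)
      map_smul' := fun c z => funext fun i => Subtype.ext (restrictTo_smul (M.elt_subset i) _ _) }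
  refine Module.Finite.of_injective R fun z z' h => Subtype.ext (Lp.ext (M.ae_mem_elt hd fun i => ?_))
  have h1 : restrictTo (M.elt_subset i) z.1 = restrictTo (M.elt_subset i) z'.1 :=
    congrArg Subtype.val (congrFun h i)
  have h2 := restrictTo_ae_eq (M.elt_subset i) z.1
  rw [h1] at h2
  exact h2.symm.trans (restrictTo_ae_eq (M.elt_subset i) z'.1)

variable [∀ i, IsFiniteMeasure ((volume : Measure (E d)).restrict (M.elt i))]

section Forms

variable (hT : ∀ i, IsElement (M.elt i)) (hE : M.IsEnrichment Ψ Φ)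

include hT hE

theorem exists_bilin_ah {s : ∀ i, M.LocalVel k Ψ Φ i → M.LocalVel k Ψ Φ i → ℝ}
    (hs : ∀ i, M.IsStab i (s i)) :
    ∃ a : LinearMap.BilinForm ℝ (M.GlobalVel k Ψ Φ), ∀ u v, a u v = M.ah s u v := by
  choose B hB using fun i => (isStab_spec hT hE (hs i)).1
  let loc : ∀ i, M.GlobalVel k Ψ Φ →ₗ[ℝ] M.LocalVel k Ψ Φ i := fun i =>
    { toFun := fun v => M.localize v i
      map_add' := fun _ _ => rfl
      map_smul' := fun _ _ => rfl }
  let J : ∀ i, M.GlobalVel k Ψ Φ →ₗ[ℝ] L2 (Mat d) (M.elt i) := fun i =>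
    (isLinearMap_weakJac_recon hT hE (i := i)).mk' _ ∘ₗ loc i
  refine ⟨∑ i, ((innerₗ _).compl₁₂ (J i) (J i) + (B i).compl₁₂ (loc i) (loc i)), fun u v => ?_⟩
  simp only [LinearMap.sum_apply, LinearMap.add_apply, LinearMap.compl₁₂_apply, hB, ah]
  rfl

theorem exists_bilin_bh [IsFiniteMeasure ((volume : Measure (E d)).restrict Ω)] :
    ∃ b : M.GlobalVel k Ψ Φ →ₗ[ℝ] L2 ℝ Ω →ₗ[ℝ] ℝ, ∀ v q, b v q = M.bh v q := by
  let D : ∀ i, M.GlobalVel k Ψ Φ →ₗ[ℝ] L2 ℝ (M.elt i) := fun i =>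
    (isLinearMap_divRecon hT hE (i := i)).mk' _ ∘ₗ
    { toFun := fun v => M.localize v i
      map_add' := fun _ _ => rfl
      map_smul' := fun _ _ => rfl }
  let R : ∀ i, L2 ℝ Ω →ₗ[ℝ] L2 ℝ (M.elt i) := fun i =>
    { toFun := restrictTo (M.elt_subset i)
      map_add' := restrictTo_add _
      map_smul' := restrictTo_smul _ }
  refine ⟨∑ i, -((innerₗ _).compl₁₂ (D i) (R i)), fun u v => ?_⟩
  simp only [LinearMap.sum_apply, LinearMap.neg_apply, LinearMap.compl₁₂_apply, bh]
  rfl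

omit [Fintype κ] [∀ i, IsFiniteMeasure ((volume : Measure (E d)).restrict (M.elt i))] hT hE in
theorem exists_lin_load (f : L2 (E d) Ω) : ∃ ℓ : M.GlobalVel k Ψ Φ →ₗ[ℝ] ℝ, ∀ v, ℓ v = M.load f v := by
  refine ⟨∑ i, (innerₗ _ (restrictTo (M.elt_subset i) f)) ∘ₗ (M.cellVel k Ψ Φ i).subtype ∘ₗ
    LinearMap.proj i ∘ₗ LinearMap.fst ℝ _ _, fun v => ?_⟩
  simp only [LinearMap.sum_apply, load]
  rfl

/-! ### Uniqueness of the velocity -/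

/-- Every term of `a_h(u, u)` is nonnegative, so each vanishes and `u` is a constant `c i` on each
element and its faces. Neighbouring constants agree because the common face has positive area and a
single unknown; one of them is zero by the boundary condition. -/
theorem velocity_eq_zero (hd : 2 ≤ d) (hΩo : IsOpen Ω) (hΩc : IsConnected Ω) (hΩb : Bornology.IsBounded Ω)
    {s : ∀ i, M.LocalVel k Ψ Φ i → M.LocalVel k Ψ Φ i → ℝ} (hs : ∀ i, M.IsStab i (s i))
    {u : M.GlobalVel k Ψ Φ} (hu : u ∈ M.velZero k Ψ Φ) (ha : M.ah s u u = 0) : u = 0 := by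
  have hd1 : 1 ≤ d := by omega
  have hc : ∀ i, ∃ c, IsConstVel (M.localize u i) c := fun i => by
    rw [ah, Finset.sum_eq_zero_iff_of_nonneg fun i _ => add_nonneg real_inner_self_nonneg
      ((isStab_spec hT hE (hs i)).2.1 _)] at ha
    have h := ha i (Finset.mem_univ i)
    rw [add_eq_zero_iff_of_nonneg real_inner_self_nonneg ((isStab_spec hT hE (hs i)).2.1 _)] at h
    exact (isStab_spec hT hE (hs i)).2.2 _ (inner_self_eq_zero.1 h.1) h.2
  choose c hcu using hc
  have hface : ∀ i j (hj : M.face j ⊆ frontier (M.elt i)),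
      (u.2 j : L2Face (E d) (M.face j)) =ᵐ[surf (M.face j)] fun _ => c i := fun i j hj => (hcu i).2 ⟨j, hj⟩
  obtain ⟨i₀, j₀, hj, hjΩ, hne⟩ := M.exists_boundary_face hd hΩc hΩb
  have h0 : c i₀ = 0 := by
    refine eq_const_of_ae_const ((M.isRegularFace hj).measure_univ_pos hd1 (M.elt_open i₀) hne)
      (hface i₀ j₀ hj) ?_
    rw [hu j₀ hjΩ]
    exact Lp.coeFn_zero _ _ _
  have hall : ∀ i, c i = 0 := M.induction_on_elements hd1 hΩo hΩc.isPreconnected (P := fun i => c i = 0) h0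
    fun i i' j hjΩ hj hj' hi => by
      have hne : (M.face j).Nonempty := Set.nonempty_iff_ne_empty.2 fun h => hjΩ (h ▸ Set.empty_subset _)
      rw [← hi]
      exact eq_const_of_ae_const ((M.isRegularFace hj).measure_univ_pos hd1 (M.elt_open i) hne)
        (hface i' j hj') (hface i j hj)
  refine Prod.ext (funext fun i => Subtype.ext (Lp.ext ?_)) (funext fun j => Subtype.ext (Lp.ext ?_))
  · have := (hcu i).1
    rw [hall i] at this
    exact this.trans (Lp.coeFn_zero _ _ _).symm
  · obtain ⟨i, hi⟩ : ∃ i, M.face j ⊆ frontier (M.elt i) := by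
      rcases M.face_incidence j with ⟨i, _, _, h⟩ | ⟨i, h⟩
      · exact ⟨i, h.trans Set.inter_subset_left⟩
      · exact ⟨i, h.trans Set.inter_subset_left⟩
    have := hface i j hi
    rw [hall i] at this
    exact this.trans (Lp.coeFn_zero _ _ _).symm

/-! ### Uniqueness of the pressure -/

open scoped Classical in
omit [Fintype ι] [Fintype κ] [∀ i, IsFiniteMeasure ((volume : Measure (E d)).restrict (M.elt i))] hT hE in
variable (M) in
/-- The flux of `q` through the face `j`, extended by zero to the faces that are not in the boundary of
the element `i`. -/
def fluxOn (i : ι) (j : κ) (q : L2 ℝ (M.elt i)) : L2Face (E d) (M.face j) :=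
  if h : M.face j ⊆ frontier (M.elt i) then flux (M.elt_open i) (M.isRegularFace h) q else 0

omit [Fintype ι] in
-- The face sum runs over all faces, with zero flux off the element, so that the sums over elements
-- and faces can be interchanged.
theorem inner_divRecon (v : M.GlobalVel k Ψ Φ) (i : ι) {q : L2 ℝ (M.elt i)} (hq : q ∈ M.cellPres k Φ i) :
    inner ℝ (M.divRecon (M.localize v i)) q =
      -inner ℝ (v.1 i : L2 (E d) (M.elt i)) (weakGrad (M.elt i) q) +
        ∑ j, inner ℝ (v.2 j : L2Face (E d) (M.face j)) (M.fluxOn i j q) := by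
  rw [(isDivReconstruction_iff.1 (isDivReconstruction_divRecon hT hE (M.localize v i))).2 q hq]
  congr 1
  refine Fintype.sum_of_injective (Subtype.val : M.facesOf i → κ) Subtype.val_injective _ _ (fun j hj => ?_)
    fun j => ?_
  · have hj' : ¬ M.face j ⊆ frontier (M.elt i) := fun h => hj ⟨⟨j, h⟩, rfl⟩
    rw [fluxOn, dif_neg hj', inner_zero_right]
  · rw [fluxOn, dif_pos j.2]
    rfl

open scoped Classical in
theorem weakGrad_eq_zero_and_jump_eq_zero {p : L2 ℝ Ω}
    (hp : ∀ i, restrictTo (M.elt_subset i) p ∈ M.cellPres k Φ i)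
    (hb : ∀ v ∈ M.velZero k Ψ Φ, M.bh v p = 0) :
    (∀ i, weakGrad (M.elt i) (restrictTo (M.elt_subset i) p) = 0) ∧
      ∀ j, ¬ M.face j ⊆ frontier Ω → ∑ i, M.fluxOn i j (restrictTo (M.elt_subset i) p) = 0 := by
  set P := fun i => restrictTo (M.elt_subset i) p
  have hjump : ∀ j, ∑ i, M.fluxOn i j (P i) ∈ M.faceVel k Ψ Φ j := fun j => by
    refine Submodule.sum_mem _ fun i _ => ?_
    rw [fluxOn]
    split_ifs with h
    · exact flux_mem_faceVel hT hE h (hp i)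
    · exact Submodule.zero_mem _
  -- The test velocity: minus the gradient in the elements, the total flux of `p` on faces not
  -- contained in `∂Ω`, zero on the others. It makes `b_h(v, p)` equal to minus a sum of squares.
  let v : M.GlobalVel k Ψ Φ := (fun i => ⟨-weakGrad (M.elt i) (P i),
    Submodule.neg_mem _ (weakGrad_mem_cellVel hT hE (hp i))⟩,
    fun j => if M.face j ⊆ frontier Ω then 0 else ⟨∑ i, M.fluxOn i j (P i), hjump j⟩)
  have hv : v ∈ M.velZero k Ψ Φ := fun j hj => if_pos hj
  have h1 := hb v hv
  have h2 : ∀ j, inner ℝ (v.2 j : L2Face (E d) (M.face j)) (∑ i, M.fluxOn i j (P i)) =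
      ‖(v.2 j : L2Face (E d) (M.face j))‖ ^ 2 := fun j => by
    by_cases hj : M.face j ⊆ frontier Ω
    · rw [hv j hj]
      simp
    · have : (v.2 j : L2Face (E d) (M.face j)) = ∑ i, M.fluxOn i j (P i) :=
        congrArg Subtype.val (if_neg hj)
      rw [← this, real_inner_self_eq_norm_sq]
  have h3 : M.bh v p = -(∑ i, ‖weakGrad (M.elt i) (P i)‖ ^ 2 +
      ∑ j, ‖(v.2 j : L2Face (E d) (M.face j))‖ ^ 2) := by
    rw [bh, Finset.sum_neg_distrib]
    congr 1
    have h4 : ∀ i, inner ℝ (M.divRecon (M.localize v i)) (restrictTo (M.elt_subset i) p) =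
        ‖weakGrad (M.elt i) (P i)‖ ^ 2 +
          ∑ j, inner ℝ (v.2 j : L2Face (E d) (M.face j)) (M.fluxOn i j (P i)) := fun i => by
      rw [inner_divRecon hT hE v i (hp i)]
      congr 1
      change -inner ℝ (-weakGrad (M.elt i) (P i)) (weakGrad (M.elt i) (P i)) = _
      rw [inner_neg_left, neg_neg, real_inner_self_eq_norm_sq]
    rw [Finset.sum_congr rfl fun i _ => h4 i, Finset.sum_add_distrib, Finset.sum_comm]
    congr 1
    refine Finset.sum_congr rfl fun j _ => ?_
    rw [← inner_sum, h2]
  rw [h3, neg_eq_zero, add_eq_zero_iff_of_nonneg (by positivity) (by positivity),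
    Finset.sum_eq_zero_iff_of_nonneg fun _ _ => by positivity,
    Finset.sum_eq_zero_iff_of_nonneg fun _ _ => by positivity] at h1
  refine ⟨fun i => by simpa using h1.1 i (Finset.mem_univ i), fun j hj => ?_⟩
  have h5 : (v.2 j : L2Face (E d) (M.face j)) = 0 := by simpa using h1.2 j (Finset.mem_univ j)
  have h6 : (v.2 j : L2Face (E d) (M.face j)) = ∑ i, M.fluxOn i j (P i) := congrArg Subtype.val (if_neg hj)
  exact h6.symm.trans h5

omit [Fintype κ] hE in
-- Only the two neighbours contribute to the total flux, and their normals are opposite, so it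
-- equals `(c i - c i') n`.
theorem eq_of_jump_eq_zero (hd : 1 ≤ d) {q : ∀ i, L2 ℝ (M.elt i)} {c : ι → ℝ}
    (hq : ∀ i, q i =ᵐ[volume.restrict (M.elt i)] fun _ => c i) {i i' : ι} {j : κ}
    (hne : (M.face j).Nonempty) (hj : M.face j ⊆ frontier (M.elt i)) (hj' : M.face j ⊆ frontier (M.elt i'))
    (hjump : ∑ i, M.fluxOn i j (q i) = 0) : c i = c i' := by
  rcases eq_or_ne i i' with rfl | hii'
  · rfl
  classical
  have hsum : ∑ i, M.fluxOn i j (q i) = M.fluxOn i j (q i) + M.fluxOn i' j (q i') := by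
    refine Finset.sum_eq_add i i' hii' (fun a _ ha => ?_) (by simp) (by simp)
    rw [fluxOn, dif_neg]
    intro h
    rcases M.eq_or_eq_of_interface hii' hj hj' h hne with rfl | rfl
    · exact ha.1 rfl
    · exact ha.2 rfl
  have hfl : ∀ i, M.face j ⊆ frontier (M.elt i) →
      M.fluxOn i j (q i) =ᵐ[surf (M.face j)] fun x => c i • normal (M.elt i) x := fun i h => by
    rw [fluxOn, dif_pos h]
    filter_upwards [flux_ae_eq (M.elt_open i) (M.isRegularFace h) (q i),
      trace_ae_eq_of_const (M.elt_open i) (hT i).bounded (M.isRegularFace h) (hq i)] with x h1 h2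
    rw [h1, h2]
  rw [hsum] at hjump
  have hpos := (M.isRegularFace hj).measure_univ_pos hd (M.elt_open i) hne
  have : NeZero (surf (M.face j)) := ⟨fun h0 => hpos (by rw [h0]; rfl)⟩
  have hae := Lp.coeFn_add (M.fluxOn i j (q i)) (M.fluxOn i' j (q i'))
  rw [hjump] at hae
  obtain ⟨x, h1, h2, h3, h4, h5, h6⟩ := ((hfl i hj).and ((hfl i' hj').and (hae.and
    ((Lp.coeFn_zero (E d) 2 (surf (M.face j))).and ((M.isRegularFace hj).ae_norm_normal.and
      (ae_restrict_mem (M.isRegularFace hj).measurableSet)))))).exists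
  rw [h4, Pi.add_apply, h1, h2] at h3
  dsimp only at h3
  rw [M.normal_eq_neg hii' hj hj' h6, Pi.zero_apply, smul_neg, ← sub_eq_add_neg, ← sub_smul] at h3
  have hn : normal (M.elt i) x ≠ 0 := by rw [← norm_ne_zero_iff, h5]; exact one_ne_zero
  exact sub_eq_zero.1 ((smul_eq_zero.1 h3.symm).resolve_right hn)

/-- Zero gradient makes `p` constant on each element, the absence of jumps propagates the constant
through interior faces, and the zero mean over `Ω`, of positive volume, makes it vanish. -/
theorem pressure_eq_zero (hd : 2 ≤ d) (hΩo : IsOpen Ω) (hΩc : IsConnected Ω) (hΩb : Bornology.IsBounded Ω)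
    {p : L2 ℝ Ω} (hp : p ∈ M.presZero k Φ) (hb : ∀ v ∈ M.velZero k Ψ Φ, M.bh v p = 0) : p = 0 := by
  have hd1 : 1 ≤ d := by omega
  obtain ⟨hgrad, hjump⟩ := weakGrad_eq_zero_and_jump_eq_zero hT hE hp.1 hb
  choose c hc using fun i => exists_ae_const_of_weakGrad_eq_zero (M.elt_open i)
    (M.elt_connected i).isPreconnected (cellPres_le_h1 hT hE i (hp.1 i)) (hgrad i)
  obtain ⟨i₀, -⟩ := M.exists_boundary_face hd hΩc hΩb
  have hall : ∀ i, c i = c i₀ := M.induction_on_elements hd1 hΩo hΩc.isPreconnected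
    (P := fun i => c i = c i₀) rfl fun i i' j hjΩ hj hj' hi => by
      have hne : (M.face j).Nonempty := Set.nonempty_iff_ne_empty.2 fun h => hjΩ (h ▸ Set.empty_subset _)
      rw [← hi]
      exact eq_of_jump_eq_zero hT hd1 hc hne hj' hj (hjump j hjΩ)
  have hpc : p =ᵐ[volume.restrict Ω] fun _ => c i₀ := M.ae_mem_elt hd1 fun i => by
    have := (restrictTo_ae_eq (M.elt_subset i) p).symm.trans (hc i)
    rwa [hall i] at this
  have hint := hp.2
  have hvol : (volume : Measure (E d)).real Ω ≠ 0 :=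
    (ENNReal.toReal_pos (hΩo.measure_pos _ hΩc.nonempty).ne' hΩb.measure_lt_top.ne).ne'
  rw [integral_of_ae_const hpc, smul_eq_zero, or_iff_right hvol] at hint
  rw [hint] at hpc
  exact Lp.ext (hpc.trans (Lp.coeFn_zero _ _ _).symm)

/-! ### Well-posedness -/

theorem existsUnique_isDiscreteSolution (hd : 2 ≤ d) (hΩo : IsOpen Ω) (hΩc : IsConnected Ω)
    (hΩb : Bornology.IsBounded Ω) {s : ∀ i, M.LocalVel k Ψ Φ i → M.LocalVel k Ψ Φ i → ℝ}
    (hs : ∀ i, M.IsStab i (s i)) {ν : ℝ} (hν : 0 < ν) (f : L2 (E d) Ω) :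
    ∃! x : M.GlobalVel k Ψ Φ × L2 ℝ Ω, M.IsDiscreteSolution ν f s x.1 x.2 := by
  have := isFiniteMeasure_restrict_of_isBounded hΩb
  have := finiteDimensional_cellVel (k := k) hE
  have := finiteDimensional_faceVel (k := k) hT hE
  have := finiteDimensional_presSpace (k := k) (by omega) hE
  obtain ⟨a, ha⟩ := exists_bilin_ah hT hE hs
  obtain ⟨b, hb⟩ := exists_bilin_bh (k := k) hT hE
  obtain ⟨ℓ, hℓ⟩ := exists_lin_load (M := M) (k := k) (Ψ := Ψ) (Φ := Φ) f
  let V := M.velSpace k Ψ Φ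
  let Q := M.presSpace k Φ
  obtain ⟨⟨u, p⟩, ⟨h1, h2⟩, h3⟩ := existsUnique_saddle (V := V) (Q := Q) (ν • a.compl₁₂ V.subtype V.subtype)
    (b.compl₁₂ V.subtype Q.subtype) (fun u p h1 h2 => by
      have h1' : ∀ v ∈ V, ν * M.ah s u v + M.bh v p = 0 := fun v hv => by
        rw [← ha, ← hb]; exact h1 ⟨v, hv⟩
      have h2' : ∀ q ∈ Q, M.bh u q = 0 := fun q hq => by
        rw [← hb]; exact h2 ⟨q, hq⟩
      have hau : M.ah s u u = 0 := by
        have := h1' u u.2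
        rw [h2' p p.2, add_zero] at this
        exact (mul_eq_zero.1 this).resolve_left hν.ne'
      have hu : (u : M.GlobalVel k Ψ Φ) = 0 := velocity_eq_zero hT hE hd hΩo hΩc hΩb hs u.2 hau
      refine ⟨Subtype.ext hu, Subtype.ext (pressure_eq_zero hT hE hd hΩo hΩc hΩb p.2 fun v hv => ?_)⟩
      have := h1' v hv
      rwa [← ha, hu, map_zero, LinearMap.zero_apply, mul_zero, zero_add] at this)
    (ℓ ∘ₗ V.subtype)
  -- Translation between solutions in the subspaces and the formulation with membership conditions.
  have key : ∀ (u : V) (p : Q), M.IsDiscreteSolution ν f s u p ↔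
      (∀ v : V, (ν • a.compl₁₂ V.subtype V.subtype) u v + (b.compl₁₂ V.subtype Q.subtype) v p =
        (ℓ ∘ₗ V.subtype) v) ∧ ∀ q : Q, (b.compl₁₂ V.subtype Q.subtype) u q = 0 := by
    intro u p
    constructor
    · rintro ⟨-, -, h1, h2⟩
      refine ⟨fun v => ?_, fun q => ?_⟩
      · have := h1 v v.2
        rwa [← ha, ← hb, ← hℓ] at this
      · have := h2 q q.2
        rwa [← hb, neg_eq_zero] at this
    · rintro ⟨h1, h2⟩
      refine ⟨u.2, p.2, fun v hv => ?_, fun q hq => ?_⟩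
      · rw [← ha, ← hb, ← hℓ]; exact h1 ⟨v, hv⟩
      · rw [← hb, neg_eq_zero]; exact h2 ⟨q, hq⟩
  refine ⟨(u, p), (key u p).2 ⟨h1, h2⟩, ?_⟩
  rintro ⟨u', p'⟩ hx
  have h4 := h3 (⟨u', hx.1⟩, ⟨p', hx.2.1⟩) ((key ⟨u', hx.1⟩ ⟨p', hx.2.1⟩).1 hx)
  exact Prod.ext (congrArg (fun y : V × Q => (y.1 : M.GlobalVel k Ψ Φ)) h4)
    (congrArg (fun y : V × Q => (y.2 : L2 ℝ Ω)) h4)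

end Forms

end CurvedMesh

end EnrichedHHO

end

/-! ### The theorem. -/

theorem theorem1 {d : ℕ} (hd : 2 ≤ d) {Ω : Set (E d)} (hΩo : IsOpen Ω) (hΩc : IsConnected Ω)
    (hΩb : Bornology.IsBounded Ω) {ι κ : Type*} [Fintype ι] [Fintype κ]
    (M : CurvedMesh Ω ι κ) (hM : M.IsRegular) (k : ℕ)
    (Ψ : ∀ i, Submodule ℝ (L2 (E d) (M.elt i))) (Φ : ∀ i, Submodule ℝ (L2 ℝ (M.elt i)))
    (hE : M.IsEnrichment Ψ Φ)
    (s : ∀ i, M.LocalVel k Ψ Φ i → M.LocalVel k Ψ Φ i → ℝ) (hs : ∀ i, M.IsStab i (s i))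
    (ν : ℝ) (hν : 0 < ν) (f : L2 (E d) Ω) :
    (∀ i, ∀ v : M.LocalVel k Ψ Φ i,
      (∃! r, M.IsReconstruction v r) ∧ ∃! D, M.IsDivReconstruction v D) ∧
    ∃! x : M.GlobalVel k Ψ Φ × L2 ℝ Ω, M.IsDiscreteSolution ν f s x.1 x.2 := by
  have hT : ∀ i, IsElement (M.elt i) := CurvedMesh.isElement hd hΩb hM
  have := fun i => (hT i).isFiniteMeasure
  exact ⟨fun i v => ⟨CurvedMesh.existsUnique_isReconstruction hT hE v,
    CurvedMesh.existsUnique_isDivReconstruction hT hE v⟩,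
    CurvedMesh.existsUnique_isDiscreteSolution hT hE hd hΩo hΩc hΩb hs hν f⟩
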